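/- Let $\mathfrak g$ be a finite-dimensional simple Lie algebra over $\mathbb C$ with an $\mathfrak{sl}_2$-triple $(e,h,f)$, where $f$ is a minimal nilpotent element (nonzero, nilpotent, and lying in the closure of every nonzero nilpotent adjoint orbit). Put $x=h/2$, $\mathfrak g(i)=\{a\in\mathfrak g : [x,a]=ia\}$, $\mathfrak n=\bigoplus_{i\ge 1/2}\mathfrak g(i)$, $\mathfrak g_f=\{a\in\mathfrak g:[a,f]=0\}$. Let $(\cdot,\cdot)$ be the invariant symmetric bilinear form with $(e,f)=1$, $(h,h)=2$. Let $d$ be the largest eigenvalue of $\operatorname{ad}x$, let $p\in\mathfrak g(d)$ (so $p$ commutes with $\mathfrak n$), let $k\in\mathbb C$ and let $m>0$ be an integer. On the loop algebra $\hat{\mathfrak g}=\mathfrak g[z,z^{-1}]$, with $[az^i,bz^j]=[a,b]z^{i+j}$ and $(az^i,bz^j)=(a,b)\delta_{i+j,0}$, give $az^j$ ($a\in\mathfrak g(i)$) the degree $(d+1)j+i$, and write $\hat{\mathfrak g}_q$ for the degree $q$ component and $\hat{\mathfrak g}_{>q}=\bigoplus_{r>q}\hat{\mathfrak g}_r$.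 Let $\hat{\mathfrak g}^{+}=\mathfrak g[z]/\hat{\mathfrak g}_{>(d+1)m+1}$, $\Lambda_m=-fz^{-m}-pz^{-m-1}$, and let $$\mathcal V=S(\mathbb C[\partial]\otimes\hat{\mathfrak g}^{+})/I,$$ where $I$ is the differential ideal generated by the elements $a-(\Lambda_m,a)$, $a\in\hat{\mathfrak g}_{(d+1)m+1}$. For $n\in\mathfrak n$ let $\operatorname{ad}_\lambda n:\mathcal V\to\mathcal V[\lambda]$ be the linear map determined by $$(\operatorname{ad}_\lambda n)(az^i)=[n,a]z^i+\delta_{i,0}\,k\lambda\,(n,a),\qquad (\operatorname{ad}_\lambda n)(\partial A)=(\partial+\lambda)(\operatorname{ad}_\lambda n)(A),$$ $$(\operatorname{ad}_\lambda n)(AB)=B\,(\operatorname{ad}_\lambda n)(A)+A\,(\operatorname{ad}_\lambda n)(B),$$ and let $\mathcal W(\mathfrak g,\Lambda_m,k)=\{A\in\mathcal V:(\operatorname{ad}_\lambda n)(A)=0\text{ for all }n\in\mathfrak n\}$ be the $m$-th classical affine fractional $\mathcal W$-algebra. Let $\{z_i\}_{i=1}^{2s}$ and $\{z_i^*\}_{i=1}^{2s}$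 be bases of $\mathfrak g(\tfrac12)$ with $[z_i,z_j^*]=\delta_{ij}e$, and put $z_{2s+1}=x$, $z_{2s+1}^*=e$. Let $\tilde\eta_m:\hat{\mathfrak g}^{+}\to\mathcal V$ be the linear map $$\tilde\eta_m(a)=\sum_{l=0}^{4}\ \sum_{i_1,\dots,i_l=1}^{2s+1}\frac1{l!}\,(z_{i_1}z^m)\cdots(z_{i_l}z^m)\,\{a,z_{i_1}^*,\dots,z_{i_l}^*\},$$ where $\{a,y_1,\dots,y_l\}=[\cdots[[a,y_1],y_2],\cdots,y_l]$. Let $\eta_m:\hat{\mathfrak g}^{+}\to\mathcal V$ be a linear map such that * $\eta_m(a)=\tilde\eta_m(a)$ for $a\in\bigoplus_{i\ge0}\mathfrak g(i)\,z^0\ \oplus\ \bigoplus_{t=1}^{m-1}\mathfrak g z^t\ \oplus\ \mathfrak g_f z^m$; * $\eta_m(b)=\tilde\eta_m(b)-\sum_{i=1}^{2s}(z_i^*,b)\,k\,\partial(z_iz^m)$ for $b\in\mathfrak g(-\tfrac12)z^0$; * $\eta_m(f)=\tilde\eta_m(f)-k\,\partial(xz^m)-\frac k2\sum_{i=1}^{2s}\partial(z_i^*z^m)\,(z_iz^m)$.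 Such a linear map $\eta_m$ exists, and for every such $\eta_m$ the differential algebra $\mathcal W(\mathfrak g,\Lambda_m,k)$ is freely generated by the subspace $\eta_m\big(\bigoplus_{i=0}^{m-1}\mathfrak g z^i\oplus\mathfrak g_f z^m\big)$: for every basis $(b_j)_j$ of $\bigoplus_{i=0}^{m-1}\mathfrak g z^i\oplus\mathfrak g_f z^m\subset\hat{\mathfrak g}^{+}$, the elements $\partial^n\eta_m(b_j)$, $n\ge0$, are algebraically independent over $\mathbb C$ and generate $\mathcal W(\mathfrak g,\Lambda_m,k)$ as an algebra. -/

import Mathlib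

open scoped TensorProduct Polynomial

noncomputable section

namespace FractionalW

/-! ### Derivations of symmetric algebras -/

section Derivations

variable {M A : Type*} [AddCommGroup M] [Module ℂ M] [CommRing A] [Algebra ℂ A]
  [Algebra (SymmetricAlgebra ℂ M) A] [IsScalarTower ℂ (SymmetricAlgebra ℂ M) A]

/-- The algebra homomorphism `s ↦ s + ε D s` into the dual numbers over `A` with
`D v = φ v` for `v ∈ M`. -/
def dualHom (φ : M →ₗ[ℂ] A) : SymmetricAlgebra ℂ M →ₐ[ℂ] DualNumber A :=
  SymmetricAlgebra.lift
    ((TrivSqZeroExt.inlAlgHom ℂ A A).toLinearMap ∘ₗ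
        (IsScalarTower.toAlgHom ℂ (SymmetricAlgebra ℂ M) A).toLinearMap ∘ₗ SymmetricAlgebra.ι ℂ M +
      ((TrivSqZeroExt.inrHom A A).restrictScalars ℂ) ∘ₗ φ)

theorem fst_dualHom (φ : M →ₗ[ℂ] A) (s : SymmetricAlgebra ℂ M) :
    (dualHom φ s).fst = algebraMap (SymmetricAlgebra ℂ M) A s := by
  have h : (TrivSqZeroExt.fstHom ℂ A A).comp (dualHom φ) =
      IsScalarTower.toAlgHom ℂ (SymmetricAlgebra ℂ M) A := by
    apply SymmetricAlgebra.algHom_ext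
    ext v
    simp [dualHom]
  exact DFunLike.congr_fun h s

/-- The derivation of the symmetric algebra `S(M)` with values in an `S(M)`-algebra `A` that
extends a given linear map `φ : M → A`. -/
def symDer (φ : M →ₗ[ℂ] A) : Derivation ℂ (SymmetricAlgebra ℂ M) A :=
  Derivation.mk'
    ((((TrivSqZeroExt.sndHom A A).restrictScalars ℂ) ∘ₗ (dualHom φ).toLinearMap))
    (fun a b => by
      simp [fst_dualHom, Algebra.smul_def]
      try ring)

theorem symDer_ι (φ : M →ₗ[ℂ] A) (v : M) : symDer φ (SymmetricAlgebra.ι ℂ M v) = φ v := by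
  simp [symDer, dualHom]

end Derivations

section Quotients

variable {S A : Type*} [CommRing S] [Algebra ℂ S] [CommRing A] [Algebra ℂ A]
  (I : Ideal S) [Algebra S A] [Algebra (S ⧸ I) A] [IsScalarTower S (S ⧸ I) A]

theorem der_eq_zero_of_mem_span {G : Set S} (hI : I = Ideal.span G) (D : Derivation ℂ S A)
    (hD : ∀ g ∈ G, D g = 0) (s : S) (hs : s ∈ I) : D s = 0 := by
  have hz : ∀ g ∈ I, ∀ a : A, g • a = 0 := fun g hg a => by
    rw [← algebraMap_smul (S ⧸ I) g a, Ideal.Quotient.algebraMap_eq,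
      Ideal.Quotient.eq_zero_iff_mem.2 hg, zero_smul]
  subst hI
  induction hs using Submodule.span_induction with
  | mem g hg => exact hD g hg
  | zero => simp
  | add a b _ _ ha hb => simp [ha, hb]
  | smul a b hb ih => simp [ih, hz b hb]

/-- A derivation of `S` into an `S ⧸ I`-algebra that kills `I` descends to `S ⧸ I`. -/
def quotDer (D : Derivation ℂ S A) (hD : ∀ s ∈ I, D s = 0) : Derivation ℂ (S ⧸ I) A :=
  Derivation.mk'
    (((I.restrictScalars ℂ).liftQ D.toLinearMap (fun s hs => hD s hs)) ∘ₗ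
      (Submodule.Quotient.restrictScalarsEquiv ℂ I).symm.toLinearMap)
    (fun a b => by
      obtain ⟨a, rfl⟩ := Ideal.Quotient.mk_surjective a
      obtain ⟨b, rfl⟩ := Ideal.Quotient.mk_surjective b
      have h : ∀ (s : S) (x : A), Ideal.Quotient.mk I s • x = s • x := fun s x =>
        algebraMap_smul (S ⧸ I) s x
      rw [h, h, ← map_mul]
      exact D.leibniz a b)

theorem quotDer_mk (D : Derivation ℂ S A) (hD : ∀ s ∈ I, D s = 0) (s : S) :
    quotDer I D hD (Ideal.Quotient.mk I s) = D s := rfl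

end Quotients

section LambdaShift

variable {A : Type*} [CommRing A] [Algebra ℂ A]

/-- For a derivation `∂` of `A`, the operator `∂ + λ` on `A[λ]` (with `∂ λ = 0`). -/
def shift (D : Derivation ℂ A A) : Module.End ℂ A[X] :=
  (Polynomial.lsum fun n => (Polynomial.monomial n).restrictScalars ℂ ∘ₗ D.toLinearMap) +
    LinearMap.mulLeft ℂ (Polynomial.X : A[X])

theorem shift_C (D : Derivation ℂ A A) (a : A) :
    shift D (Polynomial.C a) = Polynomial.C (D a) + Polynomial.X * Polynomial.C a := by
  simp [shift, Polynomial.lsum]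

theorem shift_C_mul (D : Derivation ℂ A A) (a : A) (p : A[X]) :
    shift D (Polynomial.C a * p) = Polynomial.C (D a) * p + Polynomial.C a * shift D p := by
  induction p using Polynomial.induction_on' with
  | add p q hp hq => simp only [mul_add, map_add, hp, hq]; ring
  | monomial n b =>
    simp only [shift, Polynomial.lsum, Polynomial.C_mul_monomial, LinearMap.add_apply,
      LinearMap.coe_mk, AddHom.coe_mk, LinearMap.comp_apply, LinearMap.restrictScalars_apply,
      Derivation.coeFn_coe, map_zero, Polynomial.sum_monomial_index, Derivation.leibniz,
      smul_eq_mul, map_add, LinearMap.mulLeft_apply, Polynomial.X_mul_monomial, mul_add,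
      mul_comm b (D a)]
    ring

end LambdaShift

/-! ### Minimal nilpotent elements -/

section MinimalNilpotent

variable (𝔤 : Type*) [LieRing 𝔤] [LieAlgebra ℂ 𝔤]

/-- The adjoint group: the subgroup of `GL(𝔤)` generated by the automorphisms `exp (ad u)` with
`u` ad-nilpotent. -/
def adjointGroup : Subgroup (𝔤 ≃ₗ[ℂ] 𝔤) :=
  Subgroup.closure {φ | ∃ (u : 𝔤) (n : ℕ), LieAlgebra.ad ℂ 𝔤 u ^ n = 0 ∧
    (φ : 𝔤 →ₗ[ℂ] 𝔤) =
      ∑ j ∈ Finset.range n, ((j.factorial : ℂ)⁻¹) • LieAlgebra.ad ℂ 𝔤 u ^ j}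

/-- The algebra of complex-valued polynomial functions on `𝔤`. -/
def polynomialFunctions : Subalgebra ℂ (𝔤 → ℂ) :=
  Algebra.adjoin ℂ {F | ∃ φ : Module.Dual ℂ 𝔤, F = φ}

variable {𝔤}

/-- The adjoint orbit of `y`. -/
def adjointOrbit (y : 𝔤) : Set 𝔤 := {x | ∃ φ ∈ adjointGroup 𝔤, x = φ y}

/-- The Zariski closure of a subset of `𝔤`. -/
def zariskiClosure (s : Set 𝔤) : Set 𝔤 :=
  {x | ∀ F ∈ polynomialFunctions 𝔤, (∀ y ∈ s, F y = 0) → F x = 0}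

/-- `f` is a minimal nilpotent element: it is nonzero and nilpotent, and its adjoint orbit is the
least nonzero nilpotent orbit for the closure order, that is, it lies in the closure of every
nonzero nilpotent orbit. -/
structure IsMinimalNilpotent (f : 𝔤) : Prop where
  ne_zero : f ≠ 0
  nilpotent : IsNilpotent (LieAlgebra.ad ℂ 𝔤 f)
  mem_closure : ∀ y : 𝔤, y ≠ 0 → IsNilpotent (LieAlgebra.ad ℂ 𝔤 y) →
    f ∈ zariskiClosure (adjointOrbit y)

end MinimalNilpotent

/-! ### The loop algebra and its two gradations -/

section Loop

variable {𝔤 : Type*} [LieRing 𝔤] [LieAlgebra ℂ 𝔤]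

/-- `𝔤(i)`, the eigenspace of `ad (h/2)` with eigenvalue `i`. -/
def gr (h : 𝔤) (i : ℚ) : Submodule ℂ 𝔤 :=
  Module.End.eigenspace (LieAlgebra.ad ℂ 𝔤 ((1 / 2 : ℂ) • h)) (i : ℂ)

theorem lie_mem_gr {h : 𝔤} {i j : ℚ} {a b : 𝔤} (ha : a ∈ gr h i) (hb : b ∈ gr h j) :
    ⁅a, b⁆ ∈ gr h (i + j) := by
  rw [gr, Module.End.mem_eigenspace_iff, LieAlgebra.ad_apply] at *
  rw [leibniz_lie, ha, hb, smul_lie, lie_smul]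
  push_cast
  rw [add_smul]

/-- `𝔫 = ⨁_{i ≥ 1/2} 𝔤(i)`. -/
def nil (h : 𝔤) : Submodule ℂ 𝔤 := ⨆ (i : ℚ) (_ : 1 / 2 ≤ i), gr h i

variable (𝔤) in
/-- The loop algebra `ĝ = ℂ[z, z⁻¹] ⊗ 𝔤`. -/
def Loop : Type _ := LieAlgebra.loopAlgebra ℂ ℤ 𝔤

instance : LieRing (Loop 𝔤) := inferInstanceAs (LieRing (LieAlgebra.loopAlgebra ℂ ℤ 𝔤))

instance : LieAlgebra ℂ (Loop 𝔤) := inferInstanceAs (LieAlgebra ℂ (LieAlgebra.loopAlgebra ℂ ℤ 𝔤))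

/-- The element `a z^j` of the loop algebra. -/
def zp (j : ℤ) : 𝔤 →ₗ[ℂ] Loop 𝔤 where
  toFun a := (AddMonoidAlgebra.single j (1 : ℂ) ⊗ₜ[ℂ] a : LieAlgebra.loopAlgebra ℂ ℤ 𝔤)
  map_add' a b := TensorProduct.tmul_add _ a b
  map_smul' c a := TensorProduct.tmul_smul c _ a

theorem lie_zp (i j : ℤ) (a b : 𝔤) : ⁅zp i a, zp j b⁆ = zp (i + j) ⁅a, b⁆ := by
  have h : ⁅zp i a, zp j b⁆ = ((AddMonoidAlgebra.single i (1 : ℂ) *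
    AddMonoidAlgebra.single j (1 : ℂ)) ⊗ₜ[ℂ] ⁅a, b⁆ : LieAlgebra.loopAlgebra ℂ ℤ 𝔤) := rfl
  rw [h, AddMonoidAlgebra.single_mul_single, one_mul]
  rfl

/-- The bilinear form on `ℂ[z, z⁻¹] ⊗ 𝔤` given by `(p ⊗ a, q ⊗ b) = (p q)₀ (a, b)`, where `(p q)₀`
is the constant coefficient of `p q`. -/
def loopFormAux (B : LinearMap.BilinForm ℂ 𝔤) :
    LinearMap.BilinForm ℂ (LieAlgebra.loopAlgebra ℂ ℤ 𝔤) :=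
  LinearMap.BilinForm.tmul
    ((LinearMap.mul ℂ (AddMonoidAlgebra ℂ ℤ)).compr₂ ((AddMonoidAlgebra.basis ℤ ℂ).coord 0)) B

/-- The bilinear form `(a z^i, b z^j) = (a, b) δ_{i+j,0}` on `ĝ`. -/
def loopForm (B : LinearMap.BilinForm ℂ 𝔤) : LinearMap.BilinForm ℂ (Loop 𝔤) :=
  LinearMap.mk₂ ℂ (fun u v => loopFormAux B u v)
    (fun u u' v => LinearMap.congr_fun ((loopFormAux B).map_add u u') v)
    (fun c u v => LinearMap.congr_fun ((loopFormAux B).map_smul c u) v)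
    (fun u v v' => (loopFormAux B u).map_add v v')
    (fun c u v => (loopFormAux B u).map_smul c v)

theorem loopForm_zp (B : LinearMap.BilinForm ℂ 𝔤) (i j : ℤ) (a b : 𝔤) :
    loopForm B (zp i a) (zp j b) = if i + j = 0 then B a b else 0 := by
  have h : loopForm B (zp i a) (zp j b) =
      B a b • ((AddMonoidAlgebra.basis ℤ ℂ).coord 0)
        ((AddMonoidAlgebra.single i (1 : ℂ)) * AddMonoidAlgebra.single j 1) := rfl
  rw [h, AddMonoidAlgebra.single_mul_single, one_mul, ← AddMonoidAlgebra.basis_apply,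
    Module.Basis.coord_apply, Module.Basis.repr_self, Finsupp.single_apply]
  split_ifs <;> simp

/-- The homogeneous component `ĝ_q` of the second gradation, in which `𝔤(i) z^j` has degree
`(d+1) j + i`. -/
def loopGr (h : 𝔤) (d q : ℚ) : Submodule ℂ (Loop 𝔤) :=
  Submodule.span ℂ {x | ∃ (i : ℚ) (j : ℤ), ∃ a ∈ gr h i, (d + 1) * j + i = q ∧ x = zp j a}

/-- `ĝ_{>q}`. -/
def loopGT (h : 𝔤) (d q : ℚ) : Submodule ℂ (Loop 𝔤) :=
  ⨆ (r : ℚ) (_ : q < r), loopGr h d r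

variable (𝔤) in
/-- `ĝ^{≥0}`, spanned by the `a z^j` with `j ≥ 0`. -/
def loopNonneg : Submodule ℂ (Loop 𝔤) :=
  ⨆ (j : ℕ), LinearMap.range (zp (𝔤 := 𝔤) (j : ℤ))

end Loop

/-! ### The data defining a fractional W-algebra -/

/-- The data `(𝔤, (e, h, f), (·,·), p, m, k)` of a classical affine fractional W-algebra. -/
structure Datum (𝔤 : Type*) [LieRing 𝔤] [LieAlgebra ℂ 𝔤] where
  e : 𝔤
  h : 𝔤
  f : 𝔤
  sl2 : IsSl2Triple h e f
  /-- the invariant bilinear form `(·,·)` -/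
  form : LinearMap.BilinForm ℂ 𝔤
  form_symm : form.IsSymm
  form_invariant : form.lieInvariant 𝔤
  form_e_f : form e f = 1
  form_h_h : form h h = 2
  /-- the largest eigenvalue of `ad (h/2)` -/
  d : ℚ
  d_greatest : IsGreatest {i : ℚ | gr h i ≠ ⊥} d
  /-- an element of the top component that commutes with `𝔫` -/
  p : 𝔤
  p_mem : p ∈ gr h d
  lie_p : ∀ n ∈ nil h, ⁅p, n⁆ = 0
  m : ℕ
  k : ℂ

namespace Datum

variable {𝔤 : Type*} [LieRing 𝔤] [LieAlgebra ℂ 𝔤] (W : Datum 𝔤)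

/-- `x = h/2`. -/
def x : 𝔤 := (1 / 2 : ℂ) • W.h

/-- The degree `(d+1) m + 1`. -/
def topDeg : ℚ := (W.d + 1) * W.m + 1

theorem e_mem : W.e ∈ gr W.h 1 := by
  rw [gr, Module.End.mem_eigenspace_iff, LieAlgebra.ad_apply, smul_lie, W.sl2.lie_h_e_smul ℂ,
    smul_smul]
  norm_num

theorem one_le_d : 1 ≤ W.d := by
  apply W.d_greatest.2
  have he := W.e_mem
  intro hb
  rw [hb] at he
  exact W.sl2.e_ne_zero ((Submodule.mem_bot ℂ).1 he)

theorem topDeg_pos : 0 < W.topDeg := by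
  have := W.one_le_d
  unfold topDeg
  positivity

theorem form_eq_zero {i j : ℚ} (hij : i + j ≠ 0) {a b : 𝔤} (ha : a ∈ gr W.h i)
    (hb : b ∈ gr W.h j) : W.form a b = 0 := by
  rw [gr, Module.End.mem_eigenspace_iff, LieAlgebra.ad_apply] at ha hb
  have h := W.form_invariant ((1 / 2 : ℂ) • W.h) a b
  rw [ha, hb, map_smul, map_smul, LinearMap.smul_apply, smul_eq_mul, smul_eq_mul] at h
  have h2 : ((i + j : ℚ) : ℂ) * W.form a b = 0 := by
    push_cast
    linear_combination h
  exact (mul_eq_zero.1 h2).resolve_left (by exact_mod_cast hij)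

/-- `Λ_m = - f z^{-m} - p z^{-m-1}`. -/
def Lam : Loop 𝔤 := -zp (-(W.m : ℤ)) W.f - zp (-(W.m : ℤ) - 1) W.p

/-- `χ(a) = (Λ_m, a)`. -/
def chi : Module.Dual ℂ (Loop 𝔤) := loopForm W.form W.Lam

/-- The subspace of `ĝ^{≥0}` of elements lying in `ĝ_{>(d+1)m+1}`. -/
def high : Submodule ℂ (loopNonneg 𝔤) := (loopGT W.h W.d W.topDeg).comap (loopNonneg 𝔤).subtype

/-- `ĝ⁺_{[d,m]} = ĝ^{≥0} / ĝ_{>(d+1)m+1}`. -/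
abbrev gPlus : Type _ := loopNonneg 𝔤 ⧸ W.high

/-- The class of `a z^j` in `ĝ⁺_{[d,m]}`. -/
def cls (j : ℕ) : 𝔤 →ₗ[ℂ] W.gPlus :=
  W.high.mkQ ∘ₗ (zp (j : ℤ)).codRestrict (loopNonneg 𝔤)
    (fun a => Submodule.mem_iSup_of_mem j ⟨a, rfl⟩)

/-! ### The action of `𝔫` on `ĝ⁺_{[d,m]}` -/

theorem lie_mem_nonneg (n : 𝔤) {a : Loop 𝔤} (ha : a ∈ loopNonneg 𝔤) :
    ⁅zp 0 n, a⁆ ∈ loopNonneg 𝔤 := by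
  induction ha using Submodule.iSup_induction' with
  | mem j y hy =>
    obtain ⟨b, rfl⟩ := hy
    rw [lie_zp, zero_add]
    exact Submodule.mem_iSup_of_mem j ⟨_, rfl⟩
  | zero => simp
  | add y y' _ _ h1 h2 => rw [lie_add]; exact add_mem h1 h2

/-- `ad n` on `ĝ^{≥0}`. -/
def adNonneg (n : 𝔤) : Module.End ℂ (loopNonneg 𝔤) :=
  (LieAlgebra.ad ℂ (Loop 𝔤) (zp 0 n)).restrict
    (fun _ ha => lie_mem_nonneg n ha)

theorem lie_mem_loopGT {n : 𝔤} (hn : n ∈ nil W.h) {q r : ℚ} (hqr : q ≤ r)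
    {a : Loop 𝔤} (ha : a ∈ loopGr W.h W.d r) :
    ⁅zp 0 n, a⁆ ∈ loopGT W.h W.d q := by
  unfold nil at hn
  induction hn using Submodule.iSup_induction' with
  | zero => simp
  | add y y' _ _ h1 h2 => rw [map_add, add_lie]; exact add_mem h1 h2
  | mem i n hn =>
    by_cases hi : 1 / 2 ≤ i
    · rw [iSup_pos hi] at hn
      induction ha using Submodule.span_induction with
      | mem a ha =>
        obtain ⟨i', j, b, hb, rfl, rfl⟩ := ha
        rw [lie_zp, zero_add]
        refine Submodule.mem_iSup_of_mem ((W.d + 1) * j + (i + i'))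
          (Submodule.mem_iSup_of_mem (by linarith) (Submodule.subset_span ?_))
        exact ⟨i + i', j, _, lie_mem_gr hn hb, rfl, rfl⟩
      | zero => simp
      | add y y' _ _ h1 h2 => rw [lie_add]; exact add_mem h1 h2
      | smul c y _ h1 => rw [lie_smul]; exact Submodule.smul_mem _ c h1
    · rw [iSup_neg hi, Submodule.mem_bot] at hn
      simp [hn]

theorem lie_mem_loopGT' {n : 𝔤} (hn : n ∈ nil W.h) {q : ℚ}
    {a : Loop 𝔤} (ha : a ∈ loopGT W.h W.d q) :
    ⁅zp 0 n, a⁆ ∈ loopGT W.h W.d q := by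
  unfold loopGT at ha
  induction ha using Submodule.iSup_induction' with
  | zero => simp
  | add y y' _ _ h1 h2 => rw [lie_add]; exact add_mem h1 h2
  | mem r a ha =>
    by_cases hr : q < r
    · rw [iSup_pos hr] at ha
      exact W.lie_mem_loopGT hn hr.le ha
    · rw [iSup_neg hr, Submodule.mem_bot] at ha
      simp [ha]

/-- The operator `a ↦ [n, a]` on `ĝ⁺_{[d,m]}`, for `n ∈ 𝔫`. -/
def act (n : nil W.h) : Module.End ℂ W.gPlus :=
  W.high.mapQ W.high (adNonneg (n : 𝔤)) (fun _ ha => W.lie_mem_loopGT' n.2 ha)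

theorem form_nil_loopGr {n : 𝔤} (hn : n ∈ nil W.h) {r : ℚ} (hr : 0 < r)
    {a : Loop 𝔤} (ha : a ∈ loopGr W.h W.d r) :
    loopForm W.form (zp 0 n) a = 0 := by
  unfold nil at hn
  induction hn using Submodule.iSup_induction' with
  | zero => simp
  | add y y' _ _ h1 h2 => rw [map_add, map_add, LinearMap.add_apply, h1, h2, add_zero]
  | mem i n hn =>
    by_cases hi : 1 / 2 ≤ i
    · rw [iSup_pos hi] at hn
      induction ha using Submodule.span_induction with
      | mem a ha =>
        obtain ⟨i', j, b, hb, rfl, rfl⟩ := ha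
        rw [loopForm_zp, zero_add]
        split_ifs with hj
        · subst hj
          refine W.form_eq_zero ?_ hn hb
          simp only [Int.cast_zero, mul_zero, zero_add] at hr
          linarith
        · rfl
      | zero => simp
      | add y y' _ _ h1 h2 => rw [map_add, h1, h2, add_zero]
      | smul c y _ h1 => rw [map_smul, h1, smul_zero]
    · rw [iSup_neg hi, Submodule.mem_bot] at hn
      simp [hn]

theorem form_nil_loopGT {n : 𝔤} (hn : n ∈ nil W.h) {a : Loop 𝔤}
    (ha : a ∈ loopGT W.h W.d W.topDeg) : loopForm W.form (zp 0 n) a = 0 := by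
  unfold loopGT at ha
  induction ha using Submodule.iSup_induction' with
  | zero => simp
  | add y y' _ _ h1 h2 => rw [map_add, h1, h2, add_zero]
  | mem r a ha =>
    by_cases hr : W.topDeg < r
    · rw [iSup_pos hr] at ha
      exact W.form_nil_loopGr hn (W.topDeg_pos.trans hr) ha
    · rw [iSup_neg hr, Submodule.mem_bot] at ha
      simp [ha]

/-- The functional `a z^i ↦ δ_{i,0} (n, a)` on `ĝ⁺_{[d,m]}`, for `n ∈ 𝔫`. -/
def pair (n : nil W.h) : Module.Dual ℂ W.gPlus :=
  W.high.liftQ (loopForm W.form (zp 0 (n : 𝔤)) ∘ₗ (loopNonneg 𝔤).subtype)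
    (fun _ ha => W.form_nil_loopGT n.2 ha)

/-! ### The differential algebra `𝒱_{[d,m]}` -/

/-- `S(ℂ[∂] ⊗ ĝ⁺_{[d,m]})`. -/
abbrev SV : Type _ := SymmetricAlgebra ℂ (ℂ[X] ⊗[ℂ] W.gPlus)

/-- The inclusion of `ĝ⁺_{[d,m]} = 1 ⊗ ĝ⁺_{[d,m]}` into `S(ℂ[∂] ⊗ ĝ⁺_{[d,m]})`. -/
def genS : W.gPlus →ₗ[ℂ] W.SV :=
  SymmetricAlgebra.ι ℂ (ℂ[X] ⊗[ℂ] W.gPlus) ∘ₗ TensorProduct.mk ℂ ℂ[X] W.gPlus 1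

/-- The derivation `∂` of `S(ℂ[∂] ⊗ ĝ⁺_{[d,m]})`, acting on `ℂ[∂] ⊗ ĝ⁺_{[d,m]}` as
multiplication by `∂`. -/
def derS : Derivation ℂ W.SV W.SV :=
  symDer (SymmetricAlgebra.ι ℂ (ℂ[X] ⊗[ℂ] W.gPlus) ∘ₗ
    LinearMap.rTensor W.gPlus (LinearMap.mulLeft ℂ (Polynomial.X : ℂ[X])))

/-- The elements `∂^n (a - χ(a))`, `a ∈ ĝ_{(d+1)m+1}`. -/
def relators : Set W.SV :=
  {s | ∃ (a : loopNonneg 𝔤) (n : ℕ), (a : Loop 𝔤) ∈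
    loopGr W.h W.d W.topDeg ∧
    s = W.derS^[n] (W.genS (W.high.mkQ a) - algebraMap ℂ W.SV (W.chi a))}

/-- The differential ideal generated by the `a - χ(a)`, `a ∈ ĝ_{(d+1)m+1}`. -/
def relIdeal : Ideal W.SV := Ideal.span W.relators

/-- `𝒱_{[d,m]}`. -/
abbrev V : Type _ := W.SV ⧸ W.relIdeal

theorem derS_mem (s : W.SV) (hs : s ∈ W.relIdeal) : W.derS s ∈ W.relIdeal := by
  unfold relIdeal at hs
  induction hs using Submodule.span_induction with
  | mem s hs =>
    obtain ⟨a, n, ha, rfl⟩ := hs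
    exact Ideal.subset_span ⟨a, n + 1, ha, (Function.iterate_succ_apply' _ _ _).symm⟩
  | zero => simp
  | add a b _ _ ha hb => rw [map_add]; exact add_mem ha hb
  | smul a b hb ih =>
    rw [smul_eq_mul, Derivation.leibniz, smul_eq_mul, smul_eq_mul]
    exact add_mem (Ideal.mul_mem_left _ _ ih) (Ideal.mul_mem_right _ _ hb)

/-- The derivation `∂` of `𝒱_{[d,m]}`. -/
def der : Derivation ℂ W.V W.V :=
  quotDer W.relIdeal
    (Derivation.mk' ((Ideal.Quotient.mkₐ ℂ W.relIdeal).toLinearMap ∘ₗ W.derS.toLinearMap)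
      (fun a b => by simp [Algebra.smul_def]))
    (fun s hs => Ideal.Quotient.eq_zero_iff_mem.2 (W.derS_mem s hs))

/-- The canonical linear map `ĝ⁺_{[d,m]} → 𝒱_{[d,m]}`. -/
def gen : W.gPlus →ₗ[ℂ] W.V := (Ideal.Quotient.mkₐ ℂ W.relIdeal).toLinearMap ∘ₗ W.genS

/-! ### The `λ`-adjoint action of `𝔫` and the W-algebra -/

/-- The linear map `a z^i ↦ [n, a] z^i + δ_{i,0} k λ (n, a)` from `ĝ⁺_{[d,m]}` to
`𝒱_{[d,m]}[λ]`. -/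
def adLamGen (n : nil W.h) : W.gPlus →ₗ[ℂ] W.V[X] :=
  (Polynomial.CAlgHom (R := ℂ) (A := W.V)).toLinearMap ∘ₗ W.gen ∘ₗ W.act n +
    (LinearMap.mulLeft ℂ (Polynomial.X : W.V[X])) ∘ₗ (Algebra.linearMap ℂ W.V[X]) ∘ₗ
      (W.k • W.pair n)

/-- The `λ`-adjoint action of `n` on `S(ℂ[∂] ⊗ ĝ⁺_{[d,m]})`, with values in `𝒱_{[d,m]}[λ]`; it is
given on generators by `∂^j ⊗ a ↦ (∂ + λ)^j (ad_λ n)(a)`. -/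
def adLamS (n : nil W.h) : Derivation ℂ W.SV W.V[X] :=
  symDer (M := ℂ[X] ⊗[ℂ] W.gPlus) (A := W.V[X]) (TensorProduct.lift
    (LinearMap.lcomp ℂ W.V[X] (W.adLamGen n) ∘ₗ
      (Polynomial.aeval (shift W.der) : ℂ[X] →ₐ[ℂ] Module.End ℂ W.V[X]).toLinearMap))

theorem adLamS_derS (n : nil W.h) (s : W.SV) :
    W.adLamS n (W.derS s) = shift W.der (W.adLamS n s) := by
  have hsm : ∀ (a : W.SV) (y : W.V[X]),
      a • y = Polynomial.C (Ideal.Quotient.mk W.relIdeal a) * y := fun a y => by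
    rw [Algebra.smul_def]; rfl
  induction s using SymmetricAlgebra.induction with
  | algebraMap r => simp
  | ι v =>
    rw [adLamS, derS, symDer_ι, symDer_ι, LinearMap.comp_apply, symDer_ι]
    induction v using TensorProduct.induction_on with
    | zero => simp
    | tmul q a => simp [Module.End.mul_apply]
    | add a b ha hb => simp only [map_add, ha, hb]
  | mul a b ha hb =>
    rw [Derivation.leibniz, Derivation.leibniz]
    simp only [map_add, hsm, shift_C_mul, smul_eq_mul, Derivation.leibniz, ha, hb]
    have hd : ∀ c : W.SV, W.der (Ideal.Quotient.mk W.relIdeal c) =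
      Ideal.Quotient.mk W.relIdeal (W.derS c) := fun c => rfl
    rw [hd, hd]
    ring
  | add a b ha hb => simp only [map_add, ha, hb]

theorem adLamS_eq_zero (n : nil W.h) (s : W.SV) (hs : s ∈ W.relIdeal) : W.adLamS n s = 0 := by
  refine der_eq_zero_of_mem_span (A := W.V[X]) W.relIdeal rfl (W.adLamS n) ?_ s hs
  rintro _ ⟨a, j, ha, rfl⟩
  induction j with
  | succ j ih => rw [Function.iterate_succ_apply', adLamS_derS, ih, map_zero]
  | zero =>
    have h1 : W.act n (Submodule.Quotient.mk a) = 0 :=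
      (Submodule.Quotient.mk_eq_zero _).2 (W.lie_mem_loopGT n.2 le_rfl ha)
    have h2 : W.pair n (Submodule.Quotient.mk a) = 0 := W.form_nil_loopGr n.2 W.topDeg_pos ha
    rw [Function.iterate_zero_apply, map_sub, Derivation.map_algebraMap, sub_zero, genS, adLamS,
      LinearMap.comp_apply, symDer_ι, TensorProduct.mk_apply, TensorProduct.lift.tmul]
    simp [adLamGen, h1, h2]

/-- The `λ`-adjoint action `ad_λ n : 𝒱_{[d,m]} → 𝒱_{[d,m]}[λ]` of `n ∈ 𝔫`. -/
def adLam (n : nil W.h) : Derivation ℂ W.V W.V[X] :=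
  quotDer (A := W.V[X]) W.relIdeal (W.adLamS n) (W.adLamS_eq_zero n)

/-- The W-algebra `𝒲(𝔤, Λ_m, k) = 𝒱_{[d,m]}^{ad_λ 𝔫}`. -/
def walg : Subalgebra ℂ W.V where
  carrier := {A | ∀ n : nil W.h, W.adLam n A = 0}
  mul_mem' {a b} ha hb n := by simp [ha n, hb n]
  add_mem' {a b} ha hb n := by simp [ha n, hb n]
  algebraMap_mem' r n := by simp

/-! ### The generators -/

theorem gr_half_le_nil : gr W.h (1 / 2) ≤ nil W.h := fun _ ha =>
  Submodule.mem_iSup_of_mem (1 / 2) (Submodule.mem_iSup_of_mem le_rfl ha)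

theorem e_mem_nil : W.e ∈ nil W.h :=
  Submodule.mem_iSup_of_mem 1 (Submodule.mem_iSup_of_mem (by norm_num) W.e_mem)

/-- The operator `a ↦ {a, y} = [a, y]` on `ĝ⁺_{[d,m]}`, for `y ∈ 𝔫`. -/
def br (y : nil W.h) : Module.End ℂ W.gPlus := -W.act y

/-- The operator `a ↦ {a, y₁, …, y_l} = {…{{a, y₁}, y₂}, …, y_l}`. -/
def iterBr : List (nil W.h) → Module.End ℂ W.gPlus
  | [] => LinearMap.id
  | y :: L => iterBr L ∘ₗ W.br y

/-- `z_1, …, z_{2s}, z_{2s+1} = x`. -/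
def zExt {s : ℕ} (z : Fin (2 * s) → gr W.h (1 / 2)) : Fin (2 * s + 1) → 𝔤 :=
  Fin.snoc (α := fun _ => 𝔤) (fun i => (z i : 𝔤)) W.x

/-- `z*_1, …, z*_{2s}, z*_{2s+1} = e`. -/
def zsExt {s : ℕ} (zs : Fin (2 * s) → gr W.h (1 / 2)) : Fin (2 * s + 1) → nil W.h :=
  Fin.snoc (α := fun _ => nil W.h) (fun i => ⟨zs i, W.gr_half_le_nil (zs i).2⟩)
    ⟨W.e, W.e_mem_nil⟩

/-- The element of `𝒱_{[d,m]}` represented by `a z^j`. -/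
def el (j : ℕ) (a : 𝔤) : W.V := W.gen (W.cls j a)

/-- The map `η̃_m`. -/
def etaTilde {s : ℕ} (z zs : Fin (2 * s) → gr W.h (1 / 2)) : W.gPlus →ₗ[ℂ] W.V :=
  ∑ l ∈ Finset.range 5, ∑ i : Fin l → Fin (2 * s + 1),
    ((l.factorial : ℂ)⁻¹) •
      (LinearMap.mulLeft ℂ (∏ t, W.el W.m (W.zExt z (i t))) ∘ₗ W.gen ∘ₗ
        W.iterBr (List.ofFn fun t => W.zsExt zs (i t)))

/-- The conditions that determine `η_m` on `⨁_{i<m} 𝔤 z^i ⊕ 𝔤_f z^m`. -/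
structure IsEta {s : ℕ} (z zs : Fin (2 * s) → gr W.h (1 / 2)) (η : W.gPlus →ₗ[ℂ] W.V) :
    Prop where
  nonneg : ∀ i : ℚ, 0 ≤ i → ∀ a ∈ gr W.h i, η (W.cls 0 a) = W.etaTilde z zs (W.cls 0 a)
  middle : ∀ t : ℕ, 1 ≤ t → t < W.m → ∀ a : 𝔤,
    η (W.cls t a) = W.etaTilde z zs (W.cls t a)
  top : ∀ a : 𝔤, ⁅a, W.f⁆ = 0 → η (W.cls W.m a) = W.etaTilde z zs (W.cls W.m a)
  neg_half : ∀ b ∈ gr W.h (-1 / 2), η (W.cls 0 b) =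
    W.etaTilde z zs (W.cls 0 b) -
      ∑ i, (W.form (zs i) b * W.k) • W.der (W.el W.m (z i))
  neg_one : η (W.cls 0 W.f) =
    W.etaTilde z zs (W.cls 0 W.f) - W.k • W.der (W.el W.m W.x) -
      (W.k / 2) • ∑ i, W.der (W.el W.m (zs i)) * W.el W.m (z i)

/-- `⨁_{i<m} 𝔤 z^i ⊕ 𝔤_f z^m`, as a subspace of `ĝ⁺_{[d,m]}`. -/
def genSpace : Submodule ℂ W.gPlus :=
  (⨆ (i : ℕ) (_ : i < W.m), LinearMap.range (W.cls i)) ⊔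
    (LinearMap.ker (LieAlgebra.ad ℂ 𝔤 W.f)).map (W.cls W.m)

end Datum

/-- The family `a` freely generates the subalgebra `U` of the differential algebra `(A, D)`: the
elements `D^n (a i)` are algebraically independent and generate `U`. -/
def FreelyDiffGenerates {A ι : Type*} [CommRing A] [Algebra ℂ A] (D : Derivation ℂ A A)
    (a : ι → A) (U : Subalgebra ℂ A) : Prop :=
  AlgebraicIndependent ℂ (fun q : ι × ℕ => D^[q.2] (a q.1)) ∧
    Algebra.adjoin ℂ (Set.range fun q : ι × ℕ => D^[q.2] (a q.1)) = U

end FractionalW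

end

open scoped TensorProduct Polynomial

noncomputable section

namespace FractionalW

/-! ### The adjoint group and polynomial functions -/

section Adjoint

variable {𝔤 : Type*} [LieRing 𝔤] [LieAlgebra ℂ 𝔤]

/-! Minimality of `f` first fixes the shape of `𝔤`. A nonzero `y ∈ 𝔤(d)` satisfies `(ad y)³ = 0`,
and this is a closed condition stable under the adjoint group, so `(ad f)³ = 0`. By `sl₂`-theory `d
= 1` (`d_eq_one`), and `ad x` is diagonalisable with eigenvalues among `0, ±1/2, ±1` (`genGr_le_gr`,
`iSup_gr_eq_top`). If `𝔤(-1)` were larger than `ℂ f`, some nonzero `y'` in it would have `(ad y')²`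
singular on `𝔤(1)`, hence of rank below `dim 𝔤(1)`; but `(ad f)²` is injective on `𝔤(1)` and rank
cannot jump up in an orbit closure (`exists_eq_smul_f`). So `𝔤(±1)` are lines, `𝔫 = 𝔤(1/2) ⊕ ℂ e` is
two-step nilpotent, and `𝔤 = 𝔤_f ⊕ 𝔤(1/2) ⊕ ℂ x ⊕ ℂ e`.

The rest is gauge fixing by a moving frame. In `𝒱` one has `e z^m = -1`, so the coordinates `r_i =
z_i z^m` are translated by `𝔫`: with `R = ∑ r_i ⊗ z_i^*`, the variation of `R` under `n` is `n - [n,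
R]/2` (`sum_delta_smul`), the infinitesimal Campbell–Hausdorff formula. The map `η̃` is the action
of `exp R` on the generators, written `exp T` with `T F = ∑ r_i F ∘ {·, z_i^*}`. Its variation
telescopes to what the cocycle contributes, `κ + T κ` with `κ(a) = k λ (n, a)` on `z^0`
(`adLam_etaTilde`). The inhomogeneous gauge term `corr`, which is `k (∂R + [R, ∂R]/2, ·)`, has the
same variation (`adLam_corr`), so `η = η̃ - corr` is invariant on all of `ĝ⁺`. It satisfies the
prescribed formulas (`eta_isEta`), and these determine the map on the space of generators
(`IsEta.eq_of_mem_genSpace`).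

Since `exp T` is unipotent, `𝒱` is generated by the derivatives of the `r_i` and of the `η(b_j)`
(`eq_top_of_eta_mem`). The derivation `euler`, the gauge action with parameter `R` itself, commutes
with `∂`, kills invariants and fixes each `r_i`. It therefore measures the degree in the derivatives
of the `r_i`, and its constants are exactly the subalgebra generated by the `∂^n η(b_j)`
(`mem_of_euler`). Independence comes from restricting to the slice `r_i = 0`: a differential
homomorphism to a polynomial ring sends the `∂^n η(b_j)` to distinct variables
(`algebraicIndependent`). -/

theorem adjointGroup_map_lie {φ : 𝔤 ≃ₗ[ℂ] 𝔤} (hφ : φ ∈ adjointGroup 𝔤) (a b : 𝔤) :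
    φ ⁅a, b⁆ = ⁅φ a, φ b⁆ := by
  unfold adjointGroup at hφ
  induction hφ using Subgroup.closure_induction generalizing a b with
  | one => rfl
  | mul φ ψ _ _ h1 h2 => rw [LinearEquiv.mul_apply, h2, h1]; rfl
  | inv φ _ h =>
    apply φ.injective
    have hi : ∀ v, φ (φ⁻¹ v) = v := φ.apply_symm_apply
    rw [h, hi, hi, hi]
  | mem φ hφ =>
    obtain ⟨u, n, hn, hφ⟩ := hφ
    -- The exponential of a nilpotent derivation is taken over `ℚ`, so scalars are restricted from
    -- `ℂ`. It is a Lie algebra automorphism, and it agrees with the truncated sum defining the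
    -- generator `φ`.
    let _ : Module ℚ 𝔤 := Module.compHom 𝔤 (algebraMap ℚ ℂ)
    have hsm : ∀ (q : ℚ) (v : 𝔤), q • v = (q : ℂ) • v := fun q v => rfl
    let _ : LieAlgebra ℚ 𝔤 := { lie_smul := fun q x y => by rw [hsm, hsm, lie_smul] }
    have hD : (LieDerivation.ad ℂ 𝔤 u).toLinearMap = LieAlgebra.ad ℂ 𝔤 u :=
      LieDerivation.coe_ad_apply_eq_ad_apply u
    have hnil : IsNilpotent (LieDerivation.ad ℂ 𝔤 u).toLinearMap := ⟨n, by rw [hD]; exact hn⟩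
    have key : ∀ v, φ v = LieDerivation.exp _ hnil v := fun v => by
      rw [LieDerivation.exp_map_apply, IsNilpotent.exp_eq_sum (k := n) (by rw [hD]; exact hn), hD]
      have := LinearMap.congr_fun hφ v
      simp only [LinearEquiv.coe_coe] at this
      rw [this, LinearMap.sum_apply, LinearMap.sum_apply]
      refine Finset.sum_congr rfl fun j _ => ?_
      rw [LinearMap.smul_apply, LinearMap.smul_apply, hsm]
      push_cast
      rfl
    rw [key, key, key, LieEquiv.map_lie]

theorem dual_mem_polynomialFunctions (φ : Module.Dual ℂ 𝔤) :
    (fun y => φ y) ∈ polynomialFunctions 𝔤 :=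
  Algebra.subset_adjoin ⟨φ, rfl⟩

theorem const_mem_polynomialFunctions (c : ℂ) : (fun _ => c) ∈ polynomialFunctions 𝔤 :=
  (polynomialFunctions 𝔤).algebraMap_mem c

theorem det_mem_polynomialFunctions {ι : Type*} [Fintype ι] [DecidableEq ι]
    {M : 𝔤 → Matrix ι ι ℂ} (hM : ∀ i j, (fun y => M y i j) ∈ polynomialFunctions 𝔤) :
    (fun y => (M y).det) ∈ polynomialFunctions 𝔤 := by
  have h : (fun y => (M y).det) = ∑ σ : Equiv.Perm ι,
      (fun _ => ((Equiv.Perm.sign σ : ℤ) : ℂ)) * ∏ i, (fun y => M y (σ i) i) := by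
    funext y
    rw [Matrix.det_apply', Finset.sum_apply]
    refine Finset.sum_congr rfl fun σ _ => ?_
    rw [Pi.mul_apply, Finset.prod_apply]
  rw [h]
  exact sum_mem fun σ _ => mul_mem (const_mem_polynomialFunctions _) (prod_mem fun i _ => hM _ _)

variable [Module.Finite ℂ 𝔤]

/-- Iterated from a constant map, this makes every matrix coefficient of `(ad y)^n` polynomial in
`y`. -/
theorem lie_mem_polynomialFunctions {P : 𝔤 → 𝔤}
    (hP : ∀ φ : Module.Dual ℂ 𝔤, (fun y => φ (P y)) ∈ polynomialFunctions 𝔤)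
    (φ : Module.Dual ℂ 𝔤) : (fun y => φ ⁅y, P y⁆) ∈ polynomialFunctions 𝔤 := by
  have b := Module.finBasis ℂ 𝔤
  have h : (fun y => φ ⁅y, P y⁆) =
      ∑ i, (fun y => b.coord i (P y)) * (fun y => (-(φ ∘ₗ LieAlgebra.ad ℂ 𝔤 (b i))) y) := by
    funext y
    conv_lhs => rw [← b.sum_repr (P y), lie_sum, map_sum]
    rw [Finset.sum_apply]
    refine Finset.sum_congr rfl fun i _ => ?_
    simp only [lie_smul, map_smul, smul_eq_mul, Pi.mul_apply, Module.Basis.coord_apply,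
      LinearMap.neg_apply, LinearMap.comp_apply, LieAlgebra.ad_apply, ← map_neg, lie_skew]
  rw [h]
  exact sum_mem fun i _ => mul_mem (hP _) (dual_mem_polynomialFunctions _)

/-- If `(ad y)³ = 0` and `f` lies in the closure of the orbit of `y`, then `(ad f)³ = 0`. -/
theorem lie_lie_lie_eq_zero_of_mem_zariskiClosure {y f : 𝔤} (hy : ∀ a : 𝔤, ⁅y, ⁅y, ⁅y, a⁆⁆⁆ = 0)
    (hf : f ∈ zariskiClosure (adjointOrbit y)) (a : 𝔤) : ⁅f, ⁅f, ⁅f, a⁆⁆⁆ = 0 := by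
  rw [← Module.forall_dual_apply_eq_zero_iff ℂ]
  intro φ
  refine hf (fun y => φ ⁅y, ⁅y, ⁅y, a⁆⁆⁆) ?_ ?_
  · exact lie_mem_polynomialFunctions (lie_mem_polynomialFunctions (lie_mem_polynomialFunctions
      fun φ => const_mem_polynomialFunctions _)) φ
  · rintro _ ⟨ψ, hψ, rfl⟩
    obtain ⟨a, rfl⟩ := ψ.surjective a
    simp only [← adjointGroup_map_lie hψ, hy, map_zero]

/-- The rank of `(ad y)²` is lower semicontinuous: if `f` lies in the closure of the orbit of `y`,
then `(ad f)²` cannot be injective on a subspace of dimension larger than the rank of `(ad y)²`. -/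
theorem exists_lie_lie_eq_zero_of_mem_zariskiClosure {y f : 𝔤} {U : Submodule ℂ 𝔤}
    (hr : Module.finrank ℂ (LinearMap.range (LieAlgebra.ad ℂ 𝔤 y ^ 2)) < Module.finrank ℂ U)
    (hf : f ∈ zariskiClosure (adjointOrbit y)) : ∃ u ∈ U, u ≠ 0 ∧ ⁅f, ⁅f, u⁆⁆ = 0 := by
  by_contra! hcon
  let g : U →ₗ[ℂ] 𝔤 := (LieAlgebra.ad ℂ 𝔤 f ^ 2) ∘ₗ U.subtype
  have hg : ∀ u : U, g u = ⁅f, ⁅f, (u : 𝔤)⁆⁆ := fun u => by simp [g, pow_two]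
  have hker : LinearMap.ker g = ⊥ := by
    rw [LinearMap.ker_eq_bot']
    intro u hu
    by_contra hne
    exact hcon u u.2 (fun h => hne (Subtype.ext h)) ((hg u).symm.trans hu)
  -- A left inverse `g'` of `(ad f)²` on `U` compresses `(ad y)²` to a square matrix `M y` with `M f
  -- = 1`. Its determinant is polynomial in `y`, so it is enough that it vanishes on the orbit.
  obtain ⟨g', hg'⟩ := g.exists_leftInverse_of_injective hker
  have b := Module.finBasis ℂ U
  let M : 𝔤 → Matrix (Fin (Module.finrank ℂ U)) (Fin (Module.finrank ℂ U)) ℂ := fun y =>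
    Matrix.of fun i j => (b.coord i ∘ₗ g') ⁅y, ⁅y, (b j : 𝔤)⁆⁆
  have hM1 : M f = 1 := by
    ext i j
    have : g' ⁅f, ⁅f, (b j : 𝔤)⁆⁆ = b j := by
      rw [← hg]
      exact LinearMap.congr_fun hg' (b j)
    simp [M, this, Matrix.one_apply, Finsupp.single_apply, eq_comm]
  have h0 : (M f).det = 0 := by
    refine hf (fun y => (M y).det) (det_mem_polynomialFunctions fun i j => ?_) ?_
    · exact lie_mem_polynomialFunctions (lie_mem_polynomialFunctions
        fun φ => const_mem_polynomialFunctions _) (b.coord i ∘ₗ g')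
    · rintro _ ⟨ψ, hψ, rfl⟩
      let A := LieAlgebra.ad ℂ 𝔤 y ^ 2
      -- The rank of `(ad y)²` is less than `dim U`, so it kills some nonzero vector of `ψ⁻¹ U`.
      -- Transporting back by `ψ` gives a kernel vector of `M (ψ y)`.
      have hB : LinearMap.ker (A.rangeRestrict ∘ₗ ψ.symm.toLinearMap ∘ₗ U.subtype) ≠ ⊥ :=
        LinearMap.ker_ne_bot_of_finrank_lt hr
      obtain ⟨u, hu, hu0⟩ := Submodule.exists_mem_ne_zero_of_ne_bot hB
      have hu' : ⁅y, ⁅y, ψ.symm (u : 𝔤)⁆⁆ = 0 := by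
        have := congrArg Subtype.val (LinearMap.mem_ker.1 hu)
        simpa [A, pow_two] using this
      rw [← Matrix.exists_mulVec_eq_zero_iff]
      refine ⟨b.repr u, fun h => hu0 ?_, ?_⟩
      · exact b.repr.map_eq_zero_iff.1 (Finsupp.coe_eq_zero.1 h)
      · ext i
        have h2 : ⁅ψ y, ⁅ψ y, (u : 𝔤)⁆⁆ = 0 := by
          rw [← ψ.apply_symm_apply (u : 𝔤), ← adjointGroup_map_lie hψ, ← adjointGroup_map_lie hψ,
            hu', map_zero]
        have h3 : (u : 𝔤) = ∑ j, b.repr u j • (b j : 𝔤) := by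
          have h4 := congrArg U.subtype (b.sum_repr u).symm
          rw [map_sum] at h4
          simp only [map_smul] at h4
          exact h4
        rw [h3] at h2
        have h4 := congrArg (b.coord i ∘ₗ g') h2
        simp only [lie_sum, lie_smul, map_sum, map_smul, map_zero, smul_eq_mul] at h4
        simp only [M, Matrix.mulVec, dotProduct, Matrix.of_apply, Pi.zero_apply]
        rw [← h4]
        exact Finset.sum_congr rfl fun j _ => mul_comm _ _
  rw [hM1, Matrix.det_one] at h0
  exact one_ne_zero h0

end Adjoint

/-! ### Identities for `sl₂`-triples -/

section Sl2

variable {𝔤 : Type*} [LieRing 𝔤] [LieAlgebra ℂ 𝔤] {h e f : 𝔤} (t : IsSl2Triple h e f)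

include t

theorem lie_h_lie_f (v : 𝔤) : ⁅h, ⁅f, v⁆⁆ = ⁅f, ⁅h, v⁆⁆ - (2 : ℂ) • ⁅f, v⁆ := by
  rw [leibniz_lie, t.lie_lie_smul_f ℂ, neg_lie, smul_lie]; abel

omit [LieAlgebra ℂ 𝔤] in
theorem lie_e_lie_f (v : 𝔤) : ⁅e, ⁅f, v⁆⁆ = ⁅h, v⁆ + ⁅f, ⁅e, v⁆⁆ := by
  rw [leibniz_lie, t.lie_e_f]

/-- The vector `v` is not assumed to be an eigenvector of `h`: this and the next lemma are `e f^j v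
= j f^{j-1} (h - (j-1)) v` in operator form, as needed on generalized eigenspaces. -/
theorem lie_e_f_f {v : 𝔤} (hv : ⁅e, v⁆ = 0) :
    ⁅e, ⁅f, ⁅f, v⁆⁆⁆ = ⁅f, (2 : ℂ) • ⁅h, v⁆ - (2 : ℂ) • v⁆ := by
  rw [lie_e_lie_f t, lie_h_lie_f t, lie_e_lie_f t, hv, lie_zero, add_zero, lie_sub, lie_smul,
    lie_smul, two_smul ℂ ⁅f, ⁅h, v⁆⁆]
  abel

theorem lie_e_f_f_f {v : 𝔤} (hv : ⁅e, v⁆ = 0) :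
    ⁅e, ⁅f, ⁅f, ⁅f, v⁆⁆⁆⁆ = ⁅f, ⁅f, (3 : ℂ) • (⁅h, v⁆ - (2 : ℂ) • v)⁆⁆ := by
  rw [lie_e_lie_f t, lie_e_f_f t hv, lie_h_lie_f t, lie_h_lie_f t]
  simp only [lie_sub, lie_smul]
  module

theorem lie_e_e_f_f {v : 𝔤} (hv : ⁅e, v⁆ = 0) (hv2 : ⁅h, v⁆ = (2 : ℂ) • v) :
    ⁅e, ⁅e, ⁅f, ⁅f, v⁆⁆⁆⁆ = (4 : ℂ) • v := by
  rw [lie_e_f_f t hv, lie_e_lie_f t]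
  simp only [lie_sub, lie_smul, hv, hv2, smul_zero, sub_zero, lie_zero, add_zero]
  module

/-- Put `w = (h - 2) v`. From `e f³ v = 0` follows `f² w = 0`, then `f (h - 1) w = 0`, then `h (h -
1) w = 0` after applying `e` again. As `h` has neither eigenvalue `0` nor `1` on `U`, `w = 0`. The
version for weight one is the same with one step fewer. -/
theorem lie_h_eq_of_highest_two {U : Submodule ℂ 𝔤} (hU : ∀ u ∈ U, ⁅h, u⁆ ∈ U)
    (he : ∀ u ∈ U, ⁅e, u⁆ = 0) (hf : ∀ u ∈ U, ⁅f, ⁅f, ⁅f, u⁆⁆⁆ = 0)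
    (hc : ∀ c : ℂ, c ≠ 2 → ∀ u ∈ U, ⁅h, u⁆ = c • u → u = 0) {v : 𝔤} (hv : v ∈ U) :
    ⁅h, v⁆ = (2 : ℂ) • v := by
  set w := ⁅h, v⁆ - (2 : ℂ) • v with hw
  have hwU : w ∈ U := sub_mem (hU v hv) (U.smul_mem _ hv)
  have h1 : ⁅f, ⁅f, w⁆⁆ = 0 := by
    have := lie_e_f_f_f t (he v hv)
    rw [hf v hv, lie_zero, ← hw, lie_smul, lie_smul, eq_comm, smul_eq_zero] at this
    exact this.resolve_left (by norm_num)
  have h2 := lie_e_f_f t (he w hwU)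
  rw [h1, lie_zero] at h2
  set w2 := (2 : ℂ) • ⁅h, w⁆ - (2 : ℂ) • w with hw2
  have hw2U : w2 ∈ U := sub_mem (U.smul_mem _ (hU w hwU)) (U.smul_mem _ hwU)
  have h3 := lie_e_lie_f t w2
  rw [← h2, he w2 hw2U, lie_zero, lie_zero, add_zero] at h3
  have h4 : w2 = 0 := hc 0 (by norm_num) w2 hw2U (by rw [← h3, zero_smul])
  have h5 : w = 0 := by
    refine hc 1 (by norm_num) w hwU ?_
    rw [h4, ← smul_sub, eq_comm, smul_eq_zero] at hw2
    rw [one_smul]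
    exact sub_eq_zero.1 (hw2.resolve_left (by norm_num))
  exact sub_eq_zero.1 h5

theorem lie_h_eq_of_highest_one {U : Submodule ℂ 𝔤} (hU : ∀ u ∈ U, ⁅h, u⁆ ∈ U)
    (he : ∀ u ∈ U, ⁅e, u⁆ = 0) (hf : ∀ u ∈ U, ⁅f, ⁅f, u⁆⁆ = 0)
    (hc : ∀ c : ℂ, c ≠ 1 → ∀ u ∈ U, ⁅h, u⁆ = c • u → u = 0) {v : 𝔤} (hv : v ∈ U) :
    ⁅h, v⁆ = v := by
  have h2 := lie_e_f_f t (he v hv)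
  rw [hf v hv, lie_zero] at h2
  set w2 := (2 : ℂ) • ⁅h, v⁆ - (2 : ℂ) • v with hw2
  have hw2U : w2 ∈ U := sub_mem (U.smul_mem _ (hU v hv)) (U.smul_mem _ hv)
  have h3 := lie_e_lie_f t w2
  rw [← h2, he w2 hw2U, lie_zero, lie_zero, add_zero] at h3
  have h4 : w2 = 0 := hc 0 (by norm_num) w2 hw2U (by rw [← h3, zero_smul])
  rw [h4, ← smul_sub, eq_comm, smul_eq_zero] at hw2
  exact sub_eq_zero.1 (hw2.resolve_left (by norm_num))

/-- A vector `v` on which the triple acts "as on a zero weight space of a sum of copies of the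
trivial and the adjoint representation" is killed by `h`. -/
theorem lie_h_eq_zero {v : 𝔤} (h1 : ⁅h, ⁅e, v⁆⁆ = (2 : ℂ) • ⁅e, v⁆) (h2 : ⁅e, ⁅e, v⁆⁆ = 0)
    (h3 : ∀ w : 𝔤, w = v - (1 / 2 : ℂ) • ⁅f, ⁅e, v⁆⁆ →
      ⁅h, ⁅f, w⁆⁆ = -((2 : ℂ) • ⁅f, w⁆) ∧ ⁅f, ⁅f, w⁆⁆ = 0) : ⁅h, v⁆ = 0 := by
  have hfe : ⁅h, ⁅f, ⁅e, v⁆⁆⁆ = 0 := by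
    rw [lie_h_lie_f t, h1, lie_smul, sub_self]
  -- Removing `f e v / 2` leaves a vector killed by `e`, so that `h w = e f w`. Evaluating `e f (f
  -- w) = 0` then gives `f w = 0`.
  set w := v - (1 / 2 : ℂ) • ⁅f, ⁅e, v⁆⁆ with hw
  obtain ⟨h4, h5⟩ := h3 w rfl
  have hew : ⁅e, w⁆ = 0 := by
    rw [hw, lie_sub, lie_smul, lie_e_lie_f t, h2, h1, lie_zero, add_zero, smul_smul]
    norm_num
  have hefw : ⁅e, ⁅f, w⁆⁆ = ⁅h, w⁆ := by rw [lie_e_lie_f t, hew, lie_zero, add_zero]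
  have h6 := lie_e_lie_f t ⁅f, w⁆
  rw [h5, lie_zero, hefw, lie_h_lie_f t] at h6
  have h7 := h4
  rw [lie_h_lie_f t] at h7
  have h8 : ⁅f, ⁅h, w⁆⁆ = 0 := by
    have : ⁅f, ⁅h, w⁆⁆ = ⁅f, ⁅h, w⁆⁆ - (2 : ℂ) • ⁅f, w⁆ + (2 : ℂ) • ⁅f, w⁆ := by abel
    rw [this, h7]; abel
  rw [h8] at h6
  have h9 : ⁅f, w⁆ = 0 := by
    simp only [zero_sub, add_zero] at h6
    have := neg_eq_zero.1 h6.symm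
    exact (smul_eq_zero.1 this).resolve_left (by norm_num)
  have h10 : ⁅h, w⁆ = 0 := by rw [← hefw, h9, lie_zero]
  have : v = w + (1 / 2 : ℂ) • ⁅f, ⁅e, v⁆⁆ := by rw [hw]; abel
  rw [this, lie_add, lie_smul, h10, hfe, smul_zero, add_zero]

variable [Module.Finite ℂ 𝔤]

/-- The vectors `e^k v` have pairwise distinct `h`-eigenvalues, so finite dimension leaves a last
nonzero one. -/
theorem exists_hasPrimitiveVectorWith_pow {v : 𝔤} (hv : v ≠ 0) {c : ℂ} (hc : ⁅h, v⁆ = c • v) :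
    ∃ k : ℕ, t.HasPrimitiveVectorWith ((LieModule.toEnd ℂ 𝔤 𝔤 e ^ k) v) (c + 2 * k) := by
  have hex : ∃ k, (LieModule.toEnd ℂ 𝔤 𝔤 e ^ k) v = 0 := by
    by_contra! contra
    have hs : (Set.range fun n : ℕ => c + 2 * n).Infinite :=
      Set.infinite_range_of_injective fun a b hab => by simpa using hab
    exact hs ((LieModule.toEnd ℂ 𝔤 𝔤 h).eigenvectors_linearIndependent
      (Set.range fun n : ℕ => c + 2 * n)
      (fun μ => (LieModule.toEnd ℂ 𝔤 𝔤 e ^ (μ.2.choose)) v)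
      (fun μ => ⟨by
        rw [Module.End.mem_eigenspace_iff, LieModule.toEnd_apply_apply]
        exact (t.lie_h_pow_toEnd_e hc _).trans (congrArg (· • _) μ.2.choose_spec),
        contra _⟩)).finite
  obtain ⟨n, hn, hn'⟩ := Nat.exists_not_and_succ_of_not_zero_of_exists
    (p := fun k => (LieModule.toEnd ℂ 𝔤 𝔤 e ^ k) v = 0) hv hex
  exact ⟨n, hn, t.lie_h_pow_toEnd_e hc n, by rwa [IsSl2Triple.lie_e_pow_toEnd_e]⟩

end Sl2

theorem mem_gr_iff {𝔤 : Type*} [LieRing 𝔤] [LieAlgebra ℂ 𝔤] {h a : 𝔤} {i : ℚ} :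
    a ∈ gr h i ↔ ⁅h, a⁆ = (2 * i : ℂ) • a := by
  rw [gr, Module.End.mem_eigenspace_iff, LieAlgebra.ad_apply, smul_lie, mul_smul]
  constructor
  · intro H
    rw [← H, smul_smul]
    norm_num
  · intro H
    rw [H, smul_smul]
    norm_num

namespace Datum

variable {𝔤 : Type*} [LieRing 𝔤] [LieAlgebra ℂ 𝔤] (W : Datum 𝔤)

/-! ### The gradation of `𝔤` -/

theorem f_mem : W.f ∈ gr W.h (-1) := by
  rw [mem_gr_iff, W.sl2.lie_lie_smul_f ℂ, ← neg_smul]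
  norm_num

theorem x_mem : W.x ∈ gr W.h 0 := by
  rw [mem_gr_iff, x, lie_smul, lie_self]
  simp

theorem lie_x {i : ℚ} {a : 𝔤} (ha : a ∈ gr W.h i) : ⁅W.x, a⁆ = (i : ℂ) • a :=
  Module.End.mem_eigenspace_iff.1 ha

theorem lie_e_x : ⁅W.e, W.x⁆ = -W.e := by
  rw [← lie_skew, W.lie_x W.e_mem]
  simp

theorem lie_f_x : ⁅W.f, W.x⁆ = W.f := by
  rw [← lie_skew, W.lie_x W.f_mem]
  simp

/-- The generalized eigenspace of `ad (h/2)` with eigenvalue `μ`. -/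
def genGr (μ : ℂ) : Submodule ℂ 𝔤 :=
  (LieAlgebra.ad ℂ 𝔤 ((1 / 2 : ℂ) • W.h)).maxGenEigenspace μ

theorem gr_le_genGr (i : ℚ) : gr W.h i ≤ W.genGr i :=
  Module.End.eigenspace_le_maxGenEigenspace

theorem lie_mem_genGr {μ ν ρ : ℂ} {a b : 𝔤} (ha : a ∈ W.genGr μ) (hb : b ∈ W.genGr ν)
    (hρ : μ + ν = ρ) : ⁅a, b⁆ ∈ W.genGr ρ := by
  subst hρ
  exact LieModule.lie_mem_maxGenEigenspace_toEnd ha hb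

theorem lie_h_mem_genGr {μ : ℂ} {a : 𝔤} (ha : a ∈ W.genGr μ) : ⁅W.h, a⁆ ∈ W.genGr μ := by
  refine W.lie_mem_genGr (μ := 0) ?_ ha (zero_add μ)
  have := W.gr_le_genGr 0 W.x_mem
  rw [x, Rat.cast_zero, Submodule.smul_mem_iff _ (by norm_num)] at this
  exact this

theorem lie_e_mem_genGr {μ ν : ℂ} {a : 𝔤} (ha : a ∈ W.genGr μ) (h : 1 + μ = ν) :
    ⁅W.e, a⁆ ∈ W.genGr ν :=
  W.lie_mem_genGr (by exact_mod_cast W.gr_le_genGr 1 W.e_mem) ha h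

theorem lie_f_mem_genGr {μ ν : ℂ} {a : 𝔤} (ha : a ∈ W.genGr μ) (h : -1 + μ = ν) :
    ⁅W.f, a⁆ ∈ W.genGr ν :=
  W.lie_mem_genGr (by exact_mod_cast W.gr_le_genGr (-1) W.f_mem) ha h

theorem eq_zero_of_lie_h_eq {μ c : ℂ} (hc : c ≠ 2 * μ) {a : 𝔤} (ha : a ∈ W.genGr μ)
    (h : ⁅W.h, a⁆ = c • a) : a = 0 := by
  have h1 : a ∈ W.genGr (c / 2) := by
    refine Module.End.eigenspace_le_maxGenEigenspace (Module.End.mem_eigenspace_iff.2 ?_)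
    rw [LieAlgebra.ad_apply, smul_lie, h, smul_smul]
    congr 1
    ring
  refine Submodule.disjoint_def.1 ((Module.End.independent_maxGenEigenspace _).pairwiseDisjoint
    (fun hne => hc ?_)) a h1 ha
  rw [← hne]
  ring

variable [Module.Finite ℂ 𝔤]

/-- Raising an eigenvector to a primitive one shows that its `h`-weight is an integer. The lower
bound is not immediate, since `d` only bounds eigenvalues from above: lowering to a lowest weight
vector and applying the opposite string reaches the reflected weight, which is at most `2d`. -/
theorem exists_int_of_genGr_ne_bot {μ : ℂ} (hμ : W.genGr μ ≠ ⊥) :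
    ∃ n : ℤ, μ = ((n / 2 : ℚ) : ℂ) ∧ -W.d ≤ n / 2 ∧ (n / 2 : ℚ) ≤ W.d := by
  obtain ⟨k, hk⟩ : ∃ k : ℕ,
      (LieAlgebra.ad ℂ 𝔤 ((1 / 2 : ℂ) • W.h)).genEigenspace μ k ≠ ⊥ := by
    by_contra! h
    refine hμ ?_
    rw [genGr, ← Module.End.iSup_genEigenspace_eq]
    exact iSup_eq_bot.2 h
  have hev := Module.End.hasEigenvalue_of_hasGenEigenvalue (k := k) hk
  obtain ⟨v, hv, hv0⟩ := hev.exists_hasEigenvector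
  have hhv : ⁅W.h, v⁆ = (2 * μ) • v := by
    rw [Module.End.mem_eigenspace_iff, LieAlgebra.ad_apply, smul_lie] at hv
    rw [mul_smul, ← hv, smul_smul]
    norm_num
  obtain ⟨k, P⟩ := exists_hasPrimitiveVectorWith_pow W.sl2 hv0 hhv
  obtain ⟨n, hn⟩ := P.exists_nat
  have hμ2 : μ = ((((n : ℤ) - 2 * (k : ℤ) : ℤ) / 2 : ℚ) : ℂ) := by
    push_cast
    linear_combination hn / 2
  refine ⟨(n : ℤ) - 2 * k, hμ2, ?_, ?_⟩
  · have hhv' : ⁅-W.h, v⁆ = (-(2 * μ)) • v := by rw [neg_lie, hhv, neg_smul]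
    obtain ⟨k', P'⟩ := exists_hasPrimitiveVectorWith_pow W.sl2.symm hv0 hhv'
    obtain ⟨n', hn'⟩ := P'.exists_nat
    have h1 := P'.lie_h_pow_toEnd_f n'
    have h2 := P'.pow_toEnd_f_ne_zero_of_eq_nat hn' le_rfl
    rw [hn', neg_lie, neg_eq_iff_eq_neg, ← neg_smul] at h1
    have h3 : ((n' / 2 : ℚ)) ≤ W.d := W.d_greatest.2 fun hb => h2 (by
      rw [← Submodule.mem_bot (R := ℂ), ← hb, mem_gr_iff, h1]
      congr 1
      push_cast
      ring)
    have h4 : (((n : ℤ) - 2 * (k : ℤ) : ℤ) / 2 : ℚ) = k' - n' / 2 := by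
      have : ((((n : ℤ) - 2 * (k : ℤ) : ℤ) / 2 : ℚ) : ℂ) = ((k' - n' / 2 : ℚ) : ℂ) := by
        rw [← hμ2]
        push_cast
        linear_combination -hn' / 2
      exact_mod_cast this
    rw [h4]
    have : (0 : ℚ) ≤ k' := by positivity
    linarith
  · refine W.d_greatest.2 fun hb => hv0 ?_
    rw [← Submodule.mem_bot (R := ℂ), ← hb, mem_gr_iff, hhv, hμ2]

theorem genGr_eq_bot {i : ℚ} (hi : i < -W.d ∨ W.d < i) : W.genGr i = ⊥ := by
  by_contra h
  obtain ⟨n, h1, h2, h3⟩ := W.exists_int_of_genGr_ne_bot h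
  have h4 : i = n / 2 := by exact_mod_cast h1
  rw [h4] at hi
  rcases hi with hi | hi <;> linarith

/-- Degrees are at least `-d`, so three applications of `ad y` land in degree at least `2d > d`. -/
theorem lie_lie_lie_eq_zero_of_mem_gr_d {y : 𝔤} (hy : y ∈ gr W.h W.d) (a : 𝔤) :
    ⁅y, ⁅y, ⁅y, a⁆⁆⁆ = 0 := by
  have ha : a ∈ ⨆ μ, W.genGr μ := by
    unfold genGr
    rw [Module.End.iSup_maxGenEigenspace_eq_top]
    trivial
  induction ha using Submodule.iSup_induction' with
  | zero => simp
  | add a b _ _ ha hb => rw [lie_add, lie_add, lie_add, ha, hb, add_zero]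
  | mem μ a ha =>
    by_cases hμ : W.genGr μ = ⊥
    · rw [hμ, Submodule.mem_bot] at ha
      simp [ha]
    · obtain ⟨n, hn, h1, -⟩ := W.exists_int_of_genGr_ne_bot hμ
      have hy' := W.gr_le_genGr _ hy
      have h3 := W.lie_mem_genGr hy' (W.lie_mem_genGr hy' (W.lie_mem_genGr hy' ha rfl) rfl) rfl
      have h4 : (W.d : ℂ) + (W.d + (W.d + μ)) = ((W.d + (W.d + (W.d + n / 2)) : ℚ) : ℂ) := by
        rw [hn]; push_cast; ring
      have := W.one_le_d
      rw [h4, W.genGr_eq_bot (Or.inr (by linarith)), Submodule.mem_bot] at h3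
      exact h3

variable (hf : IsMinimalNilpotent W.f)

include hf

theorem lie_f_f_f (a : 𝔤) : ⁅W.f, ⁅W.f, ⁅W.f, a⁆⁆⁆ = 0 := by
  obtain ⟨y, hy, hy0⟩ := Submodule.exists_mem_ne_zero_of_ne_bot W.d_greatest.1
  have h3 := W.lie_lie_lie_eq_zero_of_mem_gr_d hy
  refine lie_lie_lie_eq_zero_of_mem_zariskiClosure h3 (hf.mem_closure y hy0 ⟨3, ?_⟩) a
  ext a
  simpa [pow_succ] using h3 a

/-- A nonzero vector of `𝔤(d)` is primitive of weight `2d`. Were `2d ≥ 3`, then `f³` could not kill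
it. -/
theorem d_eq_one : W.d = 1 := by
  refine le_antisymm ?_ W.one_le_d
  by_contra! hd
  obtain ⟨y, hy, hy0⟩ := Submodule.exists_mem_ne_zero_of_ne_bot W.d_greatest.1
  have he : ⁅W.e, y⁆ = 0 := by
    have := W.lie_e_mem_genGr (W.gr_le_genGr _ hy) (ν := ((1 + W.d : ℚ) : ℂ)) (by push_cast; rfl)
    rwa [W.genGr_eq_bot (Or.inr (by linarith)), Submodule.mem_bot] at this
  have P : W.sl2.HasPrimitiveVectorWith y (2 * W.d : ℂ) := ⟨hy0, mem_gr_iff.1 hy, he⟩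
  obtain ⟨n, hn⟩ := P.exists_nat
  have hn' : 2 * W.d = n := by exact_mod_cast hn
  have h3 : 3 ≤ n := by
    have : (2 : ℚ) < n := by linarith
    exact_mod_cast this
  have := P.pow_toEnd_f_ne_zero_of_eq_nat hn h3
  refine this ?_
  simpa [pow_succ] using W.lie_f_f_f hf y

theorem genGr_eq_bot_of_lt {i : ℚ} (hi : i < -1 ∨ 1 < i) : W.genGr i = ⊥ :=
  W.genGr_eq_bot (by rwa [W.d_eq_one hf])

theorem eq_zero_of_mem_genGr {i : ℚ} (hi : i < -1 ∨ 1 < i) {μ : ℂ} (hμ : μ = i) {a : 𝔤}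
    (ha : a ∈ W.genGr μ) : a = 0 := by
  subst hμ
  rwa [W.genGr_eq_bot_of_lt hf hi, Submodule.mem_bot] at ha

/-- Weights `±1` and `±1/2` are extremal, so their spaces are killed by `e` or `f` and by the third
power, respectively the square, of the opposite operator, and the highest-vector lemmas apply.
Weight `0` reduces to weights `±1` through `lie_h_eq_zero`. -/
theorem genGr_le_gr {i : ℚ} (hi : i ∈ ({-1, -1 / 2, 0, 1 / 2, 1} : Set ℚ)) :
    W.genGr i ≤ gr W.h i := by
  have h1 : W.genGr 1 ≤ gr W.h 1 := fun v hv => by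
    rw [mem_gr_iff, lie_h_eq_of_highest_two W.sl2 (U := W.genGr 1)
      (fun u hu => W.lie_h_mem_genGr hu)
      (fun u hu => W.eq_zero_of_mem_genGr hf (i := 2) (by norm_num) rfl
        (W.lie_e_mem_genGr hu (by norm_num)))
      (fun u _ => W.lie_f_f_f hf u)
      (fun c hc u hu => W.eq_zero_of_lie_h_eq (by simpa using hc) hu) hv]
    norm_num
  have h2 : W.genGr (-1) ≤ gr W.h (-1) := fun v hv => by
    have := lie_h_eq_of_highest_two W.sl2.symm (U := W.genGr (-1))
      (fun u hu => by rw [neg_lie]; exact neg_mem (W.lie_h_mem_genGr hu))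
      (fun u hu => W.eq_zero_of_mem_genGr hf (i := -2) (by norm_num) rfl
        (W.lie_f_mem_genGr hu (by norm_num)))
      (fun u hu => W.eq_zero_of_mem_genGr hf (i := 2) (by norm_num) rfl
        (W.lie_e_mem_genGr (W.lie_e_mem_genGr (W.lie_e_mem_genGr hu rfl) rfl) (by norm_num)))
      (fun c hc u hu h => W.eq_zero_of_lie_h_eq (c := -c) (fun h' => hc (by linear_combination -h'))
        hu (by rw [← neg_neg ⁅W.h, u⁆, ← neg_lie, h, neg_smul])) hv
    rw [mem_gr_iff, ← neg_neg ⁅W.h, v⁆, ← neg_lie, this, ← neg_smul]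
    norm_num
  simp only [Set.mem_insert_iff, Set.mem_singleton_iff] at hi
  rcases hi with rfl | rfl | rfl | rfl | rfl
  · exact_mod_cast h2
  · intro v hv
    have := lie_h_eq_of_highest_one W.sl2.symm (U := W.genGr ((-1 / 2 : ℚ) : ℂ))
      (fun u hu => by rw [neg_lie]; exact neg_mem (W.lie_h_mem_genGr hu))
      (fun u hu => W.eq_zero_of_mem_genGr hf (i := -3 / 2) (by norm_num) rfl
        (W.lie_f_mem_genGr hu (by norm_num)))
      (fun u hu => W.eq_zero_of_mem_genGr hf (i := 3 / 2) (by norm_num) rfl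
        (W.lie_e_mem_genGr (W.lie_e_mem_genGr hu rfl) (by norm_num)))
      (fun c hc u hu h => W.eq_zero_of_lie_h_eq (c := -c)
        (fun h' => hc (by push_cast at h'; linear_combination -h'))
        hu (by rw [← neg_neg ⁅W.h, u⁆, ← neg_lie, h, neg_smul])) hv
    rw [mem_gr_iff, ← neg_neg ⁅W.h, v⁆, ← neg_lie, this]
    norm_num
  · intro v hv
    rw [Rat.cast_zero] at hv
    have hg1 : ∀ {u}, u ∈ W.genGr 1 → ⁅W.h, u⁆ = (2 : ℂ) • u := fun hu => by
      rw [mem_gr_iff.1 (h1 hu)]; norm_num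
    have hg2 : ∀ {u}, u ∈ W.genGr (-1) → ⁅W.h, u⁆ = -((2 : ℂ) • u) := fun hu => by
      rw [mem_gr_iff.1 (h2 hu), ← neg_smul]; norm_num
    have he := W.lie_e_mem_genGr hv (add_zero 1)
    rw [mem_gr_iff, lie_h_eq_zero W.sl2 (hg1 he) (W.eq_zero_of_mem_genGr hf (i := 2) (by norm_num)
      rfl (W.lie_e_mem_genGr he (by norm_num)))]
    · simp
    · intro w hw
      have hw0 : w ∈ W.genGr 0 := by
        rw [hw]
        exact sub_mem hv (Submodule.smul_mem _ _ (W.lie_f_mem_genGr he (by norm_num)))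
      have hfw := W.lie_f_mem_genGr hw0 (add_zero (-1))
      exact ⟨hg2 hfw, W.eq_zero_of_mem_genGr hf (i := -2) (by norm_num) rfl
        (W.lie_f_mem_genGr hfw (by norm_num))⟩
  · intro v hv
    have := lie_h_eq_of_highest_one W.sl2 (U := W.genGr ((1 / 2 : ℚ) : ℂ))
      (fun u hu => W.lie_h_mem_genGr hu)
      (fun u hu => W.eq_zero_of_mem_genGr hf (i := 3 / 2) (by norm_num) rfl
        (W.lie_e_mem_genGr hu (by norm_num)))
      (fun u hu => W.eq_zero_of_mem_genGr hf (i := -3 / 2) (by norm_num) rfl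
        (W.lie_f_mem_genGr (W.lie_f_mem_genGr hu rfl) (by norm_num)))
      (fun c hc u hu => W.eq_zero_of_lie_h_eq (by push_cast; norm_num; exact hc) hu) hv
    rw [mem_gr_iff, this]
    norm_num
  · exact_mod_cast h1

theorem gr_eq_bot {i : ℚ} (hi : i < -1 ∨ 1 < i) : gr W.h i = ⊥ :=
  eq_bot_iff.2 ((W.gr_le_genGr i).trans (W.genGr_eq_bot_of_lt hf hi).le)

theorem eq_zero_of_mem_gr {i : ℚ} (hi : i < -1 ∨ 1 < i) {a : 𝔤} (ha : a ∈ gr W.h i) : a = 0 := by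
  rwa [W.gr_eq_bot hf hi, Submodule.mem_bot] at ha

theorem exists_of_genGr_ne_bot {μ : ℂ} (hμ : W.genGr μ ≠ ⊥) :
    ∃ i ∈ ({-1, -1 / 2, 0, 1 / 2, 1} : Set ℚ), μ = i := by
  obtain ⟨n, hn, h1, h2⟩ := W.exists_int_of_genGr_ne_bot hμ
  refine ⟨n / 2, ?_, hn⟩
  rw [W.d_eq_one hf] at h1 h2
  have h3 : -2 ≤ n := by
    have : (-2 : ℚ) ≤ n := by linarith
    exact_mod_cast this
  have h4 : n ≤ 2 := by
    have : (n : ℚ) ≤ 2 := by linarith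
    exact_mod_cast this
  interval_cases n <;> norm_num

theorem gr_eq_bot_of_notMem {i : ℚ} (hi : i ∉ ({-1, -1 / 2, 0, 1 / 2, 1} : Set ℚ)) :
    gr W.h i = ⊥ := by
  by_contra h
  obtain ⟨j, hj, hij⟩ := W.exists_of_genGr_ne_bot hf (μ := i)
    fun hb => h (eq_bot_iff.2 ((W.gr_le_genGr i).trans hb.le))
  exact hi ((by exact_mod_cast hij : i = j) ▸ hj)

theorem iSup_gr_eq_top :
    ⨆ (i : ℚ) (_ : i ∈ ({-1, -1 / 2, 0, 1 / 2, 1} : Set ℚ)), gr W.h i = ⊤ := by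
  rw [eq_top_iff, ← Module.End.iSup_maxGenEigenspace_eq_top
    (LieAlgebra.ad ℂ 𝔤 ((1 / 2 : ℂ) • W.h))]
  refine iSup_le fun μ => ?_
  by_cases hμ : W.genGr μ = ⊥
  · exact hμ.le.trans bot_le
  · obtain ⟨i, hi, rfl⟩ := W.exists_of_genGr_ne_bot hf hμ
    exact (W.genGr_le_gr hf hi).trans (le_iSup₂_of_le _ hi le_rfl)

end Datum

/-! ### The lines `𝔤(1)` and `𝔤(-1)`, and the resulting decompositions of `𝔤` -/

namespace Datum

variable {𝔤 : Type*} [LieRing 𝔤] [LieAlgebra ℂ 𝔤] (W : Datum 𝔤)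

theorem lie_mem_gr' {h a b : 𝔤} {i j k : ℚ} (ha : a ∈ gr h i) (hb : b ∈ gr h j)
    (hk : i + j = k) : ⁅a, b⁆ ∈ gr h k :=
  hk ▸ lie_mem_gr ha hb

variable [Module.Finite ℂ 𝔤] (hf : IsMinimalNilpotent W.f)

include hf

theorem gr_induction {motive : 𝔤 → Prop}
    (mem : ∀ i ∈ ({-1, -1 / 2, 0, 1 / 2, 1} : Set ℚ), ∀ a ∈ gr W.h i, motive a)
    (add : ∀ a b, motive a → motive b → motive (a + b)) (a : 𝔤) : motive a := by
  have hzero : motive 0 := mem 0 (by simp) 0 (zero_mem _)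
  have ha : a ∈ ⨆ (i : ℚ) (_ : i ∈ ({-1, -1 / 2, 0, 1 / 2, 1} : Set ℚ)), gr W.h i := by
    rw [W.iSup_gr_eq_top hf]
    trivial
  induction ha using Submodule.iSup_induction' with
  | zero => exact hzero
  | add a b _ _ ha hb => exact add a b ha hb
  | mem i a ha =>
    by_cases hi : i ∈ ({-1, -1 / 2, 0, 1 / 2, 1} : Set ℚ)
    · rw [iSup_pos hi] at ha
      exact mem i hi a ha
    · rw [iSup_neg hi, Submodule.mem_bot] at ha
      exact ha ▸ hzero

/-- With the mirror statement below: `(ad e)² / 4` inverts `(ad f)² : 𝔤(1) → 𝔤(-1)`. -/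
theorem lie_e_e_f_f {u : 𝔤} (hu : u ∈ gr W.h 1) : ⁅W.e, ⁅W.e, ⁅W.f, ⁅W.f, u⁆⁆⁆⁆ = (4 : ℂ) • u := by
  refine FractionalW.lie_e_e_f_f W.sl2 (W.eq_zero_of_mem_gr hf (i := 2) (by norm_num)
    (lie_mem_gr' W.e_mem hu (by norm_num))) ?_
  rw [mem_gr_iff.1 hu]
  norm_num

theorem lie_f_f_e_e {u : 𝔤} (hu : u ∈ gr W.h (-1)) :
    ⁅W.f, ⁅W.f, ⁅W.e, ⁅W.e, u⁆⁆⁆⁆ = (4 : ℂ) • u := by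
  refine FractionalW.lie_e_e_f_f W.sl2.symm (W.eq_zero_of_mem_gr hf (i := -2) (by norm_num)
    (lie_mem_gr' W.f_mem hu (by norm_num))) ?_
  rw [neg_lie, mem_gr_iff.1 hu, ← neg_smul]
  norm_num

/-- If `𝔤(-1)` contains an element that is not a multiple of `f`, then some nonzero element of
`𝔤(-1)` has a square that is not injective on `𝔤(1)`. -/
theorem exists_degenerate {y : 𝔤} (hy : y ∈ gr W.h (-1)) (hyf : ∀ c : ℂ, y ≠ c • W.f) :
    ∃ y' ∈ gr W.h (-1), y' ≠ 0 ∧ ∃ u ∈ gr W.h 1, u ≠ 0 ∧ ⁅y', ⁅y', u⁆⁆ = 0 := by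
  let D := LieAlgebra.ad ℂ 𝔤
  -- The quadratic eigenvalue problem `(ad (y + c f))² u = 0` on `𝔤(1)` is linearised: after
  -- inverting `(ad f)²` by `(ad e)² / 4`, its solutions are the eigenvectors `(u, c u)` of the
  -- companion operator `T`, and one exists over `ℂ`.
  let E : Module.End ℂ 𝔤 := (-(1 / 4 : ℂ)) • (D W.e ^ 2)
  let T : Module.End ℂ (𝔤 × 𝔤) := (LinearMap.snd ℂ 𝔤 𝔤).prod
    (E ∘ₗ ((D y ^ 2) ∘ₗ LinearMap.fst ℂ 𝔤 𝔤 +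
      (D W.f * D y + D y * D W.f) ∘ₗ LinearMap.snd ℂ 𝔤 𝔤))
  have hT : ∀ u v, T (u, v) = (v, (-(1 / 4 : ℂ)) • ⁅W.e, ⁅W.e, ⁅y, ⁅y, u⁆⁆ + (⁅W.f, ⁅y, v⁆⁆ +
      ⁅y, ⁅W.f, v⁆⁆)⁆⁆) := fun u v => rfl
  let P := (gr W.h 1).prod (gr W.h 1)
  have hPT : ∀ w ∈ P, T w ∈ P := by
    rintro ⟨u, v⟩ ⟨hu, hv⟩
    rw [hT]
    refine ⟨hv, Submodule.smul_mem _ _ (lie_mem_gr' W.e_mem (lie_mem_gr' W.e_mem (k := 0)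
      (j := -1) ?_ (by norm_num)) (by norm_num))⟩
    exact add_mem (lie_mem_gr' hy (lie_mem_gr' hy hu rfl) (by norm_num))
      (add_mem (lie_mem_gr' W.f_mem (lie_mem_gr' hy hv rfl) (by norm_num))
        (lie_mem_gr' hy (lie_mem_gr' W.f_mem hv rfl) (by norm_num)))
  have : Nontrivial P := ⟨⟨⟨(W.e, 0), W.e_mem, zero_mem _⟩, 0, fun h =>
    W.sl2.e_ne_zero (congrArg (fun w : P => (w : 𝔤 × 𝔤).1) h)⟩⟩
  obtain ⟨c, hc⟩ := Module.End.exists_eigenvalue (T.restrict hPT)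
  obtain ⟨⟨⟨u, v⟩, hu, hv⟩, hw, hw0⟩ := hc.exists_hasEigenvector
  rw [Module.End.mem_eigenspace_iff] at hw
  have hw' : T (u, v) = c • (u, v) := congrArg Subtype.val hw
  rw [hT, Prod.smul_mk, Prod.mk.injEq] at hw'
  obtain ⟨rfl, h2⟩ := hw'
  have hu0 : u ≠ 0 := by
    rintro rfl
    exact hw0 (by ext <;> simp)
  replace hu : u ∈ gr W.h 1 := hu
  refine ⟨y + c • W.f, add_mem hy (Submodule.smul_mem _ _ W.f_mem), fun h => hyf (-c) ?_, u, hu,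
    hu0, ?_⟩
  · rw [neg_smul]
    exact eq_neg_of_add_eq_zero_left h
  · have hm : ⁅y, ⁅y, u⁆⁆ + (⁅W.f, ⁅y, c • u⁆⁆ + ⁅y, ⁅W.f, c • u⁆⁆) ∈ gr W.h (-1) := by
      have hv : c • u ∈ gr W.h 1 := Submodule.smul_mem _ _ hu
      exact add_mem (lie_mem_gr' hy (lie_mem_gr' hy hu rfl) (by norm_num))
        (add_mem (lie_mem_gr' W.f_mem (lie_mem_gr' hy hv rfl) (by norm_num))
          (lie_mem_gr' hy (lie_mem_gr' W.f_mem hv rfl) (by norm_num)))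
    have h3 := congrArg (fun w => ⁅W.f, ⁅W.f, w⁆⁆) h2
    beta_reduce at h3
    rw [lie_smul, lie_smul, W.lie_f_f_e_e hf hm, smul_smul] at h3
    simp only [add_lie, lie_add, smul_lie, lie_smul] at h3 ⊢
    have h4 := sub_eq_zero.2 h3.symm
    rw [← h4]
    module

/-- `𝔤(-1) = ℂ f`. -/
theorem exists_eq_smul_f {y : 𝔤} (hy : y ∈ gr W.h (-1)) : ∃ c : ℂ, y = c • W.f := by
  by_contra! hyf
  obtain ⟨y', hy', hy0, u, hu, hu0, huy⟩ := W.exists_degenerate hf hy hyf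
  have hnil : LieAlgebra.ad ℂ 𝔤 y' ^ 3 = 0 := by
    ext a
    induction a using W.gr_induction hf with
    | add a b ha hb => rw [map_add, ha, hb, map_add]
    | mem i hi a ha =>
      have : ⁅y', ⁅y', ⁅y', a⁆⁆⁆ = 0 := by
        refine W.eq_zero_of_mem_gr hf (i := i - 3) ?_ (lie_mem_gr' hy' (lie_mem_gr' hy'
          (lie_mem_gr' hy' ha rfl) rfl) (by ring))
        simp only [Set.mem_insert_iff, Set.mem_singleton_iff] at hi
        rcases hi with rfl | rfl | rfl | rfl | rfl <;> norm_num
      simpa [pow_succ] using this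
  let A := LieAlgebra.ad ℂ 𝔤 y' ^ 2
  have hA : ∀ a, A a = ⁅y', ⁅y', a⁆⁆ := fun a => by simp [A, pow_two]
  -- For degree reasons `(ad y')²` vanishes on every `𝔤(i)` except `𝔤(1)`. There it kills `u`, so
  -- its rank is less than `dim 𝔤(1)`.
  have hrange : LinearMap.range A ≤ LinearMap.range (A ∘ₗ (gr W.h 1).subtype) := by
    rintro _ ⟨a, rfl⟩
    induction a using W.gr_induction hf with
    | add a b ha hb => rw [map_add]; exact add_mem ha hb
    | mem i hi a ha =>
      by_cases hi1 : i = 1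
      · subst hi1
        exact ⟨⟨a, ha⟩, rfl⟩
      · rw [hA, W.eq_zero_of_mem_gr hf (i := i - 2) ?_
          (lie_mem_gr' hy' (lie_mem_gr' hy' ha rfl) (by ring))]
        · exact zero_mem _
        · simp only [Set.mem_insert_iff, Set.mem_singleton_iff] at hi
          rcases hi with rfl | rfl | rfl | rfl | rfl <;> first | exact absurd rfl hi1 | norm_num
  have hlt : Module.finrank ℂ (LinearMap.range A) < Module.finrank ℂ (gr W.h 1) := by
    refine (Submodule.finrank_mono hrange).trans_lt ?_
    have h1 := LinearMap.finrank_range_add_finrank_ker (A ∘ₗ (gr W.h 1).subtype)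
    have h2 : 0 < Module.finrank ℂ (LinearMap.ker (A ∘ₗ (gr W.h 1).subtype)) := by
      rw [Module.finrank_pos_iff]
      refine ⟨⟨⟨⟨u, hu⟩, ?_⟩, 0, fun h => hu0 ?_⟩⟩
      · exact (hA u).trans huy
      · exact congrArg (fun w => ((w : gr W.h 1) : 𝔤)) (congrArg Subtype.val h)
    omega
  obtain ⟨v, hv, hv0, hfv⟩ := exists_lie_lie_eq_zero_of_mem_zariskiClosure hlt
    (hf.mem_closure y' hy0 ⟨3, hnil⟩)
  have h4 := W.lie_e_e_f_f hf hv
  rw [hfv, lie_zero, lie_zero, eq_comm, smul_eq_zero] at h4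
  exact hv0 (h4.resolve_left (by norm_num))

/-- `𝔤(1) = ℂ e`. -/
theorem exists_eq_smul_e {y : 𝔤} (hy : y ∈ gr W.h 1) : ∃ c : ℂ, y = c • W.e := by
  obtain ⟨c, hc⟩ := W.exists_eq_smul_f hf (y := ⁅W.f, ⁅W.f, y⁆⁆)
    (lie_mem_gr' W.f_mem (lie_mem_gr' W.f_mem hy rfl) (by norm_num))
  have h := W.lie_e_e_f_f hf hy
  rw [hc, lie_smul, lie_smul, W.sl2.lie_e_f, ← lie_skew, W.sl2.lie_h_e_smul ℂ] at h
  -- Here `4 y = c (ad e)² f = c [e, h] = -2 c e`.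
  refine ⟨-(c / 2), ?_⟩
  have h2 : y = (1 / 4 : ℂ) • ((4 : ℂ) • y) := by rw [smul_smul]; norm_num
  rw [h2, ← h]
  module

/-! ### The filtration of `𝔤` -/

omit [Module.Finite ℂ 𝔤] hf in
/-- `𝔤(≥ i)`. -/
def fil (i : ℚ) : Submodule ℂ 𝔤 := ⨆ (j : ℚ) (_ : i ≤ j), gr W.h j

omit [Module.Finite ℂ 𝔤] hf in
theorem gr_le_fil {i j : ℚ} (hij : i ≤ j) : gr W.h j ≤ W.fil i :=
  le_iSup₂_of_le j hij le_rfl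

omit [Module.Finite ℂ 𝔤] hf in
theorem fil_induction {i : ℚ} {motive : ∀ a, a ∈ W.fil i → Prop}
    (mem : ∀ j (hj : i ≤ j) a (ha : a ∈ gr W.h j), motive a (W.gr_le_fil hj ha))
    (add : ∀ a b ha hb, motive a ha → motive b hb → motive (a + b) (add_mem ha hb)) {a : 𝔤}
    (ha : a ∈ W.fil i) : motive a ha := by
  have hzero : motive 0 (zero_mem _) := mem i le_rfl 0 (zero_mem _)
  suffices h : ∃ h, motive a h from h.2
  have ha' : a ∈ ⨆ (j : ℚ) (_ : i ≤ j), gr W.h j := ha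
  clear ha
  induction ha' using Submodule.iSup_induction' with
  | zero => exact ⟨_, hzero⟩
  | add a b _ _ ha hb => exact ⟨_, add a b ha.1 hb.1 ha.2 hb.2⟩
  | mem j a ha =>
    by_cases hj : i ≤ j
    · rw [iSup_pos hj] at ha
      exact ⟨_, mem j hj a ha⟩
    · rw [iSup_neg hj, Submodule.mem_bot] at ha
      subst ha
      exact ⟨_, hzero⟩

omit [Module.Finite ℂ 𝔤] hf in
theorem lie_mem_fil {i j k : ℚ} {a b : 𝔤} (ha : a ∈ W.fil i) (hb : b ∈ W.fil j)
    (hk : i + j = k) : ⁅a, b⁆ ∈ W.fil k := by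
  induction ha using W.fil_induction with
  | add a a' _ _ h1 h2 => rw [add_lie]; exact add_mem h1 h2
  | mem i' hi a ha =>
    induction hb using W.fil_induction with
    | add a a' _ _ h1 h2 => rw [lie_add]; exact add_mem h1 h2
    | mem j' hj b hb => exact W.gr_le_fil (by linarith) (lie_mem_gr ha hb)

theorem mem_fil (a : 𝔤) : a ∈ W.fil (-1) := by
  induction a using W.gr_induction hf with
  | add a b ha hb => exact add_mem ha hb
  | mem i hi a ha =>
    refine W.gr_le_fil ?_ ha
    simp only [Set.mem_insert_iff, Set.mem_singleton_iff] at hi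
    rcases hi with rfl | rfl | rfl | rfl | rfl <;> norm_num

theorem eq_zero_of_mem_fil {i : ℚ} (hi : 1 < i) {a : 𝔤} (ha : a ∈ W.fil i) : a = 0 := by
  induction ha using W.fil_induction with
  | add a b _ _ ha hb => rw [ha, hb, add_zero]
  | mem j hj a ha => exact W.eq_zero_of_mem_gr hf (Or.inr (by linarith)) ha

omit [Module.Finite ℂ 𝔤] hf in
theorem form_eq_zero_of_mem_fil {i j : ℚ} (hij : 0 < i + j) {a b : 𝔤} (ha : a ∈ W.fil i)
    (hb : b ∈ W.fil j) : W.form a b = 0 := by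
  induction ha using W.fil_induction with
  | add a a' _ _ h1 h2 => rw [map_add, LinearMap.add_apply, h1, h2, add_zero]
  | mem i' hi a ha =>
    induction hb using W.fil_induction with
    | add a a' _ _ h1 h2 => rw [map_add, h1, h2, add_zero]
    | mem j' hj b hb => exact W.form_eq_zero (by linarith) ha hb

/-- `𝔫 = 𝔤(1/2) ⊕ ℂ e`. -/
theorem exists_eq_add_of_mem_nil {n : 𝔤} (hn : n ∈ nil W.h) :
    ∃ y ∈ gr W.h (1 / 2), ∃ c : ℂ, n = y + c • W.e := by
  have hn' : n ∈ W.fil (1 / 2) := hn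
  induction hn' using W.fil_induction with
  | add a b _ _ ha hb =>
    obtain ⟨y, hy, c, rfl⟩ := ha ‹_›
    obtain ⟨y', hy', c', rfl⟩ := hb ‹_›
    exact ⟨y + y', add_mem hy hy', c + c', by rw [add_smul]; abel⟩
  | mem j hj a ha =>
    by_cases h1 : j = 1 / 2
    · exact ⟨a, h1 ▸ ha, 0, by simp⟩
    by_cases h2 : j = 1
    · obtain ⟨c, rfl⟩ := W.exists_eq_smul_e hf (h2 ▸ ha)
      exact ⟨0, zero_mem _, c, by simp⟩
    · refine ⟨0, zero_mem _, 0, ?_⟩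
      rw [W.gr_eq_bot_of_notMem hf (i := j), Submodule.mem_bot] at ha
      · simp [ha]
      · simp only [Set.mem_insert_iff, Set.mem_singleton_iff, h1, h2, or_false]
        rintro (rfl | rfl | rfl) <;> norm_num at hj

/-! ### The decomposition of `𝔤` with respect to the centralizer of `f` -/

omit [Module.Finite ℂ 𝔤] hf in
/-- The centralizer `𝔤_f`. -/
def centF : Submodule ℂ 𝔤 := LinearMap.ker (LieAlgebra.ad ℂ 𝔤 W.f)

omit [Module.Finite ℂ 𝔤] hf in
theorem mem_centF {a : 𝔤} : a ∈ W.centF ↔ ⁅W.f, a⁆ = 0 := LinearMap.mem_ker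

omit [Module.Finite ℂ 𝔤] hf in
/-- The complement `𝔤(1/2) ⊕ ℂ x ⊕ ℂ e` of `𝔤_f`. -/
def compF : Submodule ℂ 𝔤 := gr W.h (1 / 2) ⊔ (ℂ ∙ W.x) ⊔ (ℂ ∙ W.e)

/-- Pairing `[f, u + d x + c e] = 0` with `e` and `h` isolates `d` and `c`, and `ad f` is injective
on `𝔤(1/2)` because `[e, [f, u]] = u`. For spanning, `𝔤(i)` with `i < 0` centralizes `f`, and for `a
∈ 𝔤(0)` the bracket `[f, a]` is a multiple of `f = [f, x]`. -/
theorem isCompl_centF_compF : IsCompl W.centF W.compF := by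
  constructor
  · rw [Submodule.disjoint_def]
    intro a ha ha'
    rw [mem_centF] at ha
    obtain ⟨b, hb, c, hc, rfl⟩ := Submodule.mem_sup.1 ha'
    obtain ⟨u, hu, d, hd, rfl⟩ := Submodule.mem_sup.1 hb
    obtain ⟨d, rfl⟩ := Submodule.mem_span_singleton.1 hd
    obtain ⟨c, rfl⟩ := Submodule.mem_span_singleton.1 hc
    have hfe : ⁅W.f, W.e⁆ = -W.h := by rw [← lie_skew, W.sl2.lie_e_f]
    have hh : W.h ∈ gr W.h 0 := by rw [mem_gr_iff]; simp
    rw [lie_add, lie_add, lie_smul, lie_smul, W.lie_f_x, hfe] at ha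
    have hfu : ⁅W.f, u⁆ ∈ gr W.h (-1 / 2) := lie_mem_gr' W.f_mem hu (by norm_num)
    have h1 := congrArg (W.form W.e) ha
    have h2 := congrArg (W.form W.h) ha
    simp only [map_add, map_smul, map_neg, smul_eq_mul, map_zero, W.form_e_f, W.form_h_h,
      W.form_eq_zero (by norm_num) W.e_mem hfu, W.form_eq_zero (by norm_num) W.e_mem hh,
      W.form_eq_zero (by norm_num) hh hfu, W.form_eq_zero (by norm_num) hh W.f_mem] at h1 h2
    have hd0 : d = 0 := by linear_combination h1
    have hc0 : c = 0 := by linear_combination -h2 / 2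
    subst hd0 hc0
    rw [zero_smul, zero_smul, add_zero, add_zero] at ha ⊢
    have h3 := lie_e_lie_f W.sl2 u
    rw [ha, lie_zero, W.eq_zero_of_mem_gr hf (i := 3 / 2) (by norm_num)
      (lie_mem_gr' W.e_mem hu (by norm_num)), lie_zero, add_zero, mem_gr_iff.1 hu] at h3
    simpa using h3.symm
  · rw [codisjoint_iff_le_sup]
    rintro a -
    induction a using W.gr_induction hf with
    | add a b ha hb => exact add_mem ha hb
    | mem i hi a ha =>
      simp only [Set.mem_insert_iff, Set.mem_singleton_iff] at hi
      have hcent : ∀ j : ℚ, j < 0 → ∀ a ∈ gr W.h j, a ∈ W.centF ⊔ W.compF := fun j hj a ha =>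
        Submodule.mem_sup_left (W.mem_centF.2 (W.eq_zero_of_mem_gr hf (i := -1 + j)
          (Or.inl (by linarith)) (lie_mem_gr W.f_mem ha)))
      rcases hi with rfl | rfl | rfl | rfl | rfl
      · exact hcent _ (by norm_num) a ha
      · exact hcent _ (by norm_num) a ha
      · obtain ⟨c, hc⟩ := W.exists_eq_smul_f hf (lie_mem_gr' W.f_mem ha (by norm_num))
        have h1 : a - c • W.x ∈ W.centF := by
          rw [mem_centF, lie_sub, lie_smul, W.lie_f_x, hc, sub_self]
        have h2 : c • W.x ∈ W.compF := Submodule.mem_sup_left (Submodule.mem_sup_right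
          (Submodule.smul_mem _ _ (Submodule.mem_span_singleton_self _)))
        rw [← sub_add_cancel a (c • W.x)]
        exact Submodule.add_mem_sup h1 h2
      · exact Submodule.mem_sup_right (Submodule.mem_sup_left (Submodule.mem_sup_left ha))
      · obtain ⟨c, rfl⟩ := W.exists_eq_smul_e hf ha
        exact Submodule.mem_sup_right (Submodule.mem_sup_right
          (Submodule.smul_mem _ _ (Submodule.mem_span_singleton_self _)))

end Datum

/-! ### Coefficients in the loop algebra -/

section Loop

variable {𝔤 : Type*} [LieRing 𝔤] [LieAlgebra ℂ 𝔤]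

/-- The map taking an element of the loop algebra to its coefficient at `z^j`. -/
def loopCoef (j : ℤ) : Loop 𝔤 →ₗ[ℂ] 𝔤 :=
  let c : AddMonoidAlgebra ℂ ℤ →ₗ[ℂ] 𝔤 →ₗ[ℂ] 𝔤 :=
    LinearMap.lsmul ℂ 𝔤 ∘ₗ (AddMonoidAlgebra.basis ℤ ℂ).coord j
  let L : LieAlgebra.loopAlgebra ℂ ℤ 𝔤 →ₗ[ℂ] 𝔤 := TensorProduct.lift c
  { toFun := fun v => L v
    map_add' := fun u v => L.map_add u v
    map_smul' := fun c u => L.map_smul c u }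

theorem loopCoef_zp (i j : ℤ) (a : 𝔤) : loopCoef j (zp i a) = if i = j then a else 0 := by
  have h : loopCoef j (zp i a) =
      ((AddMonoidAlgebra.basis ℤ ℂ).coord j (AddMonoidAlgebra.single i (1 : ℂ))) • a := rfl
  rw [h, ← AddMonoidAlgebra.basis_apply, Module.Basis.coord_apply, Module.Basis.repr_self,
    Finsupp.single_apply]
  split_ifs <;> simp

end Loop

namespace Datum

variable {𝔤 : Type*} [LieRing 𝔤] [LieAlgebra ℂ 𝔤] (W : Datum 𝔤)

/-! ### The space `ĝ⁺` -/

theorem gPlus_induction {motive : W.gPlus → Prop} (cls : ∀ j a, motive (W.cls j a))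
    (add : ∀ a b, motive a → motive b → motive (a + b)) (q : W.gPlus) : motive q := by
  obtain ⟨⟨v, hv⟩, rfl⟩ := W.high.mkQ_surjective q
  suffices h : ∃ hv, motive (W.high.mkQ ⟨v, hv⟩) from h.2
  have hv' : v ∈ ⨆ (j : ℕ), LinearMap.range (zp (𝔤 := 𝔤) (j : ℤ)) := hv
  clear hv
  induction hv' using Submodule.iSup_induction' with
  | zero =>
    refine ⟨zero_mem _, ?_⟩
    have := cls 0 0
    rw [map_zero] at this
    exact this
  | add a b _ _ ha hb => exact ⟨add_mem ha.1 hb.1, add _ _ ha.2 hb.2⟩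
  | mem j a ha =>
    obtain ⟨a, rfl⟩ := ha
    exact ⟨Submodule.mem_iSup_of_mem j ⟨a, rfl⟩, cls j a⟩

theorem gPlus_hom_ext {M : Type*} [AddCommMonoid M] [Module ℂ M] {F G : W.gPlus →ₗ[ℂ] M}
    (h : ∀ j a, F (W.cls j a) = G (W.cls j a)) : F = G := by
  refine LinearMap.ext fun q => ?_
  induction q using W.gPlus_induction with
  | cls j a => exact h j a
  | add a b ha hb => rw [map_add, map_add, ha, hb]

theorem zp_mem (j : ℕ) (a : 𝔤) : zp (j : ℤ) a ∈ loopNonneg 𝔤 :=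
  Submodule.mem_iSup_of_mem j ⟨a, rfl⟩

theorem cls_eq (j : ℕ) (a : 𝔤) : W.cls j a = W.high.mkQ ⟨zp (j : ℤ) a, zp_mem j a⟩ := rfl

theorem act_cls (n : nil W.h) (j : ℕ) (a : 𝔤) : W.act n (W.cls j a) = W.cls j ⁅(n : 𝔤), a⁆ := by
  have h : adNonneg (n : 𝔤) ⟨zp (j : ℤ) a, zp_mem j a⟩ = ⟨zp (j : ℤ) ⁅(n : 𝔤), a⁆, zp_mem j _⟩ :=
    Subtype.ext ((lie_zp 0 j (n : 𝔤) a).trans (by rw [zero_add]))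
  exact congrArg W.high.mkQ h

theorem br_cls (n : nil W.h) (j : ℕ) (a : 𝔤) : W.br n (W.cls j a) = W.cls j ⁅a, (n : 𝔤)⁆ := by
  rw [br, LinearMap.neg_apply, act_cls, ← map_neg, lie_skew]

theorem pair_cls (n : nil W.h) (j : ℕ) (a : 𝔤) :
    W.pair n (W.cls j a) = if j = 0 then W.form n a else 0 := by
  have h : W.pair n (W.cls j a) = loopForm W.form (zp 0 (n : 𝔤)) (zp j a) := rfl
  rw [h, loopForm_zp]
  rw [zero_add]
  norm_cast

theorem cls_eq_zero {i : ℚ} {j : ℕ} (h : W.topDeg < (W.d + 1) * j + i) {a : 𝔤}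
    (ha : a ∈ gr W.h i) : W.cls j a = 0 := by
  rw [cls_eq, Submodule.mkQ_apply, Submodule.Quotient.mk_eq_zero]
  refine Submodule.mem_iSup_of_mem _ (Submodule.mem_iSup_of_mem h (Submodule.subset_span ?_))
  exact ⟨i, j, a, ha, by norm_cast, rfl⟩

theorem high_le_ker {M : Type*} [AddCommGroup M] [Module ℂ M] (F : Loop 𝔤 →ₗ[ℂ] M)
    (hF : ∀ (i : ℚ) (j : ℤ), W.topDeg < (W.d + 1) * j + i → ∀ a ∈ gr W.h i, F (zp j a) = 0) :
    W.high ≤ LinearMap.ker (F ∘ₗ (loopNonneg 𝔤).subtype) := by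
  rintro ⟨v, hv⟩ hv'
  rw [LinearMap.mem_ker, LinearMap.comp_apply, Submodule.subtype_apply]
  have h : v ∈ loopGT W.h W.d W.topDeg := hv'
  change F v = 0
  clear hv hv'
  unfold loopGT at h
  induction h using Submodule.iSup_induction' with
  | zero => exact map_zero F
  | add a b _ _ ha hb => rw [map_add, ha, hb, add_zero]
  | mem r a ha =>
    by_cases hr : W.topDeg < r
    · rw [iSup_pos hr] at ha
      induction ha using Submodule.span_induction with
      | mem a ha =>
        obtain ⟨i', j, b, hb, rfl, rfl⟩ := ha
        exact hF i' j hr b hb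
      | zero => exact map_zero F
      | add y y' _ _ h1 h2 => rw [map_add, h1, h2, add_zero]
      | smul c y _ h1 => rw [map_smul, h1, smul_zero]
    · rw [iSup_neg hr, Submodule.mem_bot] at ha
      rw [ha, map_zero]

theorem chi_zp (j : ℤ) (a : 𝔤) : W.chi (zp j a) =
    -(if -(W.m : ℤ) + j = 0 then W.form W.f a else 0) -
      (if -(W.m : ℤ) - 1 + j = 0 then W.form W.p a else 0) := by
  rw [chi, Lam, map_sub, map_neg, LinearMap.sub_apply, LinearMap.neg_apply, loopForm_zp,
    loopForm_zp]

/-- The functional induced by `χ` on `ĝ⁺`. -/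
def chiPlus : Module.Dual ℂ W.gPlus :=
  W.high.liftQ (W.chi ∘ₗ (loopNonneg 𝔤).subtype) (W.high_le_ker W.chi (by
    intro i j hij a ha
    have hd := W.one_le_d
    unfold topDeg at hij
    rw [chi_zp, ite_eq_right_iff.2, ite_eq_right_iff.2, neg_zero, sub_zero]
    · intro hj
      obtain rfl : j = W.m + 1 := by omega
      refine W.form_eq_zero ?_ W.p_mem ha
      push_cast at hij
      linarith
    · intro hj
      obtain rfl : j = W.m := by omega
      refine W.form_eq_zero ?_ W.f_mem ha
      push_cast at hij
      linarith))

theorem chiPlus_cls (j : ℕ) (a : 𝔤) : W.chiPlus (W.cls j a) =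
    -(if j = W.m then W.form W.f a else 0) - (if j = W.m + 1 then W.form W.p a else 0) := by
  rw [cls_eq, chiPlus, Submodule.mkQ_apply, Submodule.liftQ_apply, LinearMap.comp_apply]
  refine (W.chi_zp j a).trans ?_
  have h1 : -(W.m : ℤ) + j = 0 ↔ j = W.m := by omega
  have h2 : -(W.m : ℤ) - 1 + j = 0 ↔ j = W.m + 1 := by omega
  simp only [h1, h2]

theorem chiPlus_cls_e : W.chiPlus (W.cls W.m W.e) = -1 := by
  rw [chiPlus_cls, if_pos rfl, if_neg (by omega), ← W.form_symm.eq W.e W.f]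
  simp [W.form_e_f]

variable [Module.Finite ℂ 𝔤] (hf : IsMinimalNilpotent W.f)

/-- The coefficient at `z^j` of an element of `ĝ⁺`, for `j ≤ m`. -/
def coef (j : ℕ) (hj : j ≤ W.m) : W.gPlus →ₗ[ℂ] 𝔤 :=
  W.high.liftQ (loopCoef (j : ℤ) ∘ₗ (loopNonneg 𝔤).subtype) (W.high_le_ker _ (by
    -- Since `d = 1`, a term `a z^j` with `j ≤ m` of degree above `2m + 1` would have `a ∈ 𝔤(i)`
    -- with `i > 1`, hence `a = 0`.
    intro i l hil a ha
    rw [loopCoef_zp, ite_eq_right_iff]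
    rintro rfl
    have h1 := W.one_le_d
    have h2 : (j : ℚ) ≤ W.m := by exact_mod_cast hj
    unfold topDeg at hil
    push_cast at hil
    rw [W.d_eq_one hf] at hil
    exact W.eq_zero_of_mem_gr hf (Or.inr (by linarith)) ha))

theorem coef_cls (j l : ℕ) (hj : j ≤ W.m) (a : 𝔤) :
    W.coef hf j hj (W.cls l a) = if l = j then a else 0 := by
  rw [cls_eq, coef, Submodule.mkQ_apply, Submodule.liftQ_apply, LinearMap.comp_apply]
  refine (loopCoef_zp l j a).trans ?_
  norm_cast

include hf

/-- Degree `2j + i ≤ 2m + 1` with `j > m` and `i ≥ -1` leaves only `j = m + 1`, `i = -1`. This is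
the top degree, so in `𝒱` every `a z^j` with `j > m` becomes a scalar. -/
theorem cls_eq_smul_of_lt {j : ℕ} (hj : W.m < j) (a : 𝔤) :
    ∃ c : ℂ, W.cls j a = c • W.cls (W.m + 1) W.f := by
  have hj' : (W.m : ℚ) + 1 ≤ j := by exact_mod_cast hj
  induction a using W.gr_induction hf with
  | add a b ha hb =>
    obtain ⟨c, hc⟩ := ha
    obtain ⟨c', hc'⟩ := hb
    exact ⟨c + c', by rw [map_add, hc, hc', add_smul]⟩
  | mem i hi a ha =>
    by_cases h : W.topDeg < (W.d + 1) * j + i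
    · exact ⟨0, by rw [W.cls_eq_zero h ha, zero_smul]⟩
    · have hi1 : i = -1 ∧ j = W.m + 1 := by
        unfold topDeg at h
        rw [W.d_eq_one hf] at h
        have hi2 : -1 ≤ i := by
          simp only [Set.mem_insert_iff, Set.mem_singleton_iff] at hi
          rcases hi with rfl | rfl | rfl | rfl | rfl <;> norm_num
        have h1 : i = -1 := by linarith
        have h2 : (j : ℚ) = W.m + 1 := by linarith
        exact ⟨h1, by exact_mod_cast h2⟩
      obtain ⟨rfl, rfl⟩ := hi1
      obtain ⟨c, rfl⟩ := W.exists_eq_smul_f hf ha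
      exact ⟨c, map_smul _ _ _⟩

/-- Every product of five operators `br y` vanishes. -/
theorem br_five (y₁ y₂ y₃ y₄ y₅ : nil W.h) (q : W.gPlus) :
    W.br y₅ (W.br y₄ (W.br y₃ (W.br y₂ (W.br y₁ q)))) = 0 := by
  induction q using W.gPlus_induction with
  | add a b ha hb => simp only [map_add, ha, hb, add_zero]
  | cls j a =>
    simp only [br_cls]
    -- Each bracket raises the filtration by `1/2`, from `-1` to `3/2 > 1` after five. Hence the sum
    -- defining `η̃` is a full exponential although it stops at `l = 4`.
    have h0 := W.mem_fil hf a
    have h1 := W.lie_mem_fil h0 y₁.2 rfl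
    have h2 := W.lie_mem_fil h1 y₂.2 rfl
    have h3 := W.lie_mem_fil h2 y₃.2 rfl
    have h4 := W.lie_mem_fil h3 y₄.2 rfl
    have h5 := W.lie_mem_fil h4 y₅.2 rfl
    rw [W.eq_zero_of_mem_fil hf (by norm_num) h5, map_zero]

/-- Two brackets with `𝔫` reach `𝔤(≥ 0)`, which is orthogonal to `𝔫`. This is what makes `T² κ = 0`.
-/
theorem pair_br_br (n y₁ y₂ : nil W.h) (q : W.gPlus) : W.pair n (W.br y₂ (W.br y₁ q)) = 0 := by
  induction q using W.gPlus_induction with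
  | add a b ha hb => simp only [map_add, ha, hb, add_zero]
  | cls j a =>
    rw [br_cls, br_cls, pair_cls, ite_eq_right_iff]
    intro _
    exact W.form_eq_zero_of_mem_fil (by norm_num) n.2
      (W.lie_mem_fil (W.lie_mem_fil (W.mem_fil hf a) y₁.2 rfl) y₂.2 rfl)

omit [Module.Finite ℂ 𝔤] hf

/-! ### The differential algebra `𝒱` -/

theorem iterate_derS (n : ℕ) (a : W.gPlus) :
    W.derS^[n] (W.genS a) = SymmetricAlgebra.ι ℂ _ ((Polynomial.X ^ n : ℂ[X]) ⊗ₜ[ℂ] a) := by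
  induction n with
  | zero => rw [pow_zero]; rfl
  | succ n ih =>
    rw [Function.iterate_succ_apply', ih, derS, symDer_ι, LinearMap.comp_apply,
      LinearMap.rTensor_tmul, LinearMap.mulLeft_apply, pow_succ']

theorem der_mk (s : W.SV) :
    W.der (Ideal.Quotient.mk W.relIdeal s) = Ideal.Quotient.mk W.relIdeal (W.derS s) := rfl

theorem V_induction {motive : W.V → Prop} (gen : ∀ a, motive (W.gen a))
    (algebraMap : ∀ c : ℂ, motive (algebraMap ℂ W.V c))
    (add : ∀ u v, motive u → motive v → motive (u + v))
    (mul : ∀ u v, motive u → motive v → motive (u * v))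
    (der : ∀ u, motive u → motive (W.der u)) (v : W.V) : motive v := by
  obtain ⟨s, rfl⟩ := Ideal.Quotient.mk_surjective v
  induction s using SymmetricAlgebra.induction with
  | algebraMap r => exact algebraMap r
  | mul a b ha hb => rw [map_mul]; exact mul _ _ ha hb
  | add a b ha hb => rw [map_add]; exact add _ _ ha hb
  | ι v =>
    induction v using TensorProduct.induction_on with
    | zero => rw [map_zero, map_zero]; simpa using algebraMap 0
    | add a b ha hb => rw [map_add, map_add]; exact add _ _ ha hb
    | tmul q a =>
      induction q using Polynomial.induction_on' with
      | add p q hp hq => rw [TensorProduct.add_tmul, map_add, map_add]; exact add _ _ hp hq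
      | monomial n c =>
        have h : SymmetricAlgebra.ι ℂ _ ((Polynomial.monomial n c : ℂ[X]) ⊗ₜ[ℂ] a) =
            W.derS^[n] (W.genS (c • a)) := by
          rw [iterate_derS, ← TensorProduct.smul_tmul, Polynomial.smul_X_eq_monomial]
        rw [h]
        have h2 : ∀ n, motive (Ideal.Quotient.mk W.relIdeal (W.derS^[n] (W.genS (c • a)))) := by
          intro n
          induction n with
          | zero => exact gen (c • a)
          | succ n ih => rw [Function.iterate_succ_apply', ← der_mk]; exact der _ ih
        exact h2 n

theorem gen_mkQ (a : loopNonneg 𝔤) (ha : (a : Loop 𝔤) ∈ loopGr W.h W.d W.topDeg) :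
    W.gen (W.high.mkQ a) = algebraMap ℂ W.V (W.chi a) := by
  refine Ideal.Quotient.eq.2 (Ideal.subset_span ⟨a, 0, ha, rfl⟩)

theorem gen_cls_of_topDeg {i : ℚ} {j : ℕ} (hij : (W.d + 1) * j + i = W.topDeg) {a : 𝔤}
    (ha : a ∈ gr W.h i) : W.gen (W.cls j a) = algebraMap ℂ W.V (W.chiPlus (W.cls j a)) :=
  W.gen_mkQ ⟨zp (j : ℤ) a, zp_mem j a⟩
    (Submodule.subset_span ⟨i, j, a, ha, by push_cast; exact hij, rfl⟩)

theorem adLam_gen (n : nil W.h) (a : W.gPlus) : W.adLam n (W.gen a) =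
    Polynomial.C (W.gen (W.act n a)) +
      Polynomial.X * Polynomial.C (algebraMap ℂ W.V (W.k * W.pair n a)) := by
  have h : W.adLam n (W.gen a) = W.adLamS n (W.genS a) := rfl
  rw [h, genS, adLamS, LinearMap.comp_apply, symDer_ι, TensorProduct.mk_apply,
    TensorProduct.lift.tmul]
  simp [adLamGen, Polynomial.C_eq_algebraMap]

theorem adLam_der (n : nil W.h) (v : W.V) : W.adLam n (W.der v) = shift W.der (W.adLam n v) := by
  obtain ⟨s, rfl⟩ := Ideal.Quotient.mk_surjective v
  exact W.adLamS_derS n s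

/-- The universal property of `𝒱` as a differential algebra: compatibility with the derivations
propagates the relations from `a - χ(a)` to the whole differential ideal. -/
theorem exists_lift {A : Type*} [CommRing A] [Algebra ℂ A] (D : Derivation ℂ A A)
    (φ : W.gPlus →ₗ[ℂ] A) (hφ : ∀ a : loopNonneg 𝔤, (a : Loop 𝔤) ∈ loopGr W.h W.d W.topDeg →
      φ (W.high.mkQ a) = algebraMap ℂ A (W.chi a)) :
    ∃ Ψ : W.V →ₐ[ℂ] A, (∀ a, Ψ (W.gen a) = φ a) ∧ ∀ v, Ψ (W.der v) = D (Ψ v) := by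
  let Φ : W.SV →ₐ[ℂ] A := SymmetricAlgebra.lift (TensorProduct.lift
    (LinearMap.lcomp ℂ A φ ∘ₗ
      (Polynomial.aeval D.toLinearMap : ℂ[X] →ₐ[ℂ] Module.End ℂ A).toLinearMap))
  have hΦ : ∀ (q : ℂ[X]) a, Φ (SymmetricAlgebra.ι ℂ _ (q ⊗ₜ[ℂ] a)) =
      Polynomial.aeval D.toLinearMap q (φ a) := fun q a => by
    simp only [Φ, SymmetricAlgebra.lift_ι_apply, TensorProduct.lift.tmul]
    rfl
  have hΦg : ∀ a, Φ (W.genS a) = φ a := fun a => by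
    refine (hΦ 1 a).trans ?_
    rw [map_one]; rfl
  have hΦD : ∀ s, Φ (W.derS s) = D (Φ s) := by
    intro s
    induction s using SymmetricAlgebra.induction with
    | algebraMap r => rw [Derivation.map_algebraMap, map_zero, AlgHom.commutes,
        Derivation.map_algebraMap]
    | mul a b ha hb =>
      simp only [Derivation.leibniz, map_add, smul_eq_mul, map_mul, ha, hb]
    | add a b ha hb => simp only [map_add, ha, hb]
    | ι v =>
      rw [derS, symDer_ι, LinearMap.comp_apply]
      induction v using TensorProduct.induction_on with
      | zero => simp
      | add a b ha hb => simp only [map_add, ha, hb]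
      | tmul q a =>
        rw [LinearMap.rTensor_tmul, LinearMap.mulLeft_apply, hΦ, hΦ, map_mul, Polynomial.aeval_X]
        rfl
  have hker : ∀ s ∈ W.relIdeal, Φ s = 0 := by
    intro s hs
    unfold relIdeal at hs
    induction hs using Submodule.span_induction with
    | zero => exact map_zero Φ
    | add a b _ _ ha hb => rw [map_add, ha, hb, add_zero]
    | smul a b _ hb => rw [smul_eq_mul, map_mul, hb, mul_zero]
    | mem s hs =>
      obtain ⟨a, n, ha, rfl⟩ := hs
      induction n with
      | zero => rw [Function.iterate_zero_apply, map_sub, hΦg, hφ a ha, AlgHom.commutes, sub_self]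
      | succ n ih => rw [Function.iterate_succ_apply', hΦD, ih, map_zero]
  refine ⟨Ideal.Quotient.liftₐ W.relIdeal Φ hker, hΦg, fun v => ?_⟩
  obtain ⟨s, rfl⟩ := Ideal.Quotient.mk_surjective v
  exact hΦD s

end Datum

namespace Datum

variable {𝔤 : Type*} [LieRing 𝔤] [LieAlgebra ℂ 𝔤] (W : Datum 𝔤)

/-! ### The Lie algebra `𝔫` -/

/-- The Lie bracket of `𝔫`. -/
def nb : nil W.h →ₗ[ℂ] nil W.h →ₗ[ℂ] nil W.h :=
  LinearMap.mk₂ ℂ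
    (fun a b => ⟨⁅(a : 𝔤), (b : 𝔤)⁆,
      (biSup_mono fun _ hi => by linarith : W.fil (1 / 2 + 1 / 2) ≤ nil W.h)
        (W.lie_mem_fil a.2 b.2 rfl)⟩)
    (fun a a' b => Subtype.ext (add_lie _ _ _)) (fun c a b => Subtype.ext (smul_lie c _ _))
    (fun a b b' => Subtype.ext (lie_add _ _ _)) (fun c a b => Subtype.ext (lie_smul c _ _))

theorem coe_nb (a b : nil W.h) : (W.nb a b : 𝔤) = ⁅(a : 𝔤), (b : 𝔤)⁆ := rfl

theorem nb_skew (a b : nil W.h) : W.nb a b = -W.nb b a :=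
  Subtype.ext (lie_skew (a : 𝔤) (b : 𝔤)).symm

/-- The element `e` of `𝔫`. -/
def eNil : nil W.h := ⟨W.e, W.e_mem_nil⟩

/-- `br` as a linear map. -/
def brL : nil W.h →ₗ[ℂ] Module.End ℂ W.gPlus where
  toFun := W.br
  map_add' a b := W.gPlus_hom_ext fun j c => by
    rw [LinearMap.add_apply, br_cls, br_cls, br_cls, ← map_add, ← lie_add]; rfl
  map_smul' a b := W.gPlus_hom_ext fun j c => by
    rw [LinearMap.smul_apply, br_cls, br_cls, RingHom.id_apply, ← map_smul, ← lie_smul]; rfl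

/-- `pair` as a linear map. -/
def pairL : nil W.h →ₗ[ℂ] Module.Dual ℂ W.gPlus where
  toFun := W.pair
  map_add' a b := W.gPlus_hom_ext fun j c => by
    rw [LinearMap.add_apply, pair_cls, pair_cls, pair_cls]
    split_ifs <;> simp
  map_smul' a b := W.gPlus_hom_ext fun j c => by
    rw [LinearMap.smul_apply, pair_cls, pair_cls, RingHom.id_apply]
    split_ifs <;> simp

theorem brL_apply (y : nil W.h) : W.brL y = W.br y := rfl

theorem br_br_sub (y y' : nil W.h) (q : W.gPlus) :
    W.br y' (W.br y q) - W.br y (W.br y' q) = W.br (W.nb y y') q := by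
  induction q using W.gPlus_induction with
  | add a b ha hb => rw [map_add, map_add, map_add, map_add, map_add, ← ha, ← hb]; abel
  | cls j a =>
    rw [br_cls, br_cls, br_cls, br_cls, br_cls, ← map_sub, coe_nb, leibniz_lie a]
    congr 1
    rw [← lie_skew ⁅a, (y' : 𝔤)⁆ (y : 𝔤)]
    abel

theorem pair_br (n y : nil W.h) (q : W.gPlus) : W.pair n (W.br y q) = -W.pair (W.nb n y) q := by
  induction q using W.gPlus_induction with
  | add a b ha hb => rw [map_add, map_add, map_add, ha, hb]; ring
  | cls j a =>
    rw [br_cls, pair_cls, pair_cls, coe_nb]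
    split_ifs
    · have := W.form_invariant (y : 𝔤) (n : 𝔤) a
      rw [← lie_skew (n : 𝔤), ← lie_skew a, map_neg, map_neg, LinearMap.neg_apply, neg_neg, this]
    · simp

section

variable [Module.Finite ℂ 𝔤] (hf : IsMinimalNilpotent W.f)

include hf

theorem nb_nb (a b c : nil W.h) : W.nb (W.nb a b) c = 0 :=
  Subtype.ext (W.eq_zero_of_mem_fil hf (by norm_num)
    (W.lie_mem_fil (W.lie_mem_fil a.2 b.2 rfl) c.2 rfl))

theorem nb_eNil (a : nil W.h) : W.nb W.eNil a = 0 :=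
  Subtype.ext (W.eq_zero_of_mem_fil hf (by norm_num)
    (W.lie_mem_fil (W.gr_le_fil le_rfl W.e_mem) a.2 rfl))

end

/-! ### Models of the differential algebra `𝒱` -/

/-- The properties of the differential algebra `𝒱` that are used below. -/
structure Model (A : Type*) [CommRing A] [Algebra ℂ A] where
  der : Derivation ℂ A A
  gen : W.gPlus →ₗ[ℂ] A
  adLam : nil W.h → Derivation ℂ A A[X]
  adLam_gen : ∀ n a, adLam n (gen a) =
    Polynomial.C (gen (W.act n a)) + Polynomial.X * Polynomial.C (algebraMap ℂ A (W.k * W.pair n a))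
  adLam_der : ∀ n v, adLam n (der v) = shift der (adLam n v)
  gen_cls : ∀ (i : ℚ) (j : ℕ), (W.d + 1) * j + i = W.topDeg → ∀ a ∈ gr W.h i,
    gen (W.cls j a) = algebraMap ℂ A (W.chiPlus (W.cls j a))
  induction : ∀ motive : A → Prop, (∀ a, motive (gen a)) → (∀ c : ℂ, motive (algebraMap ℂ A c)) →
    (∀ u v, motive u → motive v → motive (u + v)) →
    (∀ u v, motive u → motive v → motive (u * v)) → (∀ u, motive u → motive (der u)) →
    ∀ v, motive v

/-- The differential algebra `𝒱` itself. -/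
def model : W.Model W.V where
  der := W.der
  gen := W.gen
  adLam := W.adLam
  adLam_gen := W.adLam_gen
  adLam_der := W.adLam_der
  gen_cls _ _ hij _ ha := W.gen_cls_of_topDeg hij ha
  induction _ h1 h2 h3 h4 h5 v := W.V_induction h1 h2 h3 h4 h5 v

/-! ### Dual bases of `𝔤(1/2)` -/

section Frame

variable {s : ℕ} (z zs : Module.Basis (Fin (2 * s)) ℂ (gr W.h (1 / 2)))

theorem zExt_castSucc (i : Fin (2 * s)) : W.zExt z i.castSucc = z i := by simp [zExt]

theorem zExt_last : W.zExt z (Fin.last _) = W.x := by simp [zExt]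

theorem zsExt_castSucc (i : Fin (2 * s)) : (W.zsExt zs i.castSucc : 𝔤) = zs i := by simp [zsExt]

theorem zsExt_last : W.zsExt zs (Fin.last _) = W.eNil := by simp [zsExt, eNil]

variable (hz : ∀ i j, ⁅(z i : 𝔤), (zs j : 𝔤)⁆ = if i = j then W.e else 0)

-- The numbers `z.repr (zs j) i` form the Gram matrix, on the basis `z_i^*`, of the skew form with
-- which `𝔤(1/2)` brackets into `ℂ e`.
include hz in
theorem lie_zs (j i : Fin (2 * s)) : ⁅(zs j : 𝔤), (zs i : 𝔤)⁆ = z.repr (zs j) i • W.e := by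
  have h : (zs j : 𝔤) = ∑ l, z.repr (zs j) l • (z l : 𝔤) := by
    have := congrArg (gr W.h (1 / 2)).subtype (z.sum_repr (zs j)).symm
    rw [map_sum] at this
    simp only [map_smul] at this
    exact this
  conv_lhs => rw [h]
  simp [sum_lie, smul_lie, hz]

include hz in
theorem repr_zs_skew (i j : Fin (2 * s)) : z.repr (zs j) i = -z.repr (zs i) j := by
  have h := W.lie_zs z zs hz j i
  rw [← lie_skew, W.lie_zs z zs hz i j, ← neg_smul] at h
  exact (smul_left_injective ℂ W.sl2.e_ne_zero h).symm

section

variable [Module.Finite ℂ 𝔤] (hf : IsMinimalNilpotent W.f)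

include hf in
theorem nil_induction {motive : nil W.h → Prop} (zsExt : ∀ i, motive (W.zsExt zs i))
    (add : ∀ a b, motive a → motive b → motive (a + b))
    (smul : ∀ (c : ℂ) a, motive a → motive (c • a)) (n : nil W.h) : motive n := by
  obtain ⟨n, hn⟩ := n
  obtain ⟨y, hy, c, rfl⟩ := W.exists_eq_add_of_mem_nil hf hn
  have h1 : ∀ w : gr W.h (1 / 2), motive ⟨w, W.gr_half_le_nil w.2⟩ := by
    intro w
    have hw : w ∈ Submodule.span ℂ (Set.range zs) := by rw [zs.span_eq]; trivial
    induction hw using Submodule.span_induction with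
    | zero =>
      have := smul 0 _ (zsExt (Fin.last _))
      rw [zero_smul] at this
      exact this
    | add a b _ _ ha hb => exact add _ _ ha hb
    | smul c a _ ha => exact smul c _ ha
    | mem w hw =>
      obtain ⟨i, rfl⟩ := hw
      have h : W.zsExt zs i.castSucc = ⟨zs i, W.gr_half_le_nil (zs i).2⟩ :=
        Subtype.ext (W.zsExt_castSucc zs i)
      exact h ▸ zsExt i.castSucc
  have h2 := zsExt (Fin.last _)
  rw [zsExt_last] at h2
  exact add _ _ (h1 ⟨y, hy⟩) (smul c _ h2)

end

namespace Model

variable {W} {A : Type*} [CommRing A] [Algebra ℂ A] (M : W.Model A)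

/-- The class of `a z^j`. -/
def el (j : ℕ) (a : 𝔤) : A := M.gen (W.cls j a)

theorem gen_cls_e : M.gen (W.cls W.m W.e) = -1 := by
  rw [M.gen_cls 1 W.m rfl W.e W.e_mem, W.chiPlus_cls_e, map_neg, map_one]

/-- The elements `z_i z^m` of `𝒱`. -/
def r (i : Fin (2 * s + 1)) : A := M.el W.m (W.zExt z i)

theorem el_zs (j : Fin (2 * s)) :
    M.el W.m (zs j) = ∑ i, z.repr (zs j) i • M.r z i.castSucc := by
  have h : (zs j : 𝔤) = ∑ l, z.repr (zs j) l • (z l : 𝔤) := by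
    have := congrArg (gr W.h (1 / 2)).subtype (z.sum_repr (zs j)).symm
    rw [map_sum] at this
    simp only [map_smul] at this
    exact this
  simp only [r, zExt_castSucc, el]
  conv_lhs => rw [h]
  simp only [map_sum, map_smul]

-- Up to a scalar this is the skew form of `𝔤(1/2)` evaluated twice on the same vector `∑ r_i
-- z_i^*`.
include hz in
theorem sum_r_mul_el_zs : ∑ i : Fin (2 * s), M.r z i.castSucc * M.el W.m (zs i) = 0 := by
  have h : ∑ i : Fin (2 * s), M.r z i.castSucc * M.el W.m (zs i) =
      -∑ i : Fin (2 * s), M.r z i.castSucc * M.el W.m (zs i) := by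
    simp only [M.el_zs z zs, Finset.mul_sum]
    conv_lhs => rw [Finset.sum_comm]
    rw [← Finset.sum_neg_distrib]
    refine Finset.sum_congr rfl fun i _ => ?_
    rw [← Finset.sum_neg_distrib]
    refine Finset.sum_congr rfl fun j _ => ?_
    rw [W.repr_zs_skew z zs hz i j, Algebra.smul_def, Algebra.smul_def, map_neg]
    ring
  have h2 : (2 : ℂ) • ∑ i : Fin (2 * s), M.r z i.castSucc * M.el W.m (zs i) = 0 := by
    rw [two_smul]
    nth_rewrite 1 [h]
    exact neg_add_cancel _
  exact by
    have h3 := congrArg ((1 / 2 : ℂ) • ·) h2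
    simpa [smul_smul] using h3

/-- The element `(ad_λ n)(z_i z^m)` of `𝒱`. -/
def delta (n : nil W.h) (i : Fin (2 * s + 1)) : A := M.gen (W.act n (W.cls W.m (W.zExt z i)))

theorem delta_eq (n : nil W.h) (i : Fin (2 * s + 1)) :
    M.delta z n i = M.el W.m ⁅(n : 𝔤), W.zExt z i⁆ := by
  rw [delta, act_cls]; rfl

theorem delta_last (n : nil W.h) : M.delta z n (Fin.last _) = M.el W.m ⁅(n : 𝔤), W.x⁆ := by
  rw [M.delta_eq, zExt_last]

theorem delta_eNil_last : M.delta z W.eNil (Fin.last _) = 1 := by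
  rw [delta_last, eNil, W.lie_e_x, el, map_neg, map_neg, M.gen_cls_e, neg_neg]

include hz in
theorem delta_zs (j i : Fin (2 * s)) :
    M.delta z (W.zsExt zs j.castSucc) i.castSucc = if i = j then 1 else 0 := by
  rw [M.delta_eq, zExt_castSucc, zsExt_castSucc, ← lie_skew, hz, el]
  split_ifs
  · rw [map_neg, map_neg, M.gen_cls_e, neg_neg]
  · simp

theorem delta_zs_last (j : Fin (2 * s)) :
    M.delta z (W.zsExt zs j.castSucc) (Fin.last _) = -((1 / 2 : ℂ) • M.el W.m (zs j)) := by
  rw [delta_last, zsExt_castSucc, ← lie_skew, W.lie_x (zs j).2, el, map_neg, map_neg, map_smul,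
    map_smul]
  norm_num [el]

variable [Module.Finite ℂ 𝔤] (hf : IsMinimalNilpotent W.f)

include hf in
theorem delta_eNil (i : Fin (2 * s)) : M.delta z W.eNil i.castSucc = 0 := by
  rw [M.delta_eq, zExt_castSucc, eNil, W.eq_zero_of_mem_gr hf (i := 3 / 2) (by norm_num)
    (lie_mem_gr' W.e_mem (z i).2 (by norm_num)), el, map_zero, map_zero]

include hz hf in
/-- The gauge action of `𝔫` on the coordinates `z_i z^m`: with `R = ∑ r_i ⊗ z_i^*`, one has
`(ad_λ n) R = n - [n, R] / 2`. -/
theorem sum_delta_smul {N : Type*} [AddCommGroup N] [Module A N] [Module ℂ N]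
    [IsScalarTower ℂ A N] (Φ : nil W.h →ₗ[ℂ] N) (n : nil W.h) :
    ∑ i, M.delta z n i • Φ (W.zsExt zs i) =
      Φ n - (1 / 2 : ℂ) • ∑ i, M.r z i • Φ (W.nb n (W.zsExt zs i)) := by
  have hadd : ∀ a b i, M.delta z (a + b) i = M.delta z a i + M.delta z b i := fun a b i => by
    rw [M.delta_eq, delta_eq, delta_eq, Submodule.coe_add, add_lie, el, map_add, map_add]; rfl
  have hsmul : ∀ (c : ℂ) a i, M.delta z (c • a) i = c • M.delta z a i := fun c a i => by
    rw [M.delta_eq, delta_eq, Submodule.coe_smul, smul_lie, el, map_smul, map_smul]; rfl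
  induction n using W.nil_induction zs hf with
  | add a b ha hb =>
    simp only [hadd, add_smul, map_add, LinearMap.add_apply, smul_add, Finset.sum_add_distrib,
      ha, hb]
    abel
  | smul c a ha =>
    simp only [hsmul, smul_assoc, map_smul, LinearMap.smul_apply, smul_comm _ c,
      ← Finset.smul_sum, ha, smul_sub]
  | zsExt j =>
    induction j using Fin.lastCases with
    | last =>
      rw [zsExt_last, Fin.sum_univ_castSucc]
      simp only [M.delta_eNil z hf, delta_eNil_last, W.nb_eNil hf, zsExt_last, map_zero, smul_zero,
        zero_smul, Finset.sum_const_zero, one_smul, zero_add, sub_zero]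
    | cast j =>
      -- Because `[x, z_j^*] = z_j^* / 2`, the coordinate `x z^m` moves by `-(z_j^* z^m) / 2`.
      -- Expanded in the `r_i`, this is the `e`-component of `-[z_j^*, R] / 2`.
      rw [Fin.sum_univ_castSucc, Fin.sum_univ_castSucc]
      have h1 : ∀ i : Fin (2 * s), W.nb (W.zsExt zs j.castSucc) (W.zsExt zs i.castSucc) =
          z.repr (zs j) i • W.eNil := fun i => Subtype.ext (by
        rw [coe_nb, zsExt_castSucc, zsExt_castSucc, W.lie_zs z zs hz]; rfl)
      have h2 : W.nb (W.zsExt zs j.castSucc) W.eNil = 0 := by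
        rw [nb_skew, W.nb_eNil hf, neg_zero]
      simp only [M.delta_zs z zs hz, delta_zs_last, h1, h2, zsExt_last, map_zero, smul_zero,
        map_smul, add_zero, ite_smul, one_smul, zero_smul, Finset.sum_ite_eq', Finset.mem_univ,
        if_true]
      rw [M.el_zs z zs, neg_smul, smul_assoc, Finset.sum_smul, ← sub_eq_add_neg]
      simp only [smul_assoc, smul_comm (M.r z _) (_ : ℂ)]

end Model

end Frame

end Datum

/-- The combinatorial identity behind the invariance of `η̃`: if `[S, T] = Z` commutes with `T`,
`d₀ = κ - S G` and `d_{l+1} = T d_l + (S - Z / 2) T^l G`, then `∑ d_l / l!` telescopes. -/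
theorem telescope {L : Type*} [AddCommGroup L] [Module ℂ L] (S T Z : L →ₗ[ℂ] L)
    (hTS : ∀ F, T (S F) = S (T F) - Z F) (hTZ : ∀ F, T (Z F) = Z (T F)) (G κ : L)
    (hκ : T (T κ) = 0) (d : ℕ → L) (d_zero : d 0 = κ - S G)
    (d_succ : ∀ l, d (l + 1) = T (d l) + (S ((T ^ l) G) - (1 / 2 : ℂ) • Z ((T ^ l) G))) :
    ∑ l ∈ Finset.range 5, ((l.factorial : ℂ)⁻¹) • d l =
      κ + T κ - (1 / 24 : ℂ) • S ((T ^ 4) G) + (1 / 12 : ℂ) • Z ((T ^ 3) G) := by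
  -- The commutation rules move `S` and `Z` to the left of all powers of `T`. The terms with
  -- coefficients `1/24` and `1/12` are due only to the truncation at `l = 4`, and vanish in the
  -- application.
  simp only [Finset.sum_range_succ, Finset.sum_range_zero, d_succ, d_zero, pow_succ', pow_zero,
    Module.End.mul_apply, Module.End.one_apply, map_add, map_sub, map_smul, hTS, hTZ, hκ, map_zero]
  norm_num [Nat.factorial]
  module

namespace Datum

variable {𝔤 : Type*} [LieRing 𝔤] [LieAlgebra ℂ 𝔤] {W : Datum 𝔤}

namespace Model

variable {A : Type*} [CommRing A] [Algebra ℂ A] (M : W.Model A)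

/-! ### Operators on linear maps from `ĝ⁺` -/

section Operators

variable {N : Type*} [AddCommGroup N] [Module ℂ N] [Module A N] [IsScalarTower ℂ A N]

variable (W) in
/-- The map `y ↦ F ∘ {·, y}`. -/
def opSL (F : W.gPlus →ₗ[ℂ] N) : nil W.h →ₗ[ℂ] W.gPlus →ₗ[ℂ] N where
  toFun y := F ∘ₗ W.brL y
  map_add' a b := by rw [map_add, LinearMap.comp_add]
  map_smul' c a := by rw [map_smul, LinearMap.comp_smul]; rfl

variable (A W) in
/-- The operator `F ↦ F ∘ {·, y}`. -/
def opS (y : nil W.h) : (W.gPlus →ₗ[ℂ] N) →ₗ[A] (W.gPlus →ₗ[ℂ] N) where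
  toFun F := opSL W F y
  map_add' _ _ := rfl
  map_smul' _ _ := rfl

theorem opS_apply (y : nil W.h) (F : W.gPlus →ₗ[ℂ] N) (q : W.gPlus) :
    opS W A y F q = F (W.br y q) := rfl

variable {s : ℕ} (z zs : Module.Basis (Fin (2 * s)) ℂ (gr W.h (1 / 2)))

/-- The operator `F ↦ ∑ r_i F ∘ {·, z_i^*}`. -/
def opT : (W.gPlus →ₗ[ℂ] N) →ₗ[A] (W.gPlus →ₗ[ℂ] N) :=
  ∑ i, M.r z i • opS W A (W.zsExt zs i)

theorem opT_apply (F : W.gPlus →ₗ[ℂ] N) :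
    M.opT z zs F = ∑ i, M.r z i • opSL W F (W.zsExt zs i) := by
  rw [opT, LinearMap.sum_apply]; rfl

theorem opT_apply_apply (F : W.gPlus →ₗ[ℂ] N) (q : W.gPlus) :
    M.opT z zs F q = ∑ i, M.r z i • F (W.br (W.zsExt zs i) q) := by
  rw [opT_apply, LinearMap.sum_apply]; rfl

/-- The operator `[S_n, T]`. -/
def opZ (n : nil W.h) : (W.gPlus →ₗ[ℂ] N) →ₗ[A] (W.gPlus →ₗ[ℂ] N) :=
  ∑ i, M.r z i • opS W A (W.nb n (W.zsExt zs i))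

theorem opZ_apply_apply (n : nil W.h) (F : W.gPlus →ₗ[ℂ] N) (q : W.gPlus) :
    M.opZ z zs n F q = ∑ i, M.r z i • F (W.br (W.nb n (W.zsExt zs i)) q) := by
  rw [opZ, LinearMap.sum_apply, LinearMap.sum_apply]; rfl

theorem opT_opS (n : nil W.h) (F : W.gPlus →ₗ[ℂ] N) :
    M.opT z zs (opS W A n F) = opS W A n (M.opT z zs F) - M.opZ z zs n F := by
  refine LinearMap.ext fun q => ?_
  simp only [LinearMap.sub_apply, opT_apply_apply, opS_apply, opZ_apply_apply]
  rw [← Finset.sum_sub_distrib]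
  refine Finset.sum_congr rfl fun i _ => ?_
  rw [← smul_sub, ← map_sub, ← W.br_br_sub, sub_sub_cancel]

variable [Module.Finite ℂ 𝔤] (hf : IsMinimalNilpotent W.f)

include hf

/-- The elements `[n, z_i^*]` are central in `𝔫`, so bracketing with them commutes with bracketing
by `𝔫`. -/
theorem opT_opZ (n : nil W.h) (F : W.gPlus →ₗ[ℂ] N) :
    M.opT z zs (M.opZ z zs n F) = M.opZ z zs n (M.opT z zs F) := by
  refine LinearMap.ext fun q => ?_
  simp only [opT_apply_apply, opZ_apply_apply, Finset.smul_sum]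
  rw [Finset.sum_comm]
  refine Finset.sum_congr rfl fun i _ => Finset.sum_congr rfl fun j _ => ?_
  have h := W.br_br_sub (W.nb n (W.zsExt zs i)) (W.zsExt zs j) q
  have h0 : W.br (0 : nil W.h) q = 0 := by rw [← brL_apply, map_zero, LinearMap.zero_apply]
  rw [W.nb_nb hf, h0, sub_eq_zero] at h
  rw [h, smul_comm]

theorem opT_four (y : nil W.h) (F : W.gPlus →ₗ[ℂ] N) (q : W.gPlus) :
    (M.opT z zs ^ 4) F (W.br y q) = 0 := by
  simp only [pow_succ', pow_zero, Module.End.mul_apply, opT_apply_apply,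
    W.br_five hf, mul_one, map_zero, smul_zero, Finset.sum_const_zero]

theorem opS_opT_four (y : nil W.h) (F : W.gPlus →ₗ[ℂ] N) :
    opS W A y ((M.opT z zs ^ 4) F) = 0 :=
  LinearMap.ext fun q => M.opT_four z zs hf y F q

theorem opT_five (F : W.gPlus →ₗ[ℂ] N) : (M.opT z zs ^ 5) F = 0 := by
  refine LinearMap.ext fun q => ?_
  rw [pow_succ', Module.End.mul_apply, opT_apply_apply]
  simp only [M.opT_four z zs hf, smul_zero, Finset.sum_const_zero, LinearMap.zero_apply]

/-- As `Z = S T - T S`, the operator `Z T³` is `S T⁴ - T S T³`, and both terms precompose with five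
brackets. -/
theorem opZ_opT_three (n : nil W.h) (F : W.gPlus →ₗ[ℂ] N) :
    M.opZ z zs n ((M.opT z zs ^ 3) F) = 0 := by
  have h := M.opT_opS z zs n ((M.opT z zs ^ 3) F)
  have h4 : M.opT z zs ((M.opT z zs ^ 3) F) = (M.opT z zs ^ 4) F := by rw [pow_succ' _ 3]; rfl
  rw [h4, M.opS_opT_four z zs hf, zero_sub] at h
  rw [← neg_eq_zero, ← h]
  refine LinearMap.ext fun q => ?_
  simp only [opT_apply_apply, opS_apply]
  simp only [pow_succ', pow_zero, Module.End.mul_apply, opT_apply_apply,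
    W.br_five hf, mul_one, map_zero, smul_zero, Finset.sum_const_zero, LinearMap.zero_apply]

end Operators

/-! ### The map `η̃` -/

section Eta

variable {s : ℕ} (z zs : Module.Basis (Fin (2 * s)) ℂ (gr W.h (1 / 2)))

/-- The map `η̃`. -/
def etaTilde : W.gPlus →ₗ[ℂ] A :=
  ∑ l ∈ Finset.range 5, ∑ i : Fin l → Fin (2 * s + 1),
    ((l.factorial : ℂ)⁻¹) •
      (LinearMap.mulLeft ℂ (∏ t, M.el W.m (W.zExt z (i t))) ∘ₗ M.gen ∘ₗ
        W.iterBr (List.ofFn fun t => W.zsExt zs (i t)))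

/-- The coefficients `r_i` commute while the brackets keep their order, so peeling off the first
index turns the `l`-fold sum into a power of `T`. Thus `η̃` is `exp T` applied to the generators. -/
theorem sum_iterBr (F : W.gPlus →ₗ[ℂ] A) (l : ℕ) (q : W.gPlus) :
    ∑ i : Fin l → Fin (2 * s + 1), (∏ t, M.r z (i t)) *
      F (W.iterBr (List.ofFn fun t => W.zsExt zs (i t)) q) = (M.opT z zs ^ l) F q := by
  induction l generalizing q with
  | zero => simp [iterBr]
  | succ l ih =>
    rw [pow_succ', Module.End.mul_apply, opT_apply_apply,
      ← (Fin.consEquiv fun _ => Fin (2 * s + 1)).sum_comp, Fintype.sum_prod_type]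
    refine Finset.sum_congr rfl fun i _ => ?_
    rw [← ih, smul_eq_mul, Finset.mul_sum]
    refine Finset.sum_congr rfl fun j _ => ?_
    simp only [Fin.consEquiv_apply, Fin.prod_univ_succ, Fin.cons_zero, Fin.cons_succ,
      List.ofFn_succ, iterBr, LinearMap.comp_apply, mul_assoc]

theorem etaTilde_eq : M.etaTilde z zs =
    ∑ l ∈ Finset.range 5, ((l.factorial : ℂ)⁻¹) • (M.opT z zs ^ l) M.gen := by
  refine LinearMap.ext fun q => ?_
  rw [etaTilde, LinearMap.sum_apply, LinearMap.sum_apply]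
  refine Finset.sum_congr rfl fun l _ => ?_
  rw [LinearMap.smul_apply, ← M.sum_iterBr z zs M.gen l q, LinearMap.sum_apply, Finset.smul_sum]
  rfl

/-- The linear map `a ↦ λ k (n, a)`. -/
def kappa (n : nil W.h) : W.gPlus →ₗ[ℂ] A[X] :=
  LinearMap.mulLeft ℂ (Polynomial.X : A[X]) ∘ₗ Algebra.linearMap ℂ A[X] ∘ₗ (W.k • W.pair n)

theorem kappa_apply (n : nil W.h) (q : W.gPlus) : kappa (A := A) n q =
    Polynomial.X * Polynomial.C (algebraMap ℂ A (W.k * W.pair n q)) := by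
  simp [kappa, Polynomial.algebraMap_apply]

/-- The cocycle only sees `z^0`, so for `m > 0` the variation of `z_i z^m` has no `λ`-term. -/
theorem adLam_r (hm : 0 < W.m) (n : nil W.h) (i : Fin (2 * s + 1)) :
    M.adLam n (M.r z i) = Polynomial.C (M.delta z n i) := by
  rw [r, el, M.adLam_gen, pair_cls, if_neg hm.ne', mul_zero, map_zero, map_zero, mul_zero,
    add_zero]
  rfl

variable (hz : ∀ i j, ⁅(z i : 𝔤), (zs j : 𝔤)⁆ = if i = j then W.e else 0)
variable [Module.Finite ℂ 𝔤] (hf : IsMinimalNilpotent W.f)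

-- By Leibniz, the only new term is the one where the coefficients `r_i` vary, and `sum_delta_smul`
-- evaluates it. This is the recursion fed to `telescope`.
include hz hf in
theorem adLam_opT (hm : 0 < W.m) (n : nil W.h) (F : W.gPlus →ₗ[ℂ] A) :
    (M.adLam n).toLinearMap ∘ₗ M.opT z zs F =
      M.opT z zs ((M.adLam n).toLinearMap ∘ₗ F) +
        (opS W A n (Polynomial.CAlgHom.toLinearMap ∘ₗ F) -
          (1 / 2 : ℂ) • M.opZ z zs n (Polynomial.CAlgHom.toLinearMap ∘ₗ F)) := by
  have h := M.sum_delta_smul z zs hz hf (opSL W (Polynomial.CAlgHom.toLinearMap ∘ₗ F)) n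
  refine LinearMap.ext fun q => ?_
  have hq := LinearMap.congr_fun h q
  rw [LinearMap.add_apply, LinearMap.sub_apply, LinearMap.smul_apply, opT_apply_apply,
    opZ_apply_apply, LinearMap.comp_apply, opT_apply_apply]
  rw [LinearMap.sub_apply, LinearMap.smul_apply, LinearMap.sum_apply, LinearMap.sum_apply] at hq
  refine Eq.trans ?_ (congrArg _ hq)
  rw [map_sum, ← Finset.sum_add_distrib]
  refine Finset.sum_congr rfl fun i _ => ?_
  simp only [Derivation.coeFn_coe, smul_eq_mul, Derivation.leibniz, M.adLam_r z hm,
    LinearMap.comp_apply, LinearMap.smul_apply]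
  congr 1
  rw [Polynomial.smul_C, smul_eq_mul, mul_comm, ← smul_eq_mul (M.delta z n i), ← Polynomial.smul_C]
  rfl

-- For `k = 0` the right side is zero: transforming by the moving frame already gives invariants.
-- What survives is the cocycle, carried through `exp T` and cut off by `T² κ = 0`.
include hz hf in
theorem adLam_etaTilde (hm : 0 < W.m) (n : nil W.h) :
    (M.adLam n).toLinearMap ∘ₗ M.etaTilde z zs = kappa n + M.opT z zs (kappa n) := by
  let C : W.gPlus →ₗ[ℂ] A[X] := Polynomial.CAlgHom.toLinearMap ∘ₗ M.gen
  have hC : ∀ F : W.gPlus →ₗ[ℂ] A, M.opT z zs (Polynomial.CAlgHom.toLinearMap ∘ₗ F) =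
      Polynomial.CAlgHom.toLinearMap ∘ₗ M.opT z zs F := fun F => by
    refine LinearMap.ext fun q => ?_
    rw [opT_apply_apply, LinearMap.comp_apply, opT_apply_apply, map_sum]
    refine Finset.sum_congr rfl fun i _ => ?_
    exact Polynomial.smul_C _ _
  have hCl : ∀ l, (M.opT z zs ^ l) C =
      Polynomial.CAlgHom.toLinearMap ∘ₗ (M.opT z zs ^ l) M.gen := fun l => by
    induction l with
    | zero => rfl
    | succ l ih => rw [pow_succ', pow_succ', Module.End.mul_apply, ih, hC]; rfl
  have hpow : ∀ l, ((M.opT z zs).restrictScalars ℂ ^ l) C = (M.opT z zs ^ l) C := fun l => by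
    induction l with
    | zero => rfl
    | succ l ih =>
      rw [pow_succ', pow_succ', Module.End.mul_apply, Module.End.mul_apply, ih]; rfl
  have h := telescope ((opS W A n).restrictScalars ℂ) ((M.opT z zs).restrictScalars ℂ)
    ((M.opZ z zs n).restrictScalars ℂ) (fun F => M.opT_opS z zs n F)
    (fun F => M.opT_opZ z zs hf n F) C (kappa n) (by
      refine LinearMap.ext fun q => ?_
      simp only [LinearMap.restrictScalars_apply, opT_apply_apply, kappa_apply, W.pair_br_br hf,
        mul_zero, map_zero, smul_zero, Finset.sum_const_zero, LinearMap.zero_apply])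
    (fun l => (M.adLam n).toLinearMap ∘ₗ (M.opT z zs ^ l) M.gen) (by
      refine LinearMap.ext fun q => ?_
      rw [pow_zero, LinearMap.sub_apply, kappa_apply]
      refine (M.adLam_gen n q).trans ?_
      have h : (opS W A n).restrictScalars ℂ C q = -Polynomial.C (M.gen (W.act n q)) := by
        rw [LinearMap.restrictScalars_apply, opS_apply]
        simp [C, br]
      rw [h, sub_neg_eq_add, add_comm])
    (fun l => by
      rw [pow_succ', Module.End.mul_apply, M.adLam_opT z zs hz hf hm, hpow, hCl]; rfl)
  rw [hpow, hpow] at h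
  simp only [LinearMap.restrictScalars_apply, M.opS_opT_four z zs hf, M.opZ_opT_three z zs hf,
    smul_zero, sub_zero, add_zero] at h
  rw [← h, etaTilde_eq]
  refine LinearMap.ext fun q => ?_
  simp only [LinearMap.comp_apply, LinearMap.sum_apply, LinearMap.smul_apply, map_sum, map_smul]

end Eta

end Model

end Datum

/-- If an algebra is generated by constants of a derivation `E` and by elements with `E r = r`, then
all constants of `E` lie in the subalgebra of the given constants. -/
theorem mem_of_euler {A : Type*} [CommRing A] [Algebra ℂ A] (E : Derivation ℂ A A)
    (U : Subalgebra ℂ A) (hU : ∀ u ∈ U, E u = 0) (R : Set A) (hR : ∀ r ∈ R, E r = r)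
    (htop : Algebra.adjoin ℂ (U ∪ R : Set A) = ⊤) {a : A} (ha : E a = 0) : a ∈ U := by
  let T : Module.End ℂ A := E.toLinearMap
  -- `P` is the sum of the eigenspaces with eigenvalues `1, 2, …`. The sum `U + P` is closed under
  -- products and contains the generators, hence is everything, and a constant of `E` has no
  -- component in `P`.
  let P : Submodule ℂ A := ⨆ k : ℕ, T.eigenspace ((k : ℂ) + 1)
  have hmem : ∀ {c v}, v ∈ T.eigenspace c ↔ E v = c • v := Module.End.mem_eigenspace_iff
  have hUP : Subalgebra.toSubmodule U * P ≤ P := by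
    simp only [P, Submodule.mul_iSup]
    refine iSup_mono fun k => Submodule.mul_le.2 fun u hu v hv => ?_
    rw [hmem] at hv ⊢
    rw [Derivation.leibniz, hU u hu, hv, smul_zero, add_zero, smul_eq_mul, mul_smul_comm]
  have hPP : P * P ≤ P := by
    simp only [P, Submodule.mul_iSup, Submodule.iSup_mul]
    refine iSup_le fun k => iSup_le fun l => (Submodule.mul_le.2 fun u hu v hv => ?_ :
      _ ≤ T.eigenspace (((k + l + 1 : ℕ) : ℂ) + 1)).trans
      (le_iSup (fun k : ℕ => T.eigenspace ((k : ℂ) + 1)) _)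
    rw [hmem] at hu hv ⊢
    rw [Derivation.leibniz, hu, hv, smul_eq_mul, smul_eq_mul, mul_smul_comm, mul_smul_comm,
      mul_comm v u, ← add_smul]
    congr 1
    push_cast
    ring
  have hall : ∀ v, v ∈ Subalgebra.toSubmodule U ⊔ P := by
    intro v
    have hv : v ∈ Algebra.adjoin ℂ (U ∪ R : Set A) := by rw [htop]; trivial
    induction hv using Algebra.adjoin_induction with
    | algebraMap r => exact Submodule.mem_sup_left (U.algebraMap_mem r)
    | add u v _ _ hu hv => exact add_mem hu hv
    | mem v hv =>
      rcases hv with hv | hv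
      · exact Submodule.mem_sup_left hv
      · refine Submodule.mem_sup_right (Submodule.mem_iSup_of_mem 0 (hmem.2 ?_))
        rw [hR v hv]
        simp
    | mul u v _ _ hu' hv' =>
      obtain ⟨u, hu, p, hp, rfl⟩ := Submodule.mem_sup.1 hu'
      obtain ⟨v, hv, q, hq, rfl⟩ := Submodule.mem_sup.1 hv'
      have h1 : (u + p) * (v + q) = u * v + (u * q + v * p + p * q) := by ring
      rw [h1]
      exact Submodule.add_mem_sup (U.mul_mem hu hv)
        (add_mem (add_mem (hUP (Submodule.mul_mem_mul hu hq)) (hUP (Submodule.mul_mem_mul hv hp)))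
          (hPP (Submodule.mul_mem_mul hp hq)))
  obtain ⟨u, hu, p, hp, rfl⟩ := Submodule.mem_sup.1 (hall a)
  have hp0 : p ∈ T.eigenspace 0 := by
    rw [map_add, hU u hu, zero_add] at ha
    rw [hmem, ha, zero_smul]
  have hdis := T.eigenspaces_iSupIndep 0
  have hP : P ≤ ⨆ (c : ℂ) (_ : c ≠ 0), T.eigenspace c :=
    iSup_le fun k => le_iSup₂_of_le ((k : ℂ) + 1) (Nat.cast_add_one_ne_zero k) le_rfl
  rw [Submodule.disjoint_def.1 hdis p hp0 (hP hp), add_zero]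
  exact hu

/-! ### Replacing powers of `λ` by derivatives of a fixed element -/

section EvalDer

variable {A : Type*} [CommRing A] [Algebra ℂ A] (D : Derivation ℂ A A)

/-- The `A`-linear map `A[λ] → A` that sends `λ^n` to `D^n a`. -/
def evalDer (a : A) : A[X] →ₗ[A] A :=
  Polynomial.lsum fun n => LinearMap.toSpanSingleton A A (D^[n] a)

theorem evalDer_monomial (a : A) (n : ℕ) (v : A) :
    evalDer D a (Polynomial.monomial n v) = v * D^[n] a := by
  simp [evalDer, Polynomial.lsum]

theorem evalDer_C (a v : A) : evalDer D a (Polynomial.C v) = v * a :=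
  evalDer_monomial D a 0 v

/-- Under the substitution `λ^n ↦ ∂^n a`, the operator `∂ + λ` becomes the Leibniz rule. Hence
`euler` commutes with `∂`. -/
theorem evalDer_shift (a : A) (p : A[X]) : evalDer D a (shift D p) = D (evalDer D a p) := by
  induction p using Polynomial.induction_on' with
  | add p q hp hq => rw [map_add, map_add, map_add, map_add, hp, hq]
  | monomial n v =>
    have h : shift D (Polynomial.monomial n v) =
        Polynomial.monomial n (D v) + Polynomial.monomial (n + 1) v := by
      simp [shift, Polynomial.lsum]
    rw [h, map_add, evalDer_monomial, evalDer_monomial, evalDer_monomial, Derivation.leibniz,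
      Function.iterate_succ_apply', smul_eq_mul, smul_eq_mul]
    ring

end EvalDer

namespace Datum

variable {𝔤 : Type*} [LieRing 𝔤] [LieAlgebra ℂ 𝔤] {W : Datum 𝔤}

namespace Model

variable {A : Type*} [CommRing A] [Algebra ℂ A] (M : W.Model A)
variable {s : ℕ} (z zs : Module.Basis (Fin (2 * s)) ℂ (gr W.h (1 / 2)))

/-! ### The invariant map `η` on `ĝ⁺` -/

/-- The correction term `η̃ - η`. -/
def corr : W.gPlus →ₗ[ℂ] A :=
  ∑ i, (W.k • W.pair (W.zsExt zs i)).smulRight (M.der (M.r z i)) +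
    ∑ i, ∑ j, ((W.k / 2) • W.pair (W.nb (W.zsExt zs i) (W.zsExt zs j))).smulRight
      (M.r z i * M.der (M.r z j))

/-- The linear map `y ↦ k (y, q)`. -/
def kPair (q : W.gPlus) : nil W.h →ₗ[ℂ] A :=
  Algebra.linearMap ℂ A ∘ₗ (W.k • W.pairL.flip q)

theorem kPair_apply (q : W.gPlus) (y : nil W.h) :
    kPair (A := A) q y = algebraMap ℂ A (W.k * W.pair y q) := rfl

theorem corr_apply (q : W.gPlus) : M.corr z zs q =
    ∑ i, kPair q (W.zsExt zs i) * M.der (M.r z i) +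
      (1 / 2 : ℂ) • ∑ i, ∑ j, kPair q (W.nb (W.zsExt zs i) (W.zsExt zs j)) *
        (M.r z i * M.der (M.r z j)) := by
  simp only [corr, LinearMap.add_apply, LinearMap.sum_apply, LinearMap.smulRight_apply,
    LinearMap.smul_apply, kPair_apply, ← Algebra.smul_def, Finset.smul_sum, smul_smul, smul_eq_mul]
  congr 1
  refine Finset.sum_congr rfl fun i _ => Finset.sum_congr rfl fun j _ => ?_
  congr 1
  ring

/-- The map `η`, extended to `ĝ⁺`. -/
def eta : W.gPlus →ₗ[ℂ] A := M.etaTilde z zs - M.corr z zs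

section

variable (hz : ∀ i j, ⁅(z i : 𝔤), (zs j : 𝔤)⁆ = if i = j then W.e else 0)
variable [Module.Finite ℂ 𝔤] (hf : IsMinimalNilpotent W.f)

include hz hf

/-- The term `corr` is `k (∂R + [R, ∂R]/2, q)`. Varying `R` by `n - [n, R]/2`, the `λ`-terms give `κ
+ T κ` and the others cancel. -/
theorem adLam_corr (hm : 0 < W.m) (n : nil W.h) (q : W.gPlus) :
    M.adLam n (M.corr z zs q) = kappa n q + M.opT z zs (kappa n) q := by
  set P : nil W.h →ₗ[ℂ] A := kPair q with hP
  set Z := W.zsExt zs with hZ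
  set δ := M.delta z n with hδ
  have hPD : ∀ y, M.der (P y) = 0 := fun y => Derivation.map_algebraMap _ _
  have hPA : ∀ y v, M.adLam n (P y * v) = Polynomial.C (P y) * M.adLam n v := fun y v => by
    rw [Derivation.leibniz]
    have : M.adLam n (P y) = 0 := Derivation.map_algebraMap _ _
    rw [this, smul_zero, add_zero, Polynomial.smul_eq_C_mul]
  have hr : ∀ i, M.adLam n (M.r z i) = Polynomial.C (δ i) := M.adLam_r z hm n
  have hdr : ∀ i, M.adLam n (M.der (M.r z i)) =
      Polynomial.C (M.der (δ i)) + Polynomial.X * Polynomial.C (δ i) := fun i => by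
    rw [M.adLam_der, hr, shift_C]
  -- These identities are the gauge formula contracted with `(·, q)` and with `([·, z_j^*], q)`,
  -- together with `∂` of them. In the second contraction the correction `-[n, R]/2` drops out,
  -- since triple brackets in `𝔫` vanish.
  have f1 : ∑ i, δ i * P (Z i) = P n - (1 / 2 : ℂ) • ∑ i, M.r z i * P (W.nb n (Z i)) :=
    M.sum_delta_smul z zs hz hf P n
  have hPD' : ∀ v y, M.der (v * P y) = M.der v * P y := fun v y => by
    rw [Derivation.leibniz, hPD, smul_zero, zero_add, smul_eq_mul, mul_comm]
  have f1' : ∑ i, M.der (δ i) * P (Z i) =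
      -((1 / 2 : ℂ) • ∑ i, M.der (M.r z i) * P (W.nb n (Z i))) := by
    have := congrArg M.der f1
    simpa only [map_sum, map_sub, Derivation.map_smul, hPD, hPD', zero_sub] using this
  have f2 : ∀ j, ∑ i, δ i * P (W.nb (Z i) (Z j)) = P (W.nb n (Z j)) := fun j => by
    have := M.sum_delta_smul z zs hz hf (P ∘ₗ W.nb.flip (Z j)) n
    simpa only [LinearMap.comp_apply, LinearMap.flip_apply, W.nb_nb hf, map_zero, smul_zero, mul_zero,
      Finset.sum_const_zero, sub_zero, smul_eq_mul] using this
  have f3 : ∀ i, ∑ j, δ j * P (W.nb (Z i) (Z j)) = -P (W.nb n (Z i)) := fun i => by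
    rw [← f2, ← Finset.sum_neg_distrib]
    refine Finset.sum_congr rfl fun j _ => ?_
    rw [W.nb_skew, map_neg, mul_neg]
  have f3' : ∀ i, ∑ j, M.der (δ j) * P (W.nb (Z i) (Z j)) = 0 := fun i => by
    have := congrArg M.der (f3 i)
    simpa only [map_sum, map_neg, hPD, hPD', neg_zero] using this
  have key : M.adLam n (M.corr z zs q) =
      Polynomial.C (∑ i, M.der (δ i) * P (Z i)) + Polynomial.X * Polynomial.C (∑ i, δ i * P (Z i)) +
      (1 / 2 : ℂ) • (∑ i, (Polynomial.C (M.r z i * ∑ j, M.der (δ j) * P (W.nb (Z i) (Z j))) +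
        Polynomial.X * Polynomial.C (M.r z i * ∑ j, δ j * P (W.nb (Z i) (Z j)))) +
        ∑ j, Polynomial.C (M.der (M.r z j) * ∑ i, δ i * P (W.nb (Z i) (Z j)))) := by
    rw [corr_apply, map_add, Derivation.map_smul, map_sum, map_sum]
    congr 1
    · simp only [← hP, hPA, hdr, map_sum, map_mul, Finset.mul_sum]
      rw [← Finset.sum_add_distrib]
      exact Finset.sum_congr rfl fun i _ => by ring
    · congr 1
      simp only [← hP, hPA, Derivation.leibniz, hdr, hr, Polynomial.smul_eq_C_mul, map_sum, map_mul,
        Finset.mul_sum]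
      conv_rhs => rw [add_comm, Finset.sum_comm, ← Finset.sum_add_distrib]
      refine Finset.sum_congr rfl fun i _ => ?_
      rw [← Finset.sum_add_distrib, ← Finset.sum_add_distrib]
      exact Finset.sum_congr rfl fun j _ => by ring
  have hκ : kappa (A := A) n q = Polynomial.X * Polynomial.C (P n) := kappa_apply n q
  have hκ' : ∀ i, kappa (A := A) n (W.br (Z i) q) =
      -(Polynomial.X * Polynomial.C (P (W.nb n (Z i)))) := fun i => by
    rw [kappa_apply, W.pair_br, mul_neg, map_neg, map_neg, mul_neg]; rfl
  have hs : ∀ (c : ℂ) (v : A), Polynomial.C (c • v) = c • Polynomial.C v := fun c v =>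
    (Polynomial.smul_C c v).symm
  rw [key, f1, f1', opT_apply_apply, hκ, ← hZ]
  simp only [f2, f3, f3', hκ', hs, mul_zero, map_zero, zero_add, mul_neg, smul_neg, map_neg,
    map_sub, map_sum, map_mul, Polynomial.smul_eq_C_mul, Finset.sum_neg_distrib,
    Finset.mul_sum, mul_sub, smul_add, mul_smul_comm, mul_left_comm (Polynomial.X : A[X])]
  module

theorem adLam_eta (hm : 0 < W.m) (n : nil W.h) (q : W.gPlus) : M.adLam n (M.eta z zs q) = 0 := by
  have h := LinearMap.congr_fun (M.adLam_etaTilde z zs hz hf hm n) q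
  rw [eta, LinearMap.sub_apply, map_sub, M.adLam_corr z zs hz hf hm, ← LinearMap.add_apply, ← h]
  exact sub_self _

omit hz hf [Module.Finite ℂ 𝔤] in
/-- The Euler derivation, that multiplies the coordinates `r_i` by `1` and kills the invariants. -/
def euler : Derivation ℂ A A :=
  ∑ i, (evalDer M.der (M.r z i)).compDer (M.adLam (W.zsExt zs i))

omit hz hf [Module.Finite ℂ 𝔤] in
theorem euler_apply (v : A) : M.euler z zs v =
    ∑ i, evalDer M.der (M.r z i) (M.adLam (W.zsExt zs i) v) := by
  have h := map_sum (Derivation.coeFnAddMonoidHom (R := ℂ) (A := A) (M := A))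
    (fun i => (evalDer M.der (M.r z i)).compDer (M.adLam (W.zsExt zs i))) Finset.univ
  exact (congrFun h v).trans (Finset.sum_apply _ _ _)

omit hz hf [Module.Finite ℂ 𝔤] in
theorem euler_der (v : A) : M.euler z zs (M.der v) = M.der (M.euler z zs v) := by
  simp only [euler_apply, M.adLam_der, evalDer_shift, map_sum]

omit hz hf [Module.Finite ℂ 𝔤] in
theorem euler_eq_zero {v : A} (hv : ∀ n, M.adLam n v = 0) : M.euler z zs v = 0 := by
  simp only [euler_apply, hv, map_zero, Finset.sum_const_zero]

/-- For the parameter `n = R` the gauge formula reads `R - [R, R]/2 = R`. The vanishing of `[R, R]`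
is `sum_r_mul_el_zs`. -/
theorem euler_r (hm : 0 < W.m) (j : Fin (2 * s + 1)) : M.euler z zs (M.r z j) = M.r z j := by
  simp only [euler_apply, M.adLam_r z hm, evalDer_C]
  rw [Fin.sum_univ_castSucc]
  induction j using Fin.lastCases with
  | cast j =>
    simp only [M.delta_zs z zs hz, zsExt_last, M.delta_eNil z hf, zero_mul, add_zero, ite_mul,
      one_mul, Finset.sum_ite_eq, Finset.mem_univ, if_true]
  | last =>
    simp only [delta_zs_last, zsExt_last, delta_eNil_last, one_mul, neg_mul, smul_mul_assoc]
    rw [Finset.sum_neg_distrib, ← Finset.smul_sum, Finset.sum_congr rfl fun i _ => mul_comm _ _,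
      M.sum_r_mul_el_zs z zs hz, smul_zero, neg_zero, zero_add]

end

end Model

end Datum

theorem der_mem_adjoin {A : Type*} [CommRing A] [Algebra ℂ A] (D : Derivation ℂ A A) {X : Set A}
    (hX : ∀ x ∈ X, D x ∈ Algebra.adjoin ℂ X) {v : A} (hv : v ∈ Algebra.adjoin ℂ X) :
    D v ∈ Algebra.adjoin ℂ X := by
  induction hv using Algebra.adjoin_induction with
  | mem x hx => exact hX x hx
  | algebraMap c => rw [Derivation.map_algebraMap]; exact zero_mem _
  | add u v _ _ hu hv => rw [map_add]; exact add_mem hu hv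
  | mul u v hu' hv' hu hv =>
    rw [Derivation.leibniz, smul_eq_mul, smul_eq_mul]
    exact add_mem (mul_mem hu' hv) (mul_mem hv' hu)

namespace Datum

variable {𝔤 : Type*} [LieRing 𝔤] [LieAlgebra ℂ 𝔤] {W : Datum 𝔤}

theorem cls_mem_genSpace {j : ℕ} (hj : j < W.m) (a : 𝔤) : W.cls j a ∈ W.genSpace :=
  Submodule.mem_sup_left (Submodule.mem_iSup_of_mem j (Submodule.mem_iSup_of_mem hj ⟨a, rfl⟩))

theorem cls_mem_genSpace_of_mem_centF {a : 𝔤} (ha : a ∈ W.centF) : W.cls W.m a ∈ W.genSpace :=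
  Submodule.mem_sup_right ⟨a, ha, rfl⟩

namespace Model

variable {A : Type*} [CommRing A] [Algebra ℂ A] (M : W.Model A)
variable {s : ℕ} (z zs : Module.Basis (Fin (2 * s)) ℂ (gr W.h (1 / 2)))

/-! ### Generators of `𝒱` -/

section

variable (S : Subalgebra ℂ A)

theorem corr_mem (hder : ∀ v ∈ S, M.der v ∈ S) (hr : ∀ i, M.r z i ∈ S) (q : W.gPlus) :
    M.corr z zs q ∈ S := by
  rw [corr_apply]
  refine add_mem (sum_mem fun i _ => mul_mem (S.algebraMap_mem _) (hder _ (hr i)))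
    (S.smul_mem (sum_mem fun i _ => sum_mem fun j _ => mul_mem (S.algebraMap_mem _)
      (mul_mem (hr i) (hder _ (hr j)))) _)

theorem opT_pow_mem (hr : ∀ i, M.r z i ∈ S) (F : W.gPlus →ₗ[ℂ] A) (Q : Set W.gPlus)
    (hQ : ∀ q ∈ Q, F q ∈ S) (hbr : ∀ q ∈ Q, ∀ y, W.br y q ∈ Q) (l : ℕ) :
    ∀ q ∈ Q, (M.opT z zs ^ l) F q ∈ S := by
  induction l with
  | zero => exact hQ
  | succ l ih =>
    intro q hq
    rw [pow_succ', Module.End.mul_apply, opT_apply_apply]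
    exact sum_mem fun i _ => mul_mem (hr i) (ih _ (hbr q hq _))

theorem etaTilde_mem (hr : ∀ i, M.r z i ∈ S) (Q : Set W.gPlus)
    (hQ : ∀ q ∈ Q, M.gen q ∈ S) (hbr : ∀ q ∈ Q, ∀ y, W.br y q ∈ Q) :
    ∀ q ∈ Q, M.etaTilde z zs q ∈ S := by
  intro q hq
  rw [etaTilde_eq, LinearMap.sum_apply]
  exact sum_mem fun l _ => S.smul_mem (M.opT_pow_mem z zs S hr M.gen Q hQ hbr l q hq) _

theorem el_mem_of_mem_gr_half (hr : ∀ i, M.r z i ∈ S) {y : 𝔤} (hy : y ∈ gr W.h (1 / 2)) :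
    M.el W.m y ∈ S := by
  have h := congrArg (gr W.h (1 / 2)).subtype (z.sum_repr ⟨y, hy⟩).symm
  rw [map_sum] at h
  simp only [map_smul] at h
  have h' : y = ∑ i, z.repr ⟨y, hy⟩ i • (z i : 𝔤) := h
  rw [h', el, map_sum, map_sum]
  refine sum_mem fun i _ => ?_
  rw [map_smul, map_smul]
  refine S.smul_mem ?_ _
  have := hr i.castSucc
  rwa [r, zExt_castSucc] at this

theorem el_e_mem : M.el W.m W.e ∈ S := by
  rw [el, M.gen_cls_e]
  exact neg_mem (one_mem S)

variable [Module.Finite ℂ 𝔤] (hf : IsMinimalNilpotent W.f)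

include hf

theorem el_mem_of_mem_nil (hr : ∀ i, M.r z i ∈ S) {n : 𝔤} (hn : n ∈ nil W.h) :
    M.el W.m n ∈ S := by
  obtain ⟨y, hy, c, rfl⟩ := W.exists_eq_add_of_mem_nil hf hn
  rw [el, map_add, map_add, map_smul, map_smul]
  exact add_mem (M.el_mem_of_mem_gr_half z S hr hy) (S.smul_mem (M.el_e_mem S) _)

/-- One bracket with `𝔫` carries `𝔤(≥ 0)` into `𝔫`, whose elements times `z^m` are combinations of
the `r_i` and constants. -/
theorem etaTilde_mem_of_mem_compF (hr : ∀ i, M.r z i ∈ S) {a : 𝔤} (ha : a ∈ W.compF) :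
    M.etaTilde z zs (W.cls W.m a) ∈ S := by
  refine M.etaTilde_mem z zs S hr {q | ∃ a ∈ W.fil 0, M.el W.m a ∈ S ∧ q = W.cls W.m a} ?_ ?_ _
    ⟨a, ?_, ?_, rfl⟩
  · rintro _ ⟨a, -, ha, rfl⟩
    exact ha
  · rintro _ ⟨a, ha, -, rfl⟩ y
    have h : ⁅a, (y : 𝔤)⁆ ∈ W.fil (1 / 2) := W.lie_mem_fil ha y.2 (by norm_num)
    refine ⟨_, (biSup_mono fun i hi => by linarith : W.fil (1 / 2) ≤ W.fil 0) h,
      M.el_mem_of_mem_nil z S hf hr h, W.br_cls _ _ _⟩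
  · have h : W.compF ≤ W.fil 0 := by
      refine sup_le (sup_le (W.gr_le_fil (by norm_num)) ?_) ?_
      · exact (Submodule.span_singleton_le_iff_mem _ _).2 (W.gr_le_fil le_rfl W.x_mem)
      · exact (Submodule.span_singleton_le_iff_mem _ _).2 (W.gr_le_fil (by norm_num) W.e_mem)
    exact h ha
  · have h : W.compF ≤ (Subalgebra.toSubmodule S).comap (M.gen ∘ₗ W.cls W.m) := by
      refine sup_le (sup_le (fun y hy => M.el_mem_of_mem_gr_half z S hr hy) ?_) ?_
      · refine (Submodule.span_singleton_le_iff_mem _ _).2 ?_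
        have := hr (Fin.last _)
        rwa [r, zExt_last] at this
      · exact (Submodule.span_singleton_le_iff_mem _ _).2 (M.el_e_mem S)
    exact h ha

theorem gen_cls_mem_of_lt {j : ℕ} (hj : W.m < j) (a : 𝔤) : M.gen (W.cls j a) ∈ S := by
  obtain ⟨c, hc⟩ := W.cls_eq_smul_of_lt hf hj a
  rw [hc, map_smul, M.gen_cls (-1) (W.m + 1) _ W.f W.f_mem]
  · exact S.smul_mem (S.algebraMap_mem _) _
  · rw [topDeg, W.d_eq_one hf]
    push_cast
    ring

/-- Off the space of generators `η` produces nothing new: on the complement of `𝔤_f` at `z^m`, and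
above `z^m`, its values are polynomials in the `r_i` and their derivatives. -/
theorem eta_mem (hder : ∀ v ∈ S, M.der v ∈ S) (hr : ∀ i, M.r z i ∈ S)
    (heta : ∀ a ∈ W.genSpace, M.eta z zs a ∈ S) (q : W.gPlus) : M.eta z zs q ∈ S := by
  have key : ∀ q, M.etaTilde z zs q ∈ S → M.eta z zs q ∈ S := fun q hq =>
    sub_mem hq (M.corr_mem z zs S hder hr q)
  induction q using W.gPlus_induction with
  | add a b ha hb => rw [map_add]; exact add_mem ha hb
  | cls j a =>
    rcases lt_trichotomy j W.m with hj | rfl | hj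
    · exact heta _ (cls_mem_genSpace hj a)
    · have ha : a ∈ W.centF ⊔ W.compF := by
        rw [(W.isCompl_centF_compF hf).sup_eq_top]
        trivial
      obtain ⟨u, hu, v, hv, rfl⟩ := Submodule.mem_sup.1 ha
      rw [map_add, map_add]
      exact add_mem (heta _ (cls_mem_genSpace_of_mem_centF hu))
        (key _ (M.etaTilde_mem_of_mem_compF z zs S hf hr hv))
    · refine key _ (M.etaTilde_mem z zs S hr {q | ∃ a, q = W.cls j a} ?_ ?_ _ ⟨a, rfl⟩)
      · rintro _ ⟨a, rfl⟩
        exact M.gen_cls_mem_of_lt S hf hj a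
      · rintro _ ⟨a, rfl⟩ y
        exact ⟨_, W.br_cls _ _ _⟩

/-- Since `T⁵ = 0`, the unipotent operator `exp T` is inverted by descending induction on the power
of `T`. -/
theorem gen_mem_of_etaTilde_mem (hr : ∀ i, M.r z i ∈ S) (h : ∀ q, M.etaTilde z zs q ∈ S)
    (q : W.gPlus) : M.gen q ∈ S := by
  have hE : ∀ k q, (M.opT z zs ^ k) (M.etaTilde z zs) q ∈ S := fun k q =>
    M.opT_pow_mem z zs S hr _ Set.univ (fun q _ => h q) (fun _ _ _ => trivial) k q trivial
  have hT : ∀ k, (M.opT z zs ^ k) (M.etaTilde z zs) =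
      ∑ l ∈ Finset.range 5, ((l.factorial : ℂ)⁻¹) • (M.opT z zs ^ (k + l)) M.gen := fun k => by
    rw [etaTilde_eq, map_sum]
    refine Finset.sum_congr rfl fun l _ => ?_
    rw [LinearMap.map_smul_of_tower, pow_add]
    rfl
  have main : ∀ n k, 5 ≤ k + n → ∀ q, (M.opT z zs ^ k) M.gen q ∈ S := by
    intro n
    induction n with
    | zero =>
      intro k hk q
      obtain ⟨j, rfl⟩ := Nat.exists_eq_add_of_le' hk
      rw [pow_add, Module.End.mul_apply, M.opT_five z zs hf, map_zero]
      exact zero_mem S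
    | succ n ih =>
      intro k hk q
      have h1 := LinearMap.congr_fun (hT k) q
      rw [Finset.sum_range_succ', LinearMap.add_apply, Nat.factorial_zero, Nat.cast_one, inv_one,
        one_smul, add_zero] at h1
      rw [← sub_eq_iff_eq_add'.2 h1, LinearMap.sum_apply]
      exact sub_mem (hE k q) (sum_mem fun l _ => S.smul_mem (ih _ (by omega) q) _)
  exact main 5 0 (by omega) q

theorem eq_top_of_eta_mem (hder : ∀ v ∈ S, M.der v ∈ S) (hr : ∀ i, M.r z i ∈ S)
    (heta : ∀ a ∈ W.genSpace, M.eta z zs a ∈ S) : S = ⊤ := by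
  refine Algebra.eq_top_iff.2 fun v => ?_
  refine M.induction (· ∈ S) (M.gen_mem_of_etaTilde_mem z zs S hf hr fun q => ?_) S.algebraMap_mem
    (fun _ _ => add_mem) (fun _ _ => mul_mem) hder v
  have h : M.etaTilde z zs q = M.eta z zs q + M.corr z zs q := by
    rw [eta, LinearMap.sub_apply, sub_add_cancel]
  rw [h]
  exact add_mem (M.eta_mem z zs S hf hder hr heta q) (M.corr_mem z zs S hder hr q)

end

/-! ### The elements `∂^n η(b_i)` generate the W-algebra -/

section

variable (hz : ∀ i j, ⁅(z i : 𝔤), (zs j : 𝔤)⁆ = if i = j then W.e else 0)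
variable [Module.Finite ℂ 𝔤] (hf : IsMinimalNilpotent W.f)

include hz hf

theorem adLam_eq_zero_of_mem_adjoin (hm : 0 < W.m) {ι : Type*} (b : ι → W.gPlus) (n : nil W.h)
    {v : A} (hv : v ∈ Algebra.adjoin ℂ
      (Set.range fun q : ι × ℕ => M.der^[q.2] (M.eta z zs (b q.1)))) : M.adLam n v = 0 := by
  induction hv using Algebra.adjoin_induction with
  | mem x hx =>
    obtain ⟨⟨i, k⟩, rfl⟩ := hx
    induction k with
    | zero => exact M.adLam_eta z zs hz hf hm n _
    | succ k ih =>
      simp only [Function.iterate_succ_apply', M.adLam_der] at ih ⊢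
      rw [ih, map_zero]
  | algebraMap c => exact Derivation.map_algebraMap _ _
  | add u v _ _ hu hv => rw [map_add, hu, hv, add_zero]
  | mul u v _ _ hu hv => rw [Derivation.leibniz, hu, hv, smul_zero, smul_zero, add_zero]

theorem mem_adjoin_of_adLam_eq_zero (hm : 0 < W.m) {ι : Type*} (b : Module.Basis ι ℂ W.genSpace)
    {v : A} (hv : ∀ n, M.adLam n v = 0) : v ∈ Algebra.adjoin ℂ
      (Set.range fun q : ι × ℕ => M.der^[q.2] (M.eta z zs (b q.1))) := by
  set G := Set.range fun q : ι × ℕ => M.der^[q.2] (M.eta z zs (b q.1)) with hG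
  let R := Set.range fun q : Fin (2 * s + 1) × ℕ => M.der^[q.2] (M.r z q.1)
  have hGder : ∀ u ∈ Algebra.adjoin ℂ G, M.der u ∈ Algebra.adjoin ℂ G := fun u hu => by
    refine der_mem_adjoin M.der ?_ hu
    rintro _ ⟨⟨i, k⟩, rfl⟩
    exact Algebra.subset_adjoin ⟨(i, k + 1), Function.iterate_succ_apply' _ _ _⟩
  have htop : Algebra.adjoin ℂ (Algebra.adjoin ℂ G ∪ R : Set A) = ⊤ := by
    refine M.eq_top_of_eta_mem z zs _ hf (fun u hu => ?_) (fun i => ?_) (fun a ha => ?_)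
    · refine der_mem_adjoin M.der ?_ hu
      rintro x (hx | ⟨⟨i, k⟩, rfl⟩)
      · exact Algebra.subset_adjoin (Or.inl (hGder x hx))
      · exact Algebra.subset_adjoin (Or.inr ⟨(i, k + 1), Function.iterate_succ_apply' _ _ _⟩)
    · exact Algebra.subset_adjoin (Or.inr ⟨(i, 0), rfl⟩)
    · refine Algebra.subset_adjoin (Or.inl ?_)
      have h : (⊤ : Submodule ℂ W.genSpace) ≤ (Subalgebra.toSubmodule (Algebra.adjoin ℂ G)).comap
          (M.eta z zs ∘ₗ W.genSpace.subtype) := by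
        rw [← b.span_eq, Submodule.span_le]
        rintro _ ⟨i, rfl⟩
        exact Algebra.subset_adjoin ⟨(i, 0), rfl⟩
      exact h (x := ⟨a, ha⟩) trivial
  refine mem_of_euler (M.euler z zs) _ (fun u hu => M.euler_eq_zero z zs fun n =>
    M.adLam_eq_zero_of_mem_adjoin z zs hz hf hm (fun i => b i) n hu) R ?_ htop
    (M.euler_eq_zero z zs hv)
  rintro _ ⟨⟨i, k⟩, rfl⟩
  induction k with
  | zero => exact M.euler_r z zs hz hf hm i
  | succ k ih =>
    simp only [Function.iterate_succ_apply', M.euler_der] at ih ⊢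
    rw [ih]

end

end Model

end Datum

theorem loopCoef_mem_gr {𝔤 : Type*} [LieRing 𝔤] [LieAlgebra ℂ 𝔤] {h : 𝔤} {d q : ℚ} {a : Loop 𝔤}
    (ha : a ∈ loopGr h d q) (j : ℤ) : loopCoef j a ∈ gr h (q - (d + 1) * j) := by
  induction ha using Submodule.span_induction with
  | zero => rw [map_zero]; exact zero_mem _
  | add u v _ _ hu hv => rw [map_add]; exact add_mem hu hv
  | smul c u _ hu => rw [map_smul]; exact Submodule.smul_mem _ c hu
  | mem u hu =>
    obtain ⟨i, l, b, hb, rfl, rfl⟩ := hu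
    rw [loopCoef_zp]
    split_ifs with hl
    · subst hl
      rwa [add_sub_cancel_left]
    · exact zero_mem _

namespace Datum

variable {𝔤 : Type*} [LieRing 𝔤] [LieAlgebra ℂ 𝔤] {W : Datum 𝔤}

/-! ### The projection of `ĝ⁺` onto the space of generators -/

/-- By invariance, `(f, a) = ([f, x], a) = -(x, [f, a])`. -/
theorem form_f_eq_zero {a : 𝔤} (ha : a ∈ W.centF) : W.form W.f a = 0 := by
  rw [mem_centF] at ha
  have h := W.form_invariant W.f W.x a
  rwa [W.lie_f_x, ha, map_zero, neg_zero] at h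

theorem chiPlus_eq_zero {a : W.gPlus} (ha : a ∈ W.genSpace) : W.chiPlus a = 0 := by
  have h : W.genSpace ≤ LinearMap.ker W.chiPlus := by
    refine sup_le (iSup₂_le fun j hj => ?_) ?_
    · rintro _ ⟨a, rfl⟩
      rw [LinearMap.mem_ker, chiPlus_cls, if_neg hj.ne, if_neg (by omega), neg_zero, sub_zero]
    · rintro _ ⟨a, ha, rfl⟩
      rw [LinearMap.mem_ker, chiPlus_cls, form_f_eq_zero ha, if_pos rfl, if_neg (by omega),
        neg_zero, sub_zero]
  exact h ha

section

variable [Module.Finite ℂ 𝔤] (hf : IsMinimalNilpotent W.f)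

/-- The projection of `ĝ⁺` onto `⨁_{i<m} 𝔤 z^i ⊕ 𝔤_f z^m`. -/
def genProj : W.gPlus →ₗ[ℂ] W.genSpace :=
  LinearMap.codRestrict W.genSpace
    (∑ j : Fin W.m, W.cls j ∘ₗ W.coef hf j j.2.le +
      W.cls W.m ∘ₗ W.centF.subtype ∘ₗ
        W.centF.projectionOnto W.compF (W.isCompl_centF_compF hf) ∘ₗ W.coef hf W.m le_rfl)
    (fun q => by
      rw [LinearMap.add_apply, LinearMap.sum_apply]
      exact add_mem (sum_mem fun j _ => cls_mem_genSpace j.2 _)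
        (cls_mem_genSpace_of_mem_centF (Subtype.prop _)))

theorem coe_genProj (q : W.gPlus) : (genProj hf q : W.gPlus) =
    ∑ j : Fin W.m, W.cls j (W.coef hf j j.2.le q) +
      W.cls W.m (W.centF.projectionOnto W.compF (W.isCompl_centF_compF hf)
        (W.coef hf W.m le_rfl q)) := by
  rw [genProj, LinearMap.codRestrict_apply, LinearMap.add_apply, LinearMap.sum_apply]
  rfl

theorem genProj_of_mem {q : W.gPlus} (hq : q ∈ W.genSpace) : genProj hf q = ⟨q, hq⟩ := by
  have h : W.genSpace ≤ LinearMap.eqLocus (W.genSpace.subtype ∘ₗ genProj hf) LinearMap.id := by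
    refine sup_le (iSup₂_le fun j hj => ?_) ?_
    · rintro _ ⟨a, rfl⟩
      refine (coe_genProj hf _).trans ?_
      rw [coef_cls, if_neg hj.ne, map_zero, Submodule.coe_zero, map_zero, add_zero]
      simp only [coef_cls]
      rw [Finset.sum_eq_single ⟨j, hj⟩]
      · rw [if_pos rfl, LinearMap.id_apply]
      · intro l _ hl
        rw [if_neg fun h => hl (Fin.ext h.symm), map_zero]
      · exact fun h => absurd (Finset.mem_univ _) h
    · rintro _ ⟨a, ha, rfl⟩
      refine (coe_genProj hf _).trans ?_
      have ha' : a ∈ W.centF := ha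
      rw [coef_cls, if_pos rfl, Submodule.projectionOnto_apply_of_mem_left _ ha',
        Finset.sum_eq_zero, zero_add, LinearMap.id_apply]
      intro l _
      rw [coef_cls, if_neg l.2.ne', map_zero]
  exact Subtype.ext (h hq)

theorem genProj_eq_zero {q : W.gPlus} (h : ∀ j (hj : j < W.m), W.coef hf j hj.le q = 0)
    (hm : W.coef hf W.m le_rfl q ∈ W.compF) : genProj hf q = 0 := by
  refine Subtype.ext ?_
  rw [coe_genProj, Submodule.projectionOnto_apply_of_mem_right _ hm, Submodule.coe_zero, map_zero,
    add_zero, Submodule.coe_zero]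
  exact Finset.sum_eq_zero fun j _ => by rw [h j j.2, map_zero]

theorem genProj_cls_of_mem_compF {a : 𝔤} (ha : a ∈ W.compF) : genProj hf (W.cls W.m a) = 0 := by
  refine genProj_eq_zero hf (fun j hj => ?_) ?_
  · rw [coef_cls, if_neg hj.ne']
  · rwa [coef_cls, if_pos rfl]

/-- In degree `2m + 1` the coefficients below `z^m` vanish and the one at `z^m` lies in `ℂ e`. So
the relations constrain only the `χ`-part of `genPoly`, and it descends to `𝒱`. -/
theorem genProj_mkQ {a : loopNonneg 𝔤} (ha : (a : Loop 𝔤) ∈ loopGr W.h W.d W.topDeg) :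
    genProj hf (W.high.mkQ a) = 0 := by
  have hc : ∀ (j : ℕ) (hj : j ≤ W.m), W.coef hf j hj (W.high.mkQ a) ∈ gr W.h (W.topDeg - (W.d + 1) * j) :=
    fun j hj => by
      have := loopCoef_mem_gr ha (j : ℤ)
      exact_mod_cast this
  refine genProj_eq_zero hf (fun j hj => ?_) ?_
  · refine W.eq_zero_of_mem_gr hf (Or.inr ?_) (hc j hj.le)
    have h1 : (j : ℚ) + 1 ≤ W.m := by exact_mod_cast hj
    rw [topDeg, W.d_eq_one hf]
    linarith
  · have h1 := hc W.m le_rfl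
    rw [topDeg, add_sub_cancel_left] at h1
    obtain ⟨c, hc⟩ := W.exists_eq_smul_e hf h1
    rw [hc]
    exact Submodule.mem_sup_right (Submodule.smul_mem _ c (Submodule.mem_span_singleton_self _))

end

namespace Model

variable {A : Type*} [CommRing A] [Algebra ℂ A] (M : W.Model A)
variable {s : ℕ} (z zs : Module.Basis (Fin (2 * s)) ℂ (gr W.h (1 / 2)))

/-! ### Algebraic independence -/

variable [Module.Finite ℂ 𝔤] (hf : IsMinimalNilpotent W.f)

/-- The linear map `ĝ⁺ → ℂ[X_{i,n}]` that sends the basis elements `b_i` to `X_{i,0}`. -/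
def genPoly {ι : Type*} (b : Module.Basis ι ℂ W.genSpace) :
    W.gPlus →ₗ[ℂ] MvPolynomial (ι × ℕ) ℂ :=
  b.constr ℂ (fun i => MvPolynomial.X (i, 0)) ∘ₗ genProj hf +
    Algebra.linearMap ℂ (MvPolynomial (ι × ℕ) ℂ) ∘ₗ W.chiPlus

/-- The derivation of `ℂ[X_{i,n}]` with `X_{i,n} ↦ X_{i,n+1}`. -/
def polyDer (ι : Type*) : Derivation ℂ (MvPolynomial (ι × ℕ) ℂ) (MvPolynomial (ι × ℕ) ℂ) :=
  MvPolynomial.mkDerivation ℂ fun q => MvPolynomial.X (q.1, q.2 + 1)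

theorem polyDer_iterate {ι : Type*} (i : ι) (n : ℕ) :
    (polyDer ι)^[n] (MvPolynomial.X (i, 0)) = MvPolynomial.X (i, n) := by
  induction n with
  | zero => rfl
  | succ n ih => rw [Function.iterate_succ_apply', ih, polyDer, MvPolynomial.mkDerivation_X]

theorem genPoly_mkQ {ι : Type*} (b : Module.Basis ι ℂ W.genSpace) (a : loopNonneg 𝔤)
    (ha : (a : Loop 𝔤) ∈ loopGr W.h W.d W.topDeg) :
    genPoly hf b (W.high.mkQ a) = algebraMap ℂ _ (W.chi a) := by
  rw [genPoly, LinearMap.add_apply, LinearMap.comp_apply, genProj_mkQ hf ha, map_zero, zero_add]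
  rfl

theorem genPoly_basis {ι : Type*} (b : Module.Basis ι ℂ W.genSpace) (i : ι) :
    genPoly hf b (b i) = MvPolynomial.X (i, 0) := by
  rw [genPoly, LinearMap.add_apply, LinearMap.comp_apply, LinearMap.comp_apply,
    chiPlus_eq_zero (b i).2, map_zero, add_zero, genProj_of_mem hf (b i).2]
  exact b.constr_basis ℂ _ i

theorem genPoly_zExt {ι : Type*} (b : Module.Basis ι ℂ W.genSpace) (i : Fin (2 * s + 1)) :
    genPoly hf b (W.cls W.m (W.zExt z i)) = 0 := by
  have h : W.zExt z i ∈ W.compF ∧ W.form W.f (W.zExt z i) = 0 := by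
    induction i using Fin.lastCases with
    | cast i =>
      rw [zExt_castSucc]
      exact ⟨Submodule.mem_sup_left (Submodule.mem_sup_left (z i).2),
        W.form_eq_zero (by norm_num) W.f_mem (z i).2⟩
    | last =>
      rw [zExt_last]
      exact ⟨Submodule.mem_sup_left (Submodule.mem_sup_right (Submodule.mem_span_singleton_self _)),
        W.form_eq_zero (by norm_num) W.f_mem W.x_mem⟩
  rw [genPoly, LinearMap.add_apply, LinearMap.comp_apply, LinearMap.comp_apply,
    genProj_cls_of_mem_compF hf h.1, chiPlus_cls, h.2, if_pos rfl, if_neg (by omega)]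
  simp

/-- `Ψ` is restriction to the slice where all `r_i` and their derivatives vanish. It kills `corr`
and every positive power of `T`, so it sees `η` as `genPoly` and is a left inverse of evaluation at
the `∂^n η(b_i)`. -/
theorem algebraicIndependent {ι : Type*} (b : Module.Basis ι ℂ W.genSpace)
    (Ψ : A →ₐ[ℂ] MvPolynomial (ι × ℕ) ℂ) (hgen : ∀ a, Ψ (M.gen a) = genPoly hf b a)
    (hder : ∀ v, Ψ (M.der v) = polyDer ι (Ψ v)) :
    AlgebraicIndependent ℂ (fun q : ι × ℕ => M.der^[q.2] (M.eta z zs (b q.1))) := by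
  have hr : ∀ i, Ψ (M.r z i) = 0 := fun i => (hgen _).trans (genPoly_zExt z hf b i)
  have hcorr : ∀ q, Ψ (M.corr z zs q) = 0 := fun q => by
    simp only [corr_apply, map_add, map_smul, map_sum, map_mul, hr, hder, map_zero, mul_zero,
      Finset.sum_const_zero, smul_zero, add_zero]
  have hT : ∀ l q, Ψ ((M.opT z zs ^ (l + 1)) M.gen q) = 0 := fun l q => by
    simp only [pow_succ', Module.End.mul_apply, opT_apply_apply, map_sum, smul_eq_mul, map_mul, hr,
      zero_mul, Finset.sum_const_zero]
  have heta : ∀ q, Ψ (M.eta z zs q) = genPoly hf b q := fun q => by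
    rw [eta, LinearMap.sub_apply, map_sub, hcorr, sub_zero, etaTilde_eq, LinearMap.sum_apply,
      map_sum, Finset.sum_range_succ']
    simp only [LinearMap.smul_apply, map_smul, hT, smul_zero, Finset.sum_const_zero, zero_add]
    simp [hgen]
  have hX : ∀ i n, Ψ (M.der^[n] (M.eta z zs (b i))) = MvPolynomial.X (i, n) := fun i n => by
    rw [← polyDer_iterate, ← genPoly_basis hf b i, ← heta]
    exact Function.Semiconj.iterate_right hder n _
  have hid : Ψ.comp (MvPolynomial.aeval
      (fun q : ι × ℕ => M.der^[q.2] (M.eta z zs (b q.1)))) = AlgHom.id ℂ _ :=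
    MvPolynomial.algHom_ext fun q => by
      rw [AlgHom.comp_apply, MvPolynomial.aeval_X, hX, AlgHom.id_apply]
  exact Function.LeftInverse.injective (g := Ψ) fun p => DFunLike.congr_fun hid p

/-! ### The defining properties of `η` -/

omit [Module.Finite ℂ 𝔤] hf in
theorem corr_eq_zero {q : W.gPlus} (hq : ∀ y, W.pair y q = 0) : M.corr z zs q = 0 := by
  simp only [corr_apply, kPair_apply, hq, mul_zero, map_zero, zero_mul, Finset.sum_const_zero,
    smul_zero, add_zero]

omit [Module.Finite ℂ 𝔤] hf in
theorem corr_cls_of_ne_zero {j : ℕ} (hj : j ≠ 0) (a : 𝔤) : M.corr z zs (W.cls j a) = 0 :=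
  M.corr_eq_zero z zs fun y => by rw [pair_cls, if_neg hj]

omit [Module.Finite ℂ 𝔤] hf in
theorem corr_cls_zero_of_nonneg {i : ℚ} (hi : 0 ≤ i) {a : 𝔤} (ha : a ∈ gr W.h i) :
    M.corr z zs (W.cls 0 a) = 0 :=
  M.corr_eq_zero z zs fun y => by
    rw [pair_cls, if_pos rfl]
    exact W.form_eq_zero_of_mem_fil (i := 1 / 2) (by linarith) y.2 (W.gr_le_fil le_rfl ha)

omit [Module.Finite ℂ 𝔤] hf in
theorem corr_cls_neg_half {b : 𝔤} (hb : b ∈ gr W.h (-1 / 2)) :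
    M.corr z zs (W.cls 0 b) = ∑ i, (W.form (zs i) b * W.k) • M.der (M.el W.m (z i)) := by
  have h : ∀ y y', W.pair (W.nb y y') (W.cls 0 b) = 0 := fun y y' => by
    rw [pair_cls, if_pos rfl]
    exact W.form_eq_zero_of_mem_fil (i := 1) (j := -1 / 2) (by norm_num)
      (W.lie_mem_fil y.2 y'.2 (by norm_num)) (W.gr_le_fil le_rfl hb)
  have he : W.form W.e b = 0 := W.form_eq_zero (by norm_num) W.e_mem hb
  simp only [corr_apply, kPair_apply, h, map_zero, zero_mul, Finset.sum_const_zero,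
    smul_zero, add_zero, Fin.sum_univ_castSucc, zsExt_last, pair_cls, if_true, zsExt_castSucc, r,
    zExt_castSucc, ← Algebra.smul_def, mul_comm W.k]
  rw [eNil, he, zero_mul, zero_smul, add_zero]

variable (hz : ∀ i j, ⁅(z i : 𝔤), (zs j : 𝔤)⁆ = if i = j then W.e else 0)

-- In `𝔫` only the `e`-component pairs with `f`. It gives the term in `x` from the single sum, while
-- in the double sum `[z_i^*, z_j^*] ∈ ℂ e` reassembles the `r_j` into `z_i^* z^m`.
include hz hf in
theorem corr_cls_f : M.corr z zs (W.cls 0 W.f) = W.k • M.der (M.el W.m W.x) +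
    (W.k / 2) • ∑ i, M.der (M.el W.m (zs i)) * M.el W.m (z i) := by
  have he : ∀ y : nil W.h, kPair (A := A) (W.cls 0 W.f) y =
      algebraMap ℂ A (W.k * W.form y W.f) := fun y => by rw [kPair_apply, pair_cls, if_pos rfl]
  have h0 : ∀ i, W.form (zs i) W.f = 0 := fun i =>
    W.form_eq_zero (by norm_num) (zs i).2 W.f_mem
  have h1 : ∀ i j : Fin (2 * s), W.nb (W.zsExt zs i.castSucc) (W.zsExt zs j.castSucc) =
      z.repr (zs i) j • W.eNil := fun i j => Subtype.ext (by
    rw [coe_nb, zsExt_castSucc, zsExt_castSucc, W.lie_zs z zs hz]; rfl)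
  have h2 : ∀ y, W.nb y W.eNil = 0 := fun y => by rw [nb_skew, W.nb_eNil hf, neg_zero]
  have h3 : kPair (A := A) (W.cls 0 W.f) W.eNil = algebraMap ℂ A W.k := by
    rw [he, eNil, W.form_e_f, mul_one]
  rw [corr_apply]
  simp only [Fin.sum_univ_castSucc, zsExt_last, h1, h2, W.nb_eNil hf, map_zero, map_smul,
    zero_mul, add_zero, Finset.sum_const_zero, h3]
  simp only [he, zsExt_castSucc, h0, mul_zero, map_zero, zero_mul, Finset.sum_const_zero, zero_add]
  congr 1
  · rw [← Algebra.smul_def, r, zExt_last]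
  · rw [Finset.smul_sum, Finset.smul_sum]
    refine Finset.sum_congr rfl fun i _ => ?_
    rw [M.el_zs z zs, map_sum, Finset.sum_mul, Finset.smul_sum, Finset.smul_sum]
    refine Finset.sum_congr rfl fun j _ => ?_
    have hk : W.k / 2 = W.k * (1 / 2) := by ring
    rw [Derivation.map_smul, ← zExt_castSucc W z i, hk]
    simp only [Algebra.smul_def, map_mul, r, el]
    ring

end Model

variable (W) in
theorem eta_isEta [Module.Finite ℂ 𝔤] (hf : IsMinimalNilpotent W.f) (hm : 0 < W.m) {s : ℕ}
    (z zs : Module.Basis (Fin (2 * s)) ℂ (gr W.h (1 / 2)))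
    (hz : ∀ i j, ⁅(z i : 𝔤), (zs j : 𝔤)⁆ = if i = j then W.e else 0) :
    W.IsEta z zs (W.model.eta z zs) where
  nonneg i hi a ha := by
    have h : W.model.eta z zs (W.cls 0 a) = W.model.etaTilde z zs (W.cls 0 a) -
      W.model.corr z zs (W.cls 0 a) := rfl
    rw [h, W.model.corr_cls_zero_of_nonneg z zs hi ha]
    exact sub_zero _
  middle t ht _ a := by
    have h : W.model.eta z zs (W.cls t a) = W.model.etaTilde z zs (W.cls t a) -
      W.model.corr z zs (W.cls t a) := rfl
    rw [h, W.model.corr_cls_of_ne_zero z zs (by omega)]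
    exact sub_zero _
  top a _ := by
    have h : W.model.eta z zs (W.cls W.m a) = W.model.etaTilde z zs (W.cls W.m a) -
      W.model.corr z zs (W.cls W.m a) := rfl
    rw [h, W.model.corr_cls_of_ne_zero z zs hm.ne']
    exact sub_zero _
  neg_half b hb := congrArg (W.model.etaTilde z zs (W.cls 0 b) - ·)
    (W.model.corr_cls_neg_half z zs hb)
  neg_one := (congrArg (W.model.etaTilde z zs (W.cls 0 W.f) - ·)
    (W.model.corr_cls_f z zs hf hz)).trans (sub_add_eq_sub_sub _ _ _)

theorem IsEta.eq_of_mem_genSpace [Module.Finite ℂ 𝔤] (hf : IsMinimalNilpotent W.f) {s : ℕ}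
    {z zs : Fin (2 * s) → gr W.h (1 / 2)} {η η' : W.gPlus →ₗ[ℂ] W.V} (h : W.IsEta z zs η)
    (h' : W.IsEta z zs η') {a : W.gPlus} (ha : a ∈ W.genSpace) : η a = η' a := by
  have hle : W.genSpace ≤ LinearMap.eqLocus η η' := by
    refine sup_le (iSup₂_le fun j hj => ?_) ?_
    · rintro _ ⟨a, rfl⟩
      rcases Nat.eq_zero_or_pos j with rfl | hj0
      · induction a using W.gr_induction hf with
        | add a b ha hb => rw [map_add]; exact add_mem ha hb
        | mem i hi a ha =>
          simp only [Set.mem_insert_iff, Set.mem_singleton_iff] at hi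
          rcases hi with rfl | rfl | hi
          -- The value on `𝔤(-1) z^0` is prescribed only at `f`, which suffices because `𝔤(-1) = ℂ
          -- f`.
          · obtain ⟨c, rfl⟩ := W.exists_eq_smul_f hf ha
            rw [map_smul]
            exact Submodule.smul_mem _ c (h.neg_one.trans h'.neg_one.symm)
          · exact (h.neg_half a ha).trans (h'.neg_half a ha).symm
          · have hi0 : 0 ≤ i := by rcases hi with rfl | rfl | rfl <;> norm_num
            exact (h.nonneg i hi0 a ha).trans (h'.nonneg i hi0 a ha).symm
      · exact (h.middle j hj0 hj a).trans (h'.middle j hj0 hj a).symm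
    · rintro _ ⟨a, ha, rfl⟩
      have ha' : ⁅a, W.f⁆ = 0 := by rw [← lie_skew, W.mem_centF.1 ha, neg_zero]
      exact (h.top a ha').trans (h'.top a ha').symm
  exact hle ha

end Datum

end FractionalW

end

theorem mainTheorem7 {𝔤 : Type*} [LieRing 𝔤] [LieAlgebra ℂ 𝔤] [Module.Finite ℂ 𝔤]
    [LieAlgebra.IsSimple ℂ 𝔤] (W : FractionalW.Datum 𝔤)
    (hf : FractionalW.IsMinimalNilpotent W.f) (hm : 0 < W.m) (s : ℕ)
    (z zs : Module.Basis (Fin (2 * s)) ℂ (FractionalW.gr W.h (1 / 2)))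
    (hz : ∀ i j, ⁅(z i : 𝔤), (zs j : 𝔤)⁆ = if i = j then W.e else 0) :
    (∃ η : W.gPlus →ₗ[ℂ] W.V, W.IsEta z zs η) ∧
    ∀ η : W.gPlus →ₗ[ℂ] W.V, W.IsEta z zs η →
      ∀ (ι : Type*) (b : Module.Basis ι ℂ W.genSpace),
        FractionalW.FreelyDiffGenerates W.der (fun i => η (b i)) W.walg := by
  have hη₀ := W.eta_isEta hf hm z zs hz
  refine ⟨⟨_, hη₀⟩, fun η hη ι b => ?_⟩
  have hb : (fun i => η (b i)) = fun i => W.model.eta z zs (b i) :=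
    funext fun i => hη.eq_of_mem_genSpace hf hη₀ (b i).2
  rw [hb]
  obtain ⟨Ψ, hgen, hder⟩ := W.exists_lift (FractionalW.Datum.Model.polyDer ι)
    (FractionalW.Datum.Model.genPoly hf b) (FractionalW.Datum.Model.genPoly_mkQ hf b)
  refine ⟨W.model.algebraicIndependent z zs hf b Ψ hgen hder, le_antisymm (fun v hv n => ?_)
    fun v hv => ?_⟩
  · exact W.model.adLam_eq_zero_of_mem_adjoin z zs hz hf hm (fun i => (b i : W.gPlus)) n hv
  · exact W.model.mem_adjoin_of_adLam_eq_zero z zs hz hf hm b hv
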